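/- For every integer $n\ge 0$ let $\Sigma_n$ be a closed oriented surface of genus $n$ (that is, a surface homeomorphic to the connected sum of $n$ copies of the torus $T^2$, with $\Sigma_0=S^2$), and let $\#_n(S^2\times S^1)$ be the connected sum of $n$ copies of $S^2\times S^1$, where the empty connected sum is $\#_0(S^2\times S^1)=S^3$. Then $\Sigma_n\times S^1$ is a $\pi_1$-surjective branched double covering of $\#_n(S^2\times S^1)$: there is a continuous map $f\colon \Sigma_n\times S^1\to \#_n(S^2\times S^1)$ such that (1) $f$ is a branched double covering, i.e. there is a closed subset $B$ of $\#_n(S^2\times S^1)$ such that $f$ is a two-sheeted covering over the complement of $B$, and every point of $B$ has an open neighbourhood $U$ for which there are homeomorphisms $f^{-1}(U)\cong\mathbb{C}\times\mathbb{R}$ and $U\cong\mathbb{C}\times\mathbb{R}$, the latter carrying $U\cap B$ onto $\{0\}\times\mathbb{R}$, in which $f$ becomes $(z,t)\mapsto(z^2,t)$; (2) $f$ induces a surjection on fundamental groups. -/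

import Mathlib

open Set Metric Topology

noncomputable section

/-- Euclidean space `ℝᵈ`. -/
abbrev Euc (d : ℕ) : Type := EuclideanSpace ℝ (Fin d)

/-- The round unit sphere `Sᵈ ⊆ ℝᵈ⁺¹`. -/
abbrev Sph (d : ℕ) : Type := sphere (0 : Euc (d + 1)) 1

/-! ### Coordinate balls -/

/-- A (tame) coordinate `d`-ball in `M`: a map which embeds the ball of radius `2` of `ℝᵈ`
homeomorphically onto an open subset of `M`.  The closed `d`-ball itself is the image of the closed
unit ball; its boundary sphere is bicollared in `M`. -/
structure CoordBall (d : ℕ) (M : Type*) [TopologicalSpace M] where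
  toFun : Euc d → M
  isOpenEmbedding : IsOpenEmbedding fun v : ball (0 : Euc d) 2 => toFun v

/-- The closed ball underlying a coordinate ball. -/
def CoordBall.closed {d : ℕ} {M : Type*} [TopologicalSpace M] (φ : CoordBall d M) : Set M :=
  φ.toFun '' closedBall 0 1

/-- The interior of the ball underlying a coordinate ball. -/
def CoordBall.interior {d : ℕ} {M : Type*} [TopologicalSpace M] (φ : CoordBall d M) : Set M :=
  φ.toFun '' ball 0 1

/-! ### Connected sums -/

section ConnectedSum

variable {d : ℕ} {ι : Type*} {X : Type*} [TopologicalSpace X]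
  {M : ι → Type*} [∀ i, TopologicalSpace (M i)]

/-- `X` with the interiors of the balls `φ i` removed, together with, for each `i`, the space `M i`
with the interior of the ball `ψ i` removed. -/
abbrev ConnSumPieces (φ : ι → CoordBall d X) (ψ : ∀ i, CoordBall d (M i)) : Type _ :=
  {x : X // ∀ i, x ∉ (φ i).interior} ⊕ (Σ i, {y : M i // y ∉ (ψ i).interior})

/-- The identification of the `i`-th boundary sphere of the punctured `X` with the boundary sphere of
the punctured `M i`, matching the points with the same coordinates. -/
inductive ConnSumRel (φ : ι → CoordBall d X) (ψ : ∀ i, CoordBall d (M i)) :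
    ConnSumPieces φ ψ → ConnSumPieces φ ψ → Prop
  | glue (i : ι) (v : Euc d) (hv : ‖v‖ = 1)
      (x : {x : X // ∀ i, x ∉ (φ i).interior}) (hx : x.1 = (φ i).toFun v)
      (y : {y : M i // y ∉ (ψ i).interior}) (hy : y.1 = (ψ i).toFun v) :
      ConnSumRel φ ψ (Sum.inl x) (Sum.inr ⟨i, y⟩)

/-- The connected sum of `X` with all the `M i`: for every `i` the interiors of the balls `φ i` in
`X` and `ψ i` in `M i` are removed and the resulting boundary spheres are glued.  The closed
balls `φ i` in `X` are pairwise disjoint, so for `ι = {1, …, n}` this is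
`X # M 1 # ⋯ # M n`.  (If `X` and the `M i` are oriented, the `φ i` preserving and the `ψ i`
reversing orientation, this is the oriented connected sum.) -/
def ConnSum (φ : ι → CoordBall d X)
    (_hφ : Pairwise fun i j => Disjoint (φ i).closed (φ j).closed)
    (ψ : ∀ i, CoordBall d (M i)) : Type _ :=
  Quot (ConnSumRel φ ψ)

instance (φ : ι → CoordBall d X) (hφ : Pairwise fun i j => Disjoint (φ i).closed (φ j).closed)
    (ψ : ∀ i, CoordBall d (M i)) : TopologicalSpace (ConnSum φ hφ ψ) :=
  inferInstanceAs (TopologicalSpace (Quot (ConnSumRel φ ψ)))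

end ConnectedSum

/-! ### Disjoint balls in the sphere -/

/-- Inverse stereographic projection from the north pole,
`y ↦ (2 y, ‖y‖² - 1) / (‖y‖² + 1)`, as a map into `ℝᵈ⁺¹`. -/
def stereoInvVec {d : ℕ} (y : Euc d) : Euc (d + 1) :=
  WithLp.toLp 2 (Fin.snoc (α := fun _ => ℝ) (fun i => 2 * y i / (‖y‖ ^ 2 + 1))
    ((‖y‖ ^ 2 - 1) / (‖y‖ ^ 2 + 1)))

theorem stereoInvVec_castSucc {d : ℕ} (y : Euc d) (i : Fin d) :
    stereoInvVec y i.castSucc = 2 * y i / (‖y‖ ^ 2 + 1) := by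
  simp [stereoInvVec]

theorem stereoInvVec_last {d : ℕ} (y : Euc d) :
    stereoInvVec y (Fin.last d) = (‖y‖ ^ 2 - 1) / (‖y‖ ^ 2 + 1) := by
  simp [stereoInvVec]

theorem stereoInvVec_mem {d : ℕ} (y : Euc d) :
    stereoInvVec y ∈ sphere (0 : Euc (d + 1)) 1 := by
  have h : ‖stereoInvVec y‖ ^ 2 = 1 := by
    rw [EuclideanSpace.real_norm_sq_eq, Fin.sum_univ_castSucc]
    simp only [stereoInvVec_castSucc, stereoInvVec_last, div_pow, mul_pow]
    rw [← Finset.sum_div, ← Finset.mul_sum, ← EuclideanSpace.real_norm_sq_eq]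
    field_simp
    ring
  rw [mem_sphere_zero_iff_norm]
  exact (pow_eq_one_iff_of_nonneg (norm_nonneg _) two_ne_zero).1 h

/-- Inverse stereographic projection `ℝᵈ → Sᵈ`. -/
def stereoInv {d : ℕ} (y : Euc d) : Sph d := ⟨stereoInvVec y, stereoInvVec_mem y⟩

theorem stereoInv_isOpenEmbedding {d : ℕ} : IsOpenEmbedding (stereoInv : Euc d → Sph d) := by
  have hc : Continuous (stereoInv : Euc d → Sph d) := by
    refine Continuous.subtype_mk ?_ _
    refine (PiLp.continuous_toLp 2 _).comp (continuous_pi fun i => ?_)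
    have h0 : ∀ y : Euc d, ‖y‖ ^ 2 + 1 ≠ 0 := fun y => by positivity
    refine Fin.lastCases ?_ (fun j => ?_) i
    · simp only [Fin.snoc_last]
      exact Continuous.div (by fun_prop) (by fun_prop) h0
    · simp only [Fin.snoc_castSucc]
      exact Continuous.div (by fun_prop) (by fun_prop) h0
  let U : Set (Sph d) := {x | x.1 (Fin.last d) ≠ 1}
  have hU : IsOpen U := by
    have : Continuous fun x : Sph d => x.1 (Fin.last d) := by fun_prop
    exact isOpen_ne.preimage this
  let g : Sph d → Euc d := fun x =>
    WithLp.toLp 2 fun i => x.1 i.castSucc / (1 - x.1 (Fin.last d))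
  have hg : ContinuousOn g U := by
    refine (PiLp.continuous_toLp 2 _).comp_continuousOn (continuousOn_pi.2 fun i => ?_)
    refine ContinuousOn.div (by fun_prop) (by fun_prop) fun x hx => ?_
    exact sub_ne_zero.2 (Ne.symm hx)
  have hl : ∀ y : Euc d, 1 - stereoInvVec y (Fin.last d) = 2 / (‖y‖ ^ 2 + 1) := fun y => by
    have h0 : ‖y‖ ^ 2 + 1 ≠ 0 := by positivity
    rw [stereoInvVec_last]
    field_simp
    ring
  have hmem : ∀ y : Euc d, stereoInv y ∈ U := fun y h => by
    have h1 := hl y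
    have h2 : stereoInvVec y (Fin.last d) = 1 := h
    have h0 : (0 : ℝ) < 2 / (‖y‖ ^ 2 + 1) := by positivity
    rw [h2] at h1
    linarith
  have hgl : ∀ y : Euc d, g (stereoInv y) = y := fun y => by
    have h0 : ‖y‖ ^ 2 + 1 ≠ 0 := by positivity
    ext i
    change stereoInvVec y i.castSucc / (1 - stereoInvVec y (Fin.last d)) = y i
    rw [hl, stereoInvVec_castSucc]
    field_simp
  have hgr : ∀ x ∈ U, stereoInv (g x) = x := fun x hx => by
    have hx1 : 1 - x.1 (Fin.last d) ≠ 0 := sub_ne_zero.2 (Ne.symm hx)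
    have hs : ∑ i : Fin d, x.1 i.castSucc ^ 2 + x.1 (Fin.last d) ^ 2 = 1 := by
      rw [← Fin.sum_univ_castSucc (fun i => x.1 i ^ 2), ← EuclideanSpace.real_norm_sq_eq,
        mem_sphere_zero_iff_norm.1 x.2, one_pow]
    have hn : ‖g x‖ ^ 2 = (1 + x.1 (Fin.last d)) / (1 - x.1 (Fin.last d)) := by
      rw [EuclideanSpace.real_norm_sq_eq]
      simp only [g, div_pow]
      rw [← Finset.sum_div]
      field_simp
      linarith
    have hn1 : ‖g x‖ ^ 2 + 1 = 2 / (1 - x.1 (Fin.last d)) := by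
      rw [hn]; field_simp; ring
    apply Subtype.ext
    ext i
    change stereoInvVec (g x) i = x.1 i
    refine Fin.lastCases ?_ (fun j => ?_) i
    · rw [stereoInvVec_last, hn1, hn]; field_simp; ring
    · rw [stereoInvVec_castSucc, hn1]; simp only [g]; field_simp
  let e : OpenPartialHomeomorph (Euc d) (Sph d) :=
    { toFun := stereoInv
      invFun := g
      source := univ
      target := U
      map_source' := fun y _ => hmem y
      map_target' := fun _ _ => mem_univ _
      left_inv' := fun y _ => hgl y
      right_inv' := fun x hx => hgr x hx
      open_source := isOpen_univ
      open_target := hU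
      continuousOn_toFun := hc.continuousOn
      continuousOn_invFun := hg }
  exact e.isOpenEmbedding rfl

/-- The `k`-th standard ball in `Sᵈ`: in stereographic coordinates, the unit ball centred at
`(3k, 0, …, 0)`. -/
def sphBall (d : ℕ) [NeZero d] (k : ℕ) : CoordBall d (Sph d) where
  toFun v := stereoInv (EuclideanSpace.single 0 (3 * (k : ℝ)) + v)
  isOpenEmbedding := by
    have h1 : IsOpenEmbedding fun v : Euc d => EuclideanSpace.single 0 (3 * (k : ℝ)) + v :=
      (Homeomorph.addLeft (EuclideanSpace.single (0 : Fin d) (3 * (k : ℝ)))).isOpenEmbedding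
    have h2 : IsOpenEmbedding fun v : ball (0 : Euc d) 2 => (v : Euc d) :=
      isOpen_ball.isOpenEmbedding_subtypeVal
    exact stereoInv_isOpenEmbedding.comp (h1.comp h2)

theorem sphBall_disjoint (d : ℕ) [NeZero d] (n : ℕ) :
    Pairwise fun i j : Fin n => Disjoint (sphBall d i).closed (sphBall d j).closed := by
  intro i j hij
  rw [Set.disjoint_left]
  rintro _ ⟨v, hv, rfl⟩ ⟨w, hw, h⟩
  have h1 := stereoInv_isOpenEmbedding.injective h
  have h2 : 3 * ((j : ℕ) : ℝ) + w 0 = 3 * ((i : ℕ) : ℝ) + v 0 := by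
    simpa using congrArg (fun z : Euc d => z 0) h1
  have hv0 : |v 0| ≤ 1 := (PiLp.norm_apply_le v 0).trans (mem_closedBall_zero_iff.1 hv)
  have hw0 : |w 0| ≤ 1 := (PiLp.norm_apply_le w 0).trans (mem_closedBall_zero_iff.1 hw)
  have hne : ((i : ℕ) : ℤ) - ((j : ℕ) : ℤ) ≠ 0 := by
    intro h; exact hij (Fin.ext (by omega))
  have h3 : (1 : ℝ) ≤ |((i : ℕ) : ℝ) - ((j : ℕ) : ℝ)| := by
    exact_mod_cast Int.one_le_abs hne
  have h4 : |3 * (((i : ℕ) : ℝ) - ((j : ℕ) : ℝ))| ≤ 2 := by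
    have : 3 * (((i : ℕ) : ℝ) - ((j : ℕ) : ℝ)) = w 0 - v 0 := by linarith
    rw [this]
    exact (abs_sub _ _).trans (by linarith)
  rw [abs_mul, abs_of_pos (by norm_num : (0 : ℝ) < 3)] at h4
  linarith

/-- The `n`-fold connected sum `#ₙ M` of a space `M` with itself, performed at the coordinate
ball `ψ`: the connected sum of the sphere `Sᵈ` with `n` copies of `M`.  For `n = 0` this is `Sᵈ`. -/
abbrev NFoldConnSum {d : ℕ} [NeZero d] {M : Type*} [TopologicalSpace M] (n : ℕ)
    (ψ : CoordBall d M) : Type _ :=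
  ConnSum (fun i : Fin n => sphBall d i) (sphBall_disjoint d n) (fun _ => ψ)

/-! ### The surface of genus `n` and the connected sum of `n` copies of `S² × S¹` -/

theorem circleExp_injOn : InjOn Circle.exp (Ioo (-2) 2) := by
  intro a ha b hb h
  exact Circle.injective_arg.eq_iff.2 h |> fun h' => by
    have hpi := Real.pi_gt_three
    rwa [Circle.arg_exp (by linarith [ha.1]) (by linarith [ha.2]),
      Circle.arg_exp (by linarith [hb.1]) (by linarith [hb.2])] at h'

theorem abs_coord_lt {d : ℕ} {v : Euc d} (hv : v ∈ ball (0 : Euc d) 2) (i : Fin d) :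
    v i ∈ Ioo (-2 : ℝ) 2 :=
  abs_lt.1 ((PiLp.norm_apply_le v i).trans_lt (mem_ball_zero_iff.1 hv))

/-- The standard disc in the torus `S¹ × S¹`: the image of the round unit disc under
`(s, t) ↦ (e^{is}, e^{it})`. -/
def torusBall : CoordBall 2 (Circle × Circle) where
  toFun v := (Circle.exp (v 0), Circle.exp (v 1))
  isOpenEmbedding := by
    let h : Euc 2 ≃ₜ ℝ × ℝ :=
      { toFun := fun v => (v 0, v 1)
        invFun := fun p => !₂[p.1, p.2]
        left_inv := fun v => by ext i; fin_cases i <;> rfl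
        right_inv := fun p => rfl
        continuous_toFun := by fun_prop
        continuous_invFun := by
          refine (PiLp.continuous_toLp 2 _).comp (continuous_pi fun i => ?_)
          fin_cases i
          exacts [continuous_fst, continuous_snd] }
    have ho := isLocalHomeomorph_circleExp.isOpenMap
    refine .of_continuous_injective_isOpenMap
      (((Circle.exp.continuous.prodMap Circle.exp.continuous).comp h.continuous).comp
        continuous_subtype_val) ?_
      (((ho.prodMap ho).comp h.isOpenMap).comp isOpen_ball.isOpenMap_subtype_val)
    intro v w hvw
    have h0 := circleExp_injOn (abs_coord_lt v.2 0) (abs_coord_lt w.2 0) (congrArg Prod.fst hvw)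
    have h1 := circleExp_injOn (abs_coord_lt v.2 1) (abs_coord_lt w.2 1) (congrArg Prod.snd hvw)
    exact Subtype.ext (h.injective (Prod.ext h0 h1))

/-- The standard ball in `S² × S¹`: the image of the round unit ball under
`(x, y, t) ↦ (σ(x, y), e^{it})`, with `σ` inverse stereographic projection. -/
def sphCircleBall : CoordBall 3 (Sph 2 × Circle) where
  toFun v := (stereoInv !₂[v 0, v 1], Circle.exp (v 2))
  isOpenEmbedding := by
    let h : Euc 3 ≃ₜ Euc 2 × ℝ :=
      { toFun := fun v => (!₂[v 0, v 1], v 2)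
        invFun := fun p => !₂[p.1 0, p.1 1, p.2]
        left_inv := fun v => by ext i; fin_cases i <;> rfl
        right_inv := fun p => by
          refine Prod.ext ?_ rfl
          ext i; fin_cases i <;> rfl
        continuous_toFun := by
          refine Continuous.prodMk ((PiLp.continuous_toLp 2 _).comp (continuous_pi fun i => ?_))
            (by fun_prop)
          fin_cases i
          exacts [by fun_prop, by fun_prop]
        continuous_invFun := by
          refine (PiLp.continuous_toLp 2 _).comp (continuous_pi fun i => ?_)
          fin_cases i
          exacts [by fun_prop, by fun_prop, by fun_prop] }
    have ho := isLocalHomeomorph_circleExp.isOpenMap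
    have hs := stereoInv_isOpenEmbedding (d := 2)
    refine .of_continuous_injective_isOpenMap
      (((hs.continuous.prodMap Circle.exp.continuous).comp h.continuous).comp
        continuous_subtype_val) ?_
      (((hs.isOpenMap.prodMap ho).comp h.isOpenMap).comp isOpen_ball.isOpenMap_subtype_val)
    intro v w hvw
    have h0 := hs.injective (congrArg Prod.fst hvw)
    have h1 := circleExp_injOn (abs_coord_lt v.2 2) (abs_coord_lt w.2 2) (congrArg Prod.snd hvw)
    exact Subtype.ext (h.injective (Prod.ext h0 h1))

/-- The closed oriented surface `Σₙ` of genus `n`: the connected sum of `n` tori. -/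
abbrev GenusSurface (n : ℕ) : Type := NFoldConnSum n torusBall

/-- The closed three-manifold `#ₙ(S² × S¹)`. -/
abbrev ConnSumSphCircle (n : ℕ) : Type := NFoldConnSum n sphCircleBall

/-! ### Branched double coverings and `π₁`-surjectivity -/

/-- `f` is a branched double covering (of three-manifolds): there is a closed set `B` in the target,
the branch locus, such that `f` is a two-sheeted covering over the complement of `B`, and
near each point of `B` the map `f` is, in suitable coordinates, the map `(z, t) ↦ (z², t)` of `ℂ × ℝ`
with `B` corresponding to `{0} × ℝ`; here one chart covers the whole preimage. -/
def IsBranchedDoubleCovering {X Y : Type*} [TopologicalSpace X] [TopologicalSpace Y]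
    (f : C(X, Y)) : Prop :=
  ∃ B : Set Y, IsClosed B ∧
    (∀ y ∉ B, IsEvenlyCovered f y (Fin 2)) ∧
    ∀ y ∈ B, ∃ U : Set Y, IsOpen U ∧ ∃ hy : y ∈ U,
      ∃ (a : (f ⁻¹' U) ≃ₜ ℂ × ℝ) (b : U ≃ₜ ℂ × ℝ),
        b ⟨y, hy⟩ = 0 ∧
        (∀ u : U, u.1 ∈ B ↔ (b u).1 = 0) ∧
        ∀ x : f ⁻¹' U, b ⟨f x.1, x.2⟩ = ((a x).1 ^ 2, (a x).2)

/-- `f` induces a surjection on fundamental groups (at every base point). -/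
def PiOneSurjective {X Y : Type*} [TopologicalSpace X] [TopologicalSpace Y] (f : C(X, Y)) : Prop :=
  ∀ x : X, Function.Surjective (FundamentalGroup.map f x)

end

noncomputable section

/-! ### Quotients by involutions -/

/-! Let `s` be a reflection of the surface and let `τ` act on the surface times the circle by `s` on
the first factor and by `z ↦ z⁻¹` on the second. The covering is the quotient by `τ`. At a fixed
point of `τ` the map `s` is complex conjugation in a suitable chart, and inversion of the circle is
the reflection of a line. The product of these two reflections is a half turn `(z, t) ↦ (-z, t)`,
whose quotient map is `(z, t) ↦ (z², t)`. Away from its fixed points `τ` is free, so the quotient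
map is a two-sheeted covering there. This is `isBranchedDoubleCovering_of_involution`.

For surjectivity on fundamental groups, every path in the target lifts up to homotopy from any
starting point over its source (`IsBranchedDoubleCovering.liftsUpToHomotopy`). A fixed point of `τ`
is alone in its fibre, so there the lift of a loop closes up. Every point can be joined to a fixed
point, so conjugating by a path settles all base points.

It remains to recognise the quotient as the connected sum of copies of `S² × S¹`. This is done with
explicit maps whose fibres are the orbits of the involution, called folds (`IsFold`). The torus
modulo `(b, z) ↦ (b⁻¹, z⁻¹)` is a sphere, the pillowcase, and its half `Re b ≥ 0` folds onto a disc
(`annulusFold`). Multiplied by an interval, this folds a rectangle times the circle onto a solid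
cylinder. Doubling along the boundaries gives a fold of `S² × S¹` onto `S³` (`exists_fold_sphere`).
Multiplying the pillowcase map by a circle gives a fold of `T² × S¹` onto `S² × S¹`
(`exists_fold_torus`).

To form connected sums, round discs are removed from the surfaces and round balls from the
three-manifolds. The shell between a disc and a rectangle, times the circle, is folded radially onto
the shell between a ball and a cylinder (`shellFold`). Inserting this (`IsFold.puncture`) yields
folds of the punctured pieces, which all restrict to the same map `sphereFold` on the boundary.
Hence they glue (`ConnSum.exists_fold`). -/

theorem exists_homeomorph_of_isOpenMap {A B C : Type*} [TopologicalSpace A] [TopologicalSpace B]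
    [TopologicalSpace C] {p : A → B} {q : A → C} (hp : Continuous p) (hpo : IsOpenMap p)
    (hps : Function.Surjective p) (hq : Continuous q) (hqo : IsOpenMap q)
    (hqs : Function.Surjective q) (h : ∀ a a', p a = p a' ↔ q a = q a') :
    ∃ e : B ≃ₜ C, ∀ a, e (p a) = q a := by
  let F : B → C := fun b => q (hps b).choose
  let G : C → B := fun c => p (hqs c).choose
  have hF : ∀ a, F (p a) = q a := fun a => (h _ _).1 (hps (p a)).choose_spec
  have hG : ∀ a, G (q a) = p a := fun a => (h _ _).2 (hqs (q a)).choose_spec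
  refine ⟨⟨⟨F, G, fun b => ?_, fun c => ?_⟩, ?_, ?_⟩, hF⟩
  · obtain ⟨a, rfl⟩ := hps b
    rw [hF, hG]
  · obtain ⟨a, rfl⟩ := hqs c
    rw [hG, hF]
  · refine (hpo.isQuotientMap hp hps).continuous_iff.2 ?_
    exact hq.congr fun a => (hF a).symm
  · refine (hqo.isQuotientMap hq hqs).continuous_iff.2 ?_
    exact hp.congr fun a => (hG a).symm

theorem isOpenMap_complex_sq : IsOpenMap fun z : ℂ => z ^ 2 := by
  have h : AnalyticOnNhd ℂ (fun z : ℂ => z ^ 2) univ := fun z _ => by fun_prop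
  rcases h.is_constant_or_isOpenMap with ⟨w, hw⟩ | h
  · have h0 := hw 0
    have h1 := hw 1
    simp [← h0] at h1
  · exact h

variable {X Y : Type*} [TopologicalSpace X] [TopologicalSpace Y]

/-- A continuous surjection from a compact Hausdorff space onto a Hausdorff space whose fibres are
the orbits of an involution is a branched double covering, provided the involution looks like
`(z, t) ↦ (-z, t)` near each of its fixed points. -/
theorem isBranchedDoubleCovering_of_involution [CompactSpace X] [T2Space X] [T2Space Y]
    (τ : X → X) (hτc : Continuous τ) (hτ : Function.Involutive τ) (f : C(X, Y))
    (hs : Function.Surjective f) (hf : ∀ x y, f x = f y ↔ y = x ∨ y = τ x)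
    (hc : ∀ x, τ x = x → ∃ e : ℂ × ℝ → X, IsOpenEmbedding e ∧ e 0 = x ∧
      ∀ z t, e (-z, t) = τ (e (z, t))) :
    IsBranchedDoubleCovering f := by
  have hfτ : ∀ x, f (τ x) = f x := fun x => ((hf x (τ x)).2 (Or.inr rfl)).symm
  have hq : IsQuotientMap f := .of_surjective_continuous hs f.continuous
  have hpre : ∀ O : Set X, f ⁻¹' (f '' O) = O ∪ τ ⁻¹' O := by
    intro O
    ext x
    constructor
    · rintro ⟨y, hy, hxy⟩
      rcases (hf y x).1 hxy with rfl | rfl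
      · exact Or.inl hy
      · refine Or.inr ?_
        rwa [mem_preimage, hτ]
    · rintro (h | h)
      · exact ⟨x, h, rfl⟩
      · exact ⟨τ x, h, hfτ x⟩
  have hopen : IsOpenMap f := fun O hO => by
    rw [← hq.isOpen_preimage, hpre]
    exact hO.union (hO.preimage hτc)
  refine ⟨f '' {x | τ x = x}, ?_, ?_, ?_⟩
  · exact ((isClosed_eq hτc continuous_id).isCompact.image f.continuous).isClosed
  · intro y hy
    have hfree : ∀ x, f x = y → τ x ≠ x := fun x hx h => hy ⟨x, h, hx⟩
    have hcov : IsEvenlyCovered f y (f ⁻¹' {y}) := by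
      refine .of_openPartialHomeomorph f.continuous fun e he => ?_
      -- Separating a point from its image gives a neighbourhood `W` disjoint from `τ '' W`, and `f`
      -- is injective on such a set.
      obtain ⟨O, O', hO, hO', heO, heO', hd⟩ := t2_separation (hfree e he).symm
      let W := O ∩ τ ⁻¹' O'
      have hW : IsOpen W := hO.inter (hO'.preimage hτc)
      have hinj : InjOn f W := by
        intro u hu v hv huv
        rcases (hf u v).1 huv with h | h
        · exact h.symm
        · exact (Set.disjoint_left.1 hd hv.1 (h ▸ hu.2)).elim
      have hne : Nonempty X := ⟨e⟩
      refine ⟨OpenPartialHomeomorph.ofContinuousOpenRestrict (hinj.toPartialEquiv f W)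
        f.continuous.continuousOn ?_ hW, ⟨heO, heO'⟩, rfl⟩
      exact hopen.comp hW.isOpenMap_subtype_val
    have := hcov.discreteTopology_fiber
    obtain ⟨x, hx⟩ := hs y
    have hfib : f ⁻¹' {y} = {x, τ x} := by
      ext z
      rw [mem_preimage, mem_singleton_iff, ← hx, eq_comm, hf]
      simp
    have hcard : Nat.card (f ⁻¹' {y}) = 2 := by
      rw [hfib, Nat.card_coe_set_eq, Set.ncard_pair (hfree x hx).symm]
    have : Finite (f ⁻¹' {y}) := Nat.finite_of_card_ne_zero (by omega)
    exact hcov.of_fiber_homeomorph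
      (Finite.equivFinOfCardEq hcard).toHomeomorphOfDiscrete
  · rintro _ ⟨x, hx, rfl⟩
    obtain ⟨e, he, he0, heτ⟩ := hc x hx
    -- The range of the chart is invariant under `τ`, so a single chart fills the whole preimage of
    -- its image.
    have hpreU : f ⁻¹' (f '' range e) = range e := by
      rw [hpre]
      refine union_eq_left.2 ?_
      rintro y ⟨⟨z, t⟩, hz⟩
      refine ⟨(-z, t), ?_⟩
      rw [heτ, hz, hτ]
    have hU : IsOpen (f '' range e) := hopen _ he.isOpen_range
    let a : (f ⁻¹' (f '' range e)) ≃ₜ ℂ × ℝ :=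
      (Homeomorph.setCongr hpreU).trans he.isEmbedding.toHomeomorph.symm
    have ha : ∀ x, e (a x) = x.1 := fun x => by
      have := congrArg Subtype.val (he.isEmbedding.toHomeomorph.apply_symm_apply
        (Homeomorph.setCongr hpreU x))
      exact this
    let p : ℂ × ℝ → (f '' range e) := fun v => ⟨f (e v), e v, mem_range_self v, rfl⟩
    let q : ℂ × ℝ → ℂ × ℝ := fun v => (v.1 ^ 2, v.2)
    have hpc : Continuous p := (f.continuous.comp he.continuous).subtype_mk _
    have hpo : IsOpenMap p := by
      intro O hO
      have := hopen _ (he.isOpenMap _ hO)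
      convert! this.preimage (continuous_subtype_val (p := fun y => y ∈ f '' range e)) using 1
      ext ⟨y, hy⟩
      constructor
      · rintro ⟨v, hv, h⟩
        exact ⟨e v, ⟨v, hv, rfl⟩, congrArg Subtype.val h⟩
      · rintro ⟨_, ⟨v, hv, rfl⟩, h⟩
        exact ⟨v, hv, Subtype.ext h⟩
    have hps : Function.Surjective p := by
      rintro ⟨_, _, ⟨v, rfl⟩, rfl⟩
      exact ⟨v, rfl⟩
    have hqc : Continuous q := by fun_prop
    have hqo : IsOpenMap q := isOpenMap_complex_sq.prodMap IsOpenMap.id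
    have hqs : Function.Surjective q := by
      rintro ⟨w, t⟩
      obtain ⟨z, hz⟩ := IsAlgClosed.exists_eq_mul_self w
      exact ⟨(z, t), Prod.ext (by simp only [q]; rw [pow_two, ← hz]) rfl⟩
    have hpq : ∀ v v', p v = p v' ↔ q v = q v' := by
      rintro ⟨z, t⟩ ⟨z', t'⟩
      rw [Subtype.ext_iff]
      change f (e _) = f (e _) ↔ (z ^ 2, t) = (z' ^ 2, t')
      rw [hf, ← heτ, he.injective.eq_iff, he.injective.eq_iff, Prod.mk.injEq, Prod.mk.injEq,
        Prod.mk.injEq, sq_eq_sq_iff_eq_or_eq_neg]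
      constructor
      · rintro (⟨rfl, rfl⟩ | ⟨rfl, rfl⟩) <;> simp
      · rintro ⟨rfl | rfl, rfl⟩ <;> simp
    -- In the chart, `f` and `(z, t) ↦ (z², t)` are open surjections with the same fibres, the
    -- orbits of `(z, t) ↦ (-z, t)`. Hence their targets are homeomorphic.
    obtain ⟨b, hb⟩ := exists_homeomorph_of_isOpenMap hpc hpo hps hqc hqo hqs hpq
    refine ⟨_, hU, ⟨x, ⟨0, he0⟩, rfl⟩, a, b, ?_, ?_, ?_⟩
    · have := hb 0
      simp only [p, q, he0] at this
      rw [this]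
      simp
    · intro u
      obtain ⟨⟨z, t⟩, rfl⟩ := hps u
      rw [hb]
      simp only [p, q, pow_eq_zero_iff two_ne_zero]
      constructor
      · rintro ⟨y, hy, hyz⟩
        have h1 : e (z, t) = y := by
          rcases (hf _ _).1 hyz with h | h
          · exact h
          · exact h.trans hy
        have h2 : e (-z, t) = e (z, t) := by rw [heτ, h1, hy]
        have h3 := congrArg Prod.fst (he.injective h2)
        simpa using self_eq_neg.1 h3.symm
      · rintro rfl
        refine ⟨e (0, t), ?_, rfl⟩
        have := heτ 0 t
        rw [neg_zero] at this
        exact this.symm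
    · intro x
      have : (⟨f x.1, x.2⟩ : f '' range e) = p (a x) := Subtype.ext (by simp only [p, ha])
      rw [this, hb]

/-! ### Lifting paths up to homotopy -/

/-- Every point over the source of `γ` is the source of a path whose image is homotopic to `γ`. -/
def LiftsUpToHomotopy (f : C(X, Y)) {a b : Y} (γ : Path a b) : Prop :=
  ∀ x, f x = a → ∃ (x' : X) (δ : Path x x') (hx : f x = a) (hb : f x' = b),
    ((δ.map f.continuous).cast hx.symm hb.symm).Homotopic γ

theorem LiftsUpToHomotopy.of_homotopic {f : C(X, Y)} {a b : Y} {γ γ' : Path a b}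
    (h : LiftsUpToHomotopy f γ) (hγ : γ.Homotopic γ') : LiftsUpToHomotopy f γ' := fun x hx => by
  obtain ⟨x', δ, h1, h2, h3⟩ := h x hx
  exact ⟨x', δ, h1, h2, h3.trans hγ⟩

theorem LiftsUpToHomotopy.trans {f : C(X, Y)} {a b c : Y} {γ : Path a b} {γ' : Path b c}
    (h : LiftsUpToHomotopy f γ) (h' : LiftsUpToHomotopy f γ') :
    LiftsUpToHomotopy f (γ.trans γ') := fun x hx => by
  obtain ⟨x', δ, h1, h2, h3⟩ := h x hx
  obtain ⟨x'', δ', h4, h5, h6⟩ := h' x' h2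
  refine ⟨x'', δ.trans δ', h1, h5, ?_⟩
  subst h1 h2 h5
  simp only [Path.cast_rfl_rfl, Path.map_trans] at *
  exact h3.hcomp h6

/-- Here the lift is exact: the sheet is kept constant along `γ`. -/
theorem LiftsUpToHomotopy.of_mem_evenlyCovered {f : C(X, Y)} {I : Type*} [TopologicalSpace I]
    {U : Set Y} (H : f ⁻¹' U ≃ₜ U × I) (hH : ∀ x, (H x).1.1 = f x) {a b : Y} (γ : Path a b)
    (hγ : ∀ t, γ t ∈ U) : LiftsUpToHomotopy f γ := by
  rintro x rfl
  have hxU : f x ∈ U := by simpa using hγ 0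
  let i : I := (H ⟨x, hxU⟩).2
  have key : ∀ u : U, f (H.symm (u, i)).1 = u.1 := fun u => by
    rw [← hH, H.apply_symm_apply]
  let δ : Path x (H.symm (⟨b, by simpa using hγ 1⟩, i)).1 :=
    { toFun := fun t => (H.symm (⟨γ t, hγ t⟩, i)).1
      continuous_toFun := by
        refine continuous_subtype_val.comp (H.symm.continuous.comp ?_)
        exact (γ.continuous.subtype_mk _).prodMk continuous_const
      source' := by
        have : ((⟨γ 0, hγ 0⟩ : U), i) = H ⟨x, hxU⟩ := by
          refine Prod.ext (Subtype.ext ?_) rfl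
          rw [hH]
          simp
        rw [this, H.symm_apply_apply]
      target' := by simp }
  refine ⟨_, δ, rfl, key _, ?_⟩
  have : (δ.map f.continuous).cast rfl (key _).symm = γ := by
    ext t
    exact key ⟨γ t, hγ t⟩
  rw [this]

/-- No genuine lift is needed near the branch locus. A complex square root gives a point over the
end of `γ`, and any path to it inside the path connected preimage will do, because paths with common
ends in the contractible set `U` are homotopic. -/
theorem LiftsUpToHomotopy.of_mem_branchChart {f : C(X, Y)} {U : Set Y}
    (a : (f ⁻¹' U) ≃ₜ ℂ × ℝ) (b : U ≃ₜ ℂ × ℝ)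
    (hab : ∀ x : f ⁻¹' U, b ⟨f x.1, x.2⟩ = ((a x).1 ^ 2, (a x).2)) {y y' : Y} (γ : Path y y')
    (hγ : ∀ t, γ t ∈ U) : LiftsUpToHomotopy f γ := by
  rintro x rfl
  have hxU : f x ∈ U := by simpa using hγ 0
  have hyU : y' ∈ U := by simpa using hγ 1
  obtain ⟨z, hz⟩ := IsAlgClosed.exists_eq_mul_self (b ⟨y', hyU⟩).1
  let x' : f ⁻¹' U := a.symm (z, (b ⟨y', hyU⟩).2)
  have hx' : f x'.1 = y' := by
    have h1 := hab x'
    have h2 : b ⟨f x'.1, x'.2⟩ = b ⟨y', hyU⟩ := by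
      rw [h1]
      simp only [x', Homeomorph.apply_symm_apply]
      exact Prod.ext (by rw [pow_two, ← hz]) rfl
    exact congrArg Subtype.val (b.injective h2)
  let δ' : Path (⟨x, hxU⟩ : f ⁻¹' U) x' :=
    ((PathConnectedSpace.somePath (a ⟨x, hxU⟩) (a x')).map a.symm.continuous).cast
      (a.symm_apply_apply _).symm (a.symm_apply_apply _).symm
  have hfU : Continuous fun v : f ⁻¹' U => (⟨f v.1, v.2⟩ : U) :=
    (f.continuous.comp continuous_subtype_val).subtype_mk _
  refine ⟨x'.1, δ'.map continuous_subtype_val, rfl, hx', ?_⟩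
  let γU : Path (⟨f x, hxU⟩ : U) ⟨y', hyU⟩ :=
    { toFun := fun t => ⟨γ t, hγ t⟩
      continuous_toFun := γ.continuous.subtype_mk _
      source' := Subtype.ext γ.source
      target' := Subtype.ext γ.target }
  let δU : Path (⟨f x, hxU⟩ : U) ⟨y', hyU⟩ :=
    (δ'.map hfU).cast rfl (Subtype.ext hx'.symm)
  have : ContractibleSpace U := b.contractibleSpace
  have h := (SimplyConnectedSpace.paths_homotopic δU γU).map ⟨Subtype.val, continuous_subtype_val⟩
  exact h

theorem IsBranchedDoubleCovering.liftsUpToHomotopy {f : C(X, Y)} (hf : IsBranchedDoubleCovering f)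
    {y y' : Y} (γ : Path y y') : LiftsUpToHomotopy f γ := by
  obtain ⟨B, -, hcov, hbr⟩ := hf
  have hloc : ∀ p : Y, ∃ U : Set Y, IsOpen U ∧ p ∈ U ∧
      ∀ (u v : Y) (δ : Path u v), (∀ t, δ t ∈ U) → LiftsUpToHomotopy f δ := by
    intro p
    by_cases hp : p ∈ B
    · obtain ⟨U, hU, hpU, a, b, -, -, hab⟩ := hbr p hp
      exact ⟨U, hU, hpU, fun u v δ hδ => .of_mem_branchChart a b hab δ hδ⟩
    · obtain ⟨-, U, hpU, hU, -, H, hH⟩ := hcov p hp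
      exact ⟨U, hU, hpU, fun u v δ hδ => .of_mem_evenlyCovered H hH δ hδ⟩
  choose U hU hpU hlift using hloc
  -- Compactness of the interval cuts `γ` into finitely many subpaths, each inside one of the good
  -- open sets.
  obtain ⟨t, ht0, htm, ⟨N, hN⟩, ht⟩ := exists_monotone_Icc_subset_open_cover_unitInterval
    (c := fun p : Y => γ ⁻¹' U p) (fun p => (hU p).preimage γ.continuous)
    (fun s _ => mem_iUnion.2 ⟨γ s, hpU _⟩)
  have step : ∀ n, LiftsUpToHomotopy f (γ.subpath (t 0) (t n)) := by
    intro n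
    induction n with
    | zero =>
      refine hlift (γ (t 0)) _ _ _ fun s => ?_
      rw [Path.subpath_self]
      exact hpU _
    | succ n ih =>
      obtain ⟨p, hp⟩ := ht n
      have h2 : LiftsUpToHomotopy f (γ.subpath (t n) (t (n + 1))) := by
        refine hlift p _ _ _ fun s => ?_
        have h3 := mem_range_self (f := γ.subpath (t n) (t (n + 1))) s
        rw [Path.range_subpath_of_le _ _ _ (htm n.le_succ)] at h3
        obtain ⟨r, hr, hrs⟩ := h3
        rw [← hrs]
        exact hp hr
      exact (ih.trans h2).of_homotopic ⟨Path.Homotopy.subpathTransSubpath γ _ _ _⟩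
  have h := step N
  rw [ht0, hN N le_rfl, Path.subpath_zero_one] at h
  intro x hx
  obtain ⟨x', δ, h1, h2, h3⟩ := h x (by simpa using hx)
  refine ⟨x', δ, hx, by simpa using h2, ?_⟩
  exact h3.pathCast γ.source.symm γ.target.symm

/-- A branched double covering is `π₁`-surjective if every point can be joined to a point over
the branch locus, that is, to a point which is alone in its fibre. -/
theorem IsBranchedDoubleCovering.piOneSurjective {f : C(X, Y)} (hf : IsBranchedDoubleCovering f)
    (h : ∀ x, ∃ x₀, Joined x x₀ ∧ ∀ x', f x' = f x₀ → x' = x₀) : PiOneSurjective f := by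
  intro x g
  obtain ⟨x₀, ⟨p⟩, hx₀⟩ := h x
  obtain ⟨γ, rfl⟩ := Path.Homotopic.Quotient.mk_surjective g
  -- Conjugation by the image of `p` moves the loop to `f x₀`. Its lift ends over `f x₀`, hence at
  -- `x₀`, and so is a loop.
  obtain ⟨x', δ, h1, h2, h3⟩ := hf.liftsUpToHomotopy
    (((p.map f.continuous).symm.trans γ).trans (p.map f.continuous)) x₀ rfl
  obtain rfl := hx₀ x' h2
  refine ⟨Path.Homotopic.Quotient.mk ((p.trans δ).trans p.symm), ?_⟩
  change Path.Homotopic.Quotient.mk (((p.trans δ).trans p.symm).map f.continuous) =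
    Path.Homotopic.Quotient.mk γ
  have h4 := Path.Homotopic.Quotient.eq.2 h3
  have h5 : p.symm.map f.continuous = (p.map f.continuous).symm := rfl
  simp only [Path.cast_rfl_rfl, Path.map_trans, h5, Path.Homotopic.Quotient.mk_trans,
    Path.Homotopic.Quotient.mk_symm] at h4 ⊢
  rw [h4, Path.Homotopic.Quotient.trans_assoc, Path.Homotopic.Quotient.trans_assoc,
    Path.Homotopic.Quotient.trans_symm, Path.Homotopic.Quotient.trans_refl,
    ← Path.Homotopic.Quotient.trans_assoc, Path.Homotopic.Quotient.trans_symm,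
    Path.Homotopic.Quotient.refl_trans]

/-! ### The topology of a connected sum -/

/-- The quotient of a compact Hausdorff space by a closed equivalence relation is Hausdorff. -/
theorem t2Space_of_isQuotientMap_of_isClosed {C Q : Type*} [TopologicalSpace C]
    [TopologicalSpace Q] [CompactSpace C] [T2Space C] {π : C → Q} (hπ : IsQuotientMap π)
    (hR : IsClosed {p : C × C | π p.1 = π p.2}) : T2Space Q := by
  -- The saturation of a closed set is the projection of a closed subset of the compact space `C ×
  -- C`.
  have hcl : IsClosedMap π := by
    intro F hF
    rw [← hπ.isClosed_preimage]
    have : π ⁻¹' (π '' F) = Prod.snd '' ({p : C × C | π p.1 = π p.2} ∩ Prod.fst ⁻¹' F) := by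
      ext x
      constructor
      · rintro ⟨y, hy, hyx⟩
        exact ⟨(y, x), ⟨hyx, hy⟩, rfl⟩
      · rintro ⟨⟨y, x⟩, ⟨hyx, hy⟩, rfl⟩
        exact ⟨y, hy, hyx⟩
    rw [this]
    exact ((hR.inter (hF.preimage continuous_fst)).isCompact.image continuous_snd).isClosed
  have hfib : ∀ q, IsClosed (π ⁻¹' {q}) := fun q => by
    obtain ⟨x, rfl⟩ := hπ.surjective q
    have := hcl _ (isClosed_singleton (x := x))
    rw [image_singleton] at this
    exact this.preimage hπ.continuous
  refine ⟨fun p q hpq => ?_⟩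
  have hd : Disjoint (π ⁻¹' {p}) (π ⁻¹' {q}) :=
    Disjoint.preimage π (disjoint_singleton.2 hpq)
  obtain ⟨U, V, hU, hV, hpU, hqV, hUV⟩ :=
    SeparatedNhds.of_isCompact_isCompact (hfib p).isCompact (hfib q).isCompact hd
  -- These sets consist of the points whose whole fibre lies in `U`, respectively in `V`. They are
  -- open because `π` is closed.
  refine ⟨(π '' Uᶜ)ᶜ, (π '' Vᶜ)ᶜ, (hcl _ hU.isClosed_compl).isOpen_compl,
    (hcl _ hV.isClosed_compl).isOpen_compl, ?_, ?_, ?_⟩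
  · rintro ⟨x, hx, rfl⟩
    exact hx (hpU rfl)
  · rintro ⟨x, hx, rfl⟩
    exact hx (hqV rfl)
  · rw [Set.disjoint_left]
    intro r hr hr'
    obtain ⟨x, rfl⟩ := hπ.surjective r
    have h1 : x ∈ U := by_contra fun h => hr ⟨x, h, rfl⟩
    have h2 : x ∈ V := by_contra fun h => hr' ⟨x, h, rfl⟩
    exact Set.disjoint_left.1 hUV h1 h2

namespace CoordBall

variable {d : ℕ} {M : Type*} [TopologicalSpace M] (φ : CoordBall d M)

theorem injOn : InjOn φ.toFun (ball 0 2) := injOn_iff_injective.2 φ.isOpenEmbedding.injective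

theorem continuousOn : ContinuousOn φ.toFun (ball 0 2) :=
  continuousOn_iff_continuous_domRestrict.2 φ.isOpenEmbedding.continuous

theorem isOpen_image {O : Set (Euc d)} (hO : IsOpen O) (h : O ⊆ ball 0 2) :
    IsOpen (φ.toFun '' O) := by
  have := φ.isOpenEmbedding.isOpenMap _ (hO.preimage continuous_subtype_val)
  convert! this using 1
  ext x
  constructor
  · rintro ⟨v, hv, rfl⟩
    exact ⟨⟨v, h hv⟩, hv, rfl⟩
  · rintro ⟨v, hv, rfl⟩
    exact ⟨v, hv, rfl⟩

theorem isOpen_interior : IsOpen φ.interior :=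
  φ.isOpen_image isOpen_ball (ball_subset_ball one_le_two)

theorem interior_subset_closed : φ.interior ⊆ φ.closed := image_mono ball_subset_closedBall

theorem notMem_interior {v : Euc d} (h1 : 1 ≤ ‖v‖) (h2 : ‖v‖ < 2) : φ.toFun v ∉ φ.interior := by
  rintro ⟨w, hw, h⟩
  rw [mem_ball_zero_iff] at hw
  have := φ.injOn (mem_ball_zero_iff.2 (by linarith)) (mem_ball_zero_iff.2 h2) h
  rw [this] at hw
  linarith

theorem mem_closed_of_norm_eq_one {v : Euc d} (hv : ‖v‖ = 1) : φ.toFun v ∈ φ.closed :=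
  ⟨v, mem_closedBall_zero_iff.2 hv.le, rfl⟩

end CoordBall

/-! ### The quotient map onto a connected sum and its fibres -/

namespace ConnSum

variable {d : ℕ} {ι : Type*} {X : Type*} [TopologicalSpace X]
  {M : ι → Type*} [∀ i, TopologicalSpace (M i)] {φ : ι → CoordBall d X}
  {ψ : ∀ i, CoordBall d (M i)}

/-- The quotient map onto the connected sum. -/
def mk (hφ : Pairwise fun i j => Disjoint (φ i).closed (φ j).closed)
    (ψ : ∀ i, CoordBall d (M i)) : ConnSumPieces φ ψ → ConnSum φ hφ ψ := Quot.mk _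

/-- The class of a point of the punctured `X`. -/
def inl (hφ : Pairwise fun i j => Disjoint (φ i).closed (φ j).closed)
    (ψ : ∀ i, CoordBall d (M i)) (x : {x : X // ∀ i, x ∉ (φ i).interior}) : ConnSum φ hφ ψ :=
  mk hφ ψ (Sum.inl x)

/-- The class of a point of the punctured `M i`. -/
def inr (hφ : Pairwise fun i j => Disjoint (φ i).closed (φ j).closed)
    (ψ : ∀ i, CoordBall d (M i)) (i : ι) (y : {y : M i // y ∉ (ψ i).interior}) :
    ConnSum φ hφ ψ :=
  mk hφ ψ (Sum.inr ⟨i, y⟩)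

variable {hφ : Pairwise fun i j => Disjoint (φ i).closed (φ j).closed}

theorem isQuotientMap_mk : IsQuotientMap (mk hφ ψ) := isQuotientMap_quot_mk

theorem continuous_inl : Continuous (inl hφ ψ) :=
  isQuotientMap_mk.continuous.comp _root_.continuous_inl

theorem continuous_inr (i : ι) : Continuous (inr hφ ψ i) :=
  isQuotientMap_mk.continuous.comp (_root_.continuous_inr.comp continuous_sigmaMk)

/-- Since the closed balls in `X` are disjoint, a point lies on at most one gluing sphere, and the
chart then determines its coordinate. With `rel_left_unique`, the gluing relation is the graph of a
partial injection. -/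
theorem rel_right_unique {u v w : ConnSumPieces φ ψ}
    (hφ : Pairwise fun i j => Disjoint (φ i).closed (φ j).closed)
    (h1 : ConnSumRel φ ψ u v) (h2 : ConnSumRel φ ψ u w) : v = w := by
  cases h1 with
  | glue i v hv x hx y hy =>
    cases h2 with
    | glue j w hw _ hx' y' hy' =>
      have hij : i = j := by
        by_contra hij
        refine Set.disjoint_left.1 (hφ hij) ((φ i).mem_closed_of_norm_eq_one hv) ?_
        rw [← hx, hx']
        exact (φ j).mem_closed_of_norm_eq_one hw
      subst hij
      have : v = w := (φ i).injOn (mem_ball_zero_iff.2 (by linarith))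
        (mem_ball_zero_iff.2 (by linarith)) (hx.symm.trans hx')
      subst this
      rw [Subtype.ext (hy.trans hy'.symm)]

theorem rel_left_unique {u v w : ConnSumPieces φ ψ}
    (h1 : ConnSumRel φ ψ u w) (h2 : ConnSumRel φ ψ v w) : u = v := by
  cases h1 with
  | glue i v hv x hx y hy =>
    cases h2 with
    | glue _ w hw x' hx' _ hy' =>
      have : v = w := (ψ i).injOn (mem_ball_zero_iff.2 (by linarith))
        (mem_ball_zero_iff.2 (by linarith)) (hy.symm.trans hy')
      subst this
      rw [Subtype.ext (hx.trans hx'.symm)]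

theorem not_rel_rel {u v w : ConnSumPieces φ ψ}
    (h1 : ConnSumRel φ ψ u v) (h2 : ConnSumRel φ ψ v w) : False := by
  cases h1
  cases h2

/-- A partial injection from the left pieces to the right pieces cannot be composed with itself, and
composing it with its inverse gives identities. So chains of identifications never get longer than
one step. -/
theorem mk_eq_mk_iff {u v : ConnSumPieces φ ψ} :
    mk hφ ψ u = mk hφ ψ v ↔ u = v ∨ ConnSumRel φ ψ u v ∨ ConnSumRel φ ψ v u := by
  constructor
  · intro h
    have h' := Quot.eqvGen_exact h
    clear h
    induction h' with
    | rel _ _ h => exact Or.inr (Or.inl h)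
    | refl => exact Or.inl rfl
    | symm _ _ _ ih =>
      rcases ih with rfl | h | h
      exacts [Or.inl rfl, Or.inr (Or.inr h), Or.inr (Or.inl h)]
    | trans _ _ _ h1 h2 ih1 ih2 =>
      rcases ih1 with rfl | h | h
      · exact ih2
      · rcases ih2 with rfl | h' | h'
        exacts [Or.inr (Or.inl h), (not_rel_rel h h').elim, Or.inl (rel_left_unique h h')]
      · rcases ih2 with rfl | h' | h'
        exacts [Or.inr (Or.inr h), Or.inl (rel_right_unique hφ h h'), (not_rel_rel h' h).elim]
  · rintro (rfl | h | h)
    exacts [rfl, Quot.sound h, (Quot.sound h).symm]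

theorem inl_injective : Function.Injective (inl hφ ψ) := by
  intro x y h
  rcases mk_eq_mk_iff.1 h with h | h | h
  · exact Sum.inl_injective h
  · cases h
  · cases h

theorem inr_eq_inr {i j : ι} {x : {y : M i // y ∉ (ψ i).interior}}
    {y : {y : M j // y ∉ (ψ j).interior}} (h : inr hφ ψ i x = inr hφ ψ j y) :
    (⟨i, x⟩ : Σ i, {y : M i // y ∉ (ψ i).interior}) = ⟨j, y⟩ := by
  rcases mk_eq_mk_iff.1 h with h | h | h
  · exact Sum.inr_injective h
  · cases h
  · cases h

theorem inr_injective (i : ι) : Function.Injective (inr hφ ψ i) := by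
  intro x y h
  simpa using inr_eq_inr h

theorem inl_eq_inr_iff {x : {x : X // ∀ i, x ∉ (φ i).interior}} {i : ι}
    {y : {y : M i // y ∉ (ψ i).interior}} :
    inl hφ ψ x = inr hφ ψ i y ↔
      ∃ v : Euc d, ‖v‖ = 1 ∧ x.1 = (φ i).toFun v ∧ y.1 = (ψ i).toFun v := by
  constructor
  · intro h
    rcases mk_eq_mk_iff.1 h with h | h | h
    · cases h
    · cases h with
      | glue i v hv _ hx _ hy => exact ⟨v, hv, hx, hy⟩
    · cases h
  · rintro ⟨v, hv, hx, hy⟩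
    exact Quot.sound (.glue i v hv x hx y hy)

theorem exists_rep (p : ConnSum φ hφ ψ) : (∃ x, p = inl hφ ψ x) ∨ ∃ i y, p = inr hφ ψ i y := by
  obtain ⟨x | ⟨i, y⟩, rfl⟩ := Quot.exists_rep p
  exacts [Or.inl ⟨x, rfl⟩, Or.inr ⟨i, y, rfl⟩]

instance compactSpace_left [CompactSpace X] : CompactSpace {x : X // ∀ i, x ∉ (φ i).interior} := by
  refine isCompact_iff_compactSpace.1 (IsClosed.isCompact (s := {x | ∀ i, x ∉ (φ i).interior}) ?_)
  rw [ofPred_forall]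
  exact isClosed_iInter fun i => (φ i).isOpen_interior.isClosed_compl

instance compactSpace_right {N : Type*} [TopologicalSpace N] [CompactSpace N]
    (θ : CoordBall d N) : CompactSpace {y : N // y ∉ θ.interior} :=
  isCompact_iff_compactSpace.1 θ.isOpen_interior.isClosed_compl.isCompact

instance compactSpace [Finite ι] [CompactSpace X] [∀ i, CompactSpace (M i)] :
    CompactSpace (ConnSum φ hφ ψ) :=
  inferInstanceAs (CompactSpace (Quot (ConnSumRel φ ψ)))

/-- The relation is a finite union of continuous images of the compact unit sphere. Its closedness
is what makes the connected sum Hausdorff. -/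
theorem isClosed_setOf_rel [Finite ι] [T2Space X] [∀ i, T2Space (M i)]
    (hφ : Pairwise fun i j => Disjoint (φ i).closed (φ j).closed) :
    IsClosed {p : ConnSumPieces φ ψ × ConnSumPieces φ ψ | ConnSumRel φ ψ p.1 p.2} := by
  classical
  let S := {v : Euc d // ‖v‖ = 1}
  have : CompactSpace S := isCompact_iff_compactSpace.1 (by
    have : {v : Euc d | ‖v‖ = 1} = sphere 0 1 := by
      ext v
      simp
    change IsCompact {v : Euc d | ‖v‖ = 1}
    rw [this]
    exact isCompact_sphere _ _)
  have hle : ∀ v : S, (v : Euc d) ∈ ball (0 : Euc d) 2 := fun v =>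
    mem_ball_zero_iff.2 (by linarith [v.2])
  have hmem : ∀ (i) (v : S) (j), (φ i).toFun v ∉ (φ j).interior := by
    intro i v j
    by_cases hij : i = j
    · subst hij
      exact (φ i).notMem_interior v.2.ge (mem_ball_zero_iff.1 (hle v))
    · exact fun h => Set.disjoint_left.1 (hφ hij) ((φ i).mem_closed_of_norm_eq_one v.2)
        ((φ j).interior_subset_closed h)
  have hmem' : ∀ (i) (v : S), (ψ i).toFun v ∉ (ψ i).interior := fun i v =>
    (ψ i).notMem_interior v.2.ge (mem_ball_zero_iff.1 (hle v))
  let G : ι → S → ConnSumPieces φ ψ × ConnSumPieces φ ψ := fun i v =>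
    (Sum.inl ⟨(φ i).toFun v, hmem i v⟩, Sum.inr ⟨i, (ψ i).toFun v, hmem' i v⟩)
  have hG : ∀ i, Continuous (G i) := fun i => by
    refine (_root_.continuous_inl.comp (Continuous.subtype_mk ?_ _)).prodMk
      (_root_.continuous_inr.comp (continuous_sigmaMk.comp (Continuous.subtype_mk ?_ _)))
    · exact (φ i).continuousOn.comp_continuous continuous_subtype_val hle
    · exact (ψ i).continuousOn.comp_continuous continuous_subtype_val hle
  have : {p : ConnSumPieces φ ψ × ConnSumPieces φ ψ | ConnSumRel φ ψ p.1 p.2} =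
      ⋃ i, range (G i) := by
    ext ⟨u, w⟩
    simp only [mem_iUnion, mem_range]
    constructor
    · intro h
      cases h with
      | glue i v hv x hx y hy =>
        refine ⟨i, ⟨v, hv⟩, ?_⟩
        obtain ⟨x, hx'⟩ := x
        obtain ⟨y, hy'⟩ := y
        subst hx hy
        rfl
    · rintro ⟨i, v, h⟩
      have h1 := (Prod.ext_iff.1 h).1
      have h2 := (Prod.ext_iff.1 h).2
      change ConnSumRel φ ψ u w
      dsimp only [G] at h1 h2
      rw [← h1, ← h2]
      exact ConnSumRel.glue i v.1 v.2 ⟨_, hmem i v⟩ rfl ⟨_, hmem' i v⟩ rfl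
  have hcl : ∀ i, IsClosed (range (G i)) := fun i => (isCompact_range (hG i)).isClosed
  rw [this]
  exact isClosed_iUnion_of_finite hcl

instance t2Space [Finite ι] [CompactSpace X] [T2Space X] [∀ i, CompactSpace (M i)]
    [∀ i, T2Space (M i)] : T2Space (ConnSum φ hφ ψ) := by
  refine t2Space_of_isQuotientMap_of_isClosed (isQuotientMap_mk (hφ := hφ) (ψ := ψ)) ?_
  simp only [mk_eq_mk_iff, ofPred_or]
  have hR := isClosed_setOf_rel (ψ := ψ) hφ
  exact isClosed_diagonal.union (hR.union (hR.preimage continuous_swap))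

/-! ### Open embeddings into a connected sum -/

theorem isOpen_iff {S : Set (ConnSum φ hφ ψ)} :
    IsOpen S ↔ IsOpen (inl hφ ψ ⁻¹' S) ∧ ∀ i, IsOpen (inr hφ ψ i ⁻¹' S) := by
  rw [← (isQuotientMap_mk (hφ := hφ) (ψ := ψ)).isOpen_preimage, isOpen_sum_iff,
    isOpen_sigma_iff]
  rfl

/-- A chart that avoids the closed balls is untouched by the gluing. `isOpenEmbedding_inr` is the
counterpart on the other side. -/
theorem isOpenEmbedding_inl {Z : Type*} [TopologicalSpace Z] {e : Z → X} (he : IsOpenEmbedding e)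
    (hd : ∀ z i, e z ∉ (φ i).closed) :
    IsOpenEmbedding fun z => inl hφ ψ ⟨e z, fun i h => hd z i ((φ i).interior_subset_closed h)⟩ := by
  refine .of_continuous_injective_isOpenMap (continuous_inl.comp (he.continuous.subtype_mk _)) ?_ ?_
  · intro z w h
    exact he.injective (congrArg Subtype.val (inl_injective h))
  · intro O hO
    rw [isOpen_iff]
    constructor
    · convert! (he.isOpenMap _ hO).preimage
        (continuous_subtype_val (p := fun x => ∀ i, x ∉ (φ i).interior)) using 1
      ext x
      constructor
      · rintro ⟨z, hz, h⟩
        exact ⟨z, hz, congrArg Subtype.val (inl_injective h)⟩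
      · rintro ⟨z, hz, h⟩
        exact ⟨z, hz, congrArg _ (Subtype.ext h)⟩
    · intro i
      convert! isOpen_empty
      ext y
      simp only [mem_preimage, mem_image, mem_empty_iff_false, iff_false, not_exists, not_and]
      intro z _ h
      obtain ⟨v, hv, h1, -⟩ := inl_eq_inr_iff.1 h
      have h1' : e z = _ := h1
      exact hd z i (h1' ▸ (φ i).mem_closed_of_norm_eq_one hv)

theorem isOpenEmbedding_inr {Z : Type*} [TopologicalSpace Z] {i : ι} {e : Z → M i}
    (he : IsOpenEmbedding e) (hd : ∀ z, e z ∉ (ψ i).closed) :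
    IsOpenEmbedding fun z =>
      inr hφ ψ i ⟨e z, fun h => hd z ((ψ i).interior_subset_closed h)⟩ := by
  refine .of_continuous_injective_isOpenMap
    ((continuous_inr i).comp (he.continuous.subtype_mk _)) ?_ ?_
  · intro z w h
    exact he.injective (congrArg Subtype.val (inr_injective i h))
  · intro O hO
    rw [isOpen_iff]
    constructor
    · convert! isOpen_empty
      ext x
      simp only [mem_preimage, mem_image, mem_empty_iff_false, iff_false, not_exists, not_and]
      intro z _ h
      obtain ⟨v, hv, -, h1⟩ := inl_eq_inr_iff.1 h.symm
      have h1' : e z = _ := h1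
      exact hd z (h1' ▸ (ψ i).mem_closed_of_norm_eq_one hv)
    · intro j
      by_cases hij : i = j
      · subst hij
        convert! (he.isOpenMap _ hO).preimage
          (continuous_subtype_val (p := fun x => x ∉ (ψ i).interior)) using 1
        ext x
        constructor
        · rintro ⟨z, hz, h⟩
          exact ⟨z, hz, congrArg Subtype.val (inr_injective i h)⟩
        · rintro ⟨z, hz, h⟩
          exact ⟨z, hz, congrArg _ (Subtype.ext h)⟩
      · convert! isOpen_empty
        ext y
        simp only [mem_preimage, mem_image, mem_empty_iff_false, iff_false, not_exists, not_and]
        intro z _ h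
        exact hij (congrArg Sigma.fst (inr_eq_inr h))

/-- The open annulus of radii `1/2` and `2`. -/
abbrev Annulus (d : ℕ) : Type := {v : Euc d // 1 / 2 < ‖v‖ ∧ ‖v‖ < 2}

theorem norm_inv_sq_smul {v : Euc d} : ‖(‖v‖ ^ 2)⁻¹ • v‖ = ‖v‖⁻¹ := by
  rw [norm_smul, norm_inv, norm_pow, norm_norm]
  by_cases h : ‖v‖ = 0
  · simp [h]
  · field_simp

/-- The neck of the connected sum at the `i`-th gluing sphere. -/
def neck (hφ : Pairwise fun i j => Disjoint (φ i).closed (φ j).closed)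
    (ψ : ∀ i, CoordBall d (M i)) (i : ι)
    (hsep : ∀ j ≠ i, ∀ v ∈ ball (0 : Euc d) 2, (φ i).toFun v ∉ (φ j).closed) (v : Annulus d) :
    ConnSum φ hφ ψ :=
  -- In both charts the points that survive lie outside the unit ball. The inner half of the annulus
  -- is therefore sent by the inversion to the outer collar of `ψ i`; the inversion is the identity
  -- on the unit sphere, where the two formulas meet.
  if h : 1 ≤ ‖v.1‖ then inl hφ ψ ⟨(φ i).toFun v, fun j hj => by
      by_cases hij : j = i
      · subst hij
        exact (φ j).notMem_interior h v.2.2 hj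
      · exact hsep j hij v (mem_ball_zero_iff.2 v.2.2) ((φ j).interior_subset_closed hj)⟩
  else inr hφ ψ i ⟨(ψ i).toFun ((‖v.1‖ ^ 2)⁻¹ • v.1), by
      refine (ψ i).notMem_interior ?_ ?_
      · rw [norm_inv_sq_smul]
        exact (one_le_inv₀ (by linarith [v.2.1])).2 (not_le.1 h).le
      · rw [norm_inv_sq_smul]
        exact (inv_lt_comm₀ (by linarith [v.2.1]) two_pos).2 (by linarith [v.2.1])⟩

variable {i : ι} {hsep : ∀ j ≠ i, ∀ v ∈ ball (0 : Euc d) 2, (φ i).toFun v ∉ (φ j).closed}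

theorem annulus_inv_mem {v : Euc d} (hv : 1 / 2 < ‖v‖ ∧ ‖v‖ < 2) :
    1 / 2 < ‖(‖v‖ ^ 2)⁻¹ • v‖ ∧ ‖(‖v‖ ^ 2)⁻¹ • v‖ < 2 := by
  have h0 : 0 < ‖v‖ := by linarith [hv.1]
  rw [norm_inv_sq_smul]
  refine ⟨?_, ?_⟩
  · rw [lt_inv_comm₀ (by norm_num) h0]
    linarith [hv.2]
  · rw [inv_lt_comm₀ h0 two_pos]
    linarith [hv.1]

theorem continuous_annulus_inv : Continuous fun v : Annulus d => (‖v.1‖ ^ 2)⁻¹ • v.1 := by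
  have h : Continuous fun v : Annulus d => (‖v.1‖ ^ 2)⁻¹ := by
    refine Continuous.inv₀ (by fun_prop) fun v => ?_
    have : 0 < ‖v.1‖ := by linarith [v.2.1]
    positivity
  exact h.smul continuous_subtype_val

theorem annulus_inv_inv {v : Euc d} (hv : v ≠ 0) :
    (‖(‖v‖ ^ 2)⁻¹ • v‖ ^ 2)⁻¹ • (‖v‖ ^ 2)⁻¹ • v = v := by
  have : ‖v‖ ≠ 0 := norm_ne_zero_iff.2 hv
  rw [norm_inv_sq_smul, smul_smul]
  convert one_smul ℝ v using 2
  field_simp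

theorem neck_of_one_le {v : Annulus d} (h : 1 ≤ ‖v.1‖) :
    ∃ h', neck hφ ψ i hsep v = inl hφ ψ ⟨(φ i).toFun v, h'⟩ := by
  rw [neck, dif_pos h]
  exact ⟨_, rfl⟩

theorem neck_of_le_one {v : Annulus d} (h : ‖v.1‖ ≤ 1) :
    ∃ h', neck hφ ψ i hsep v = inr hφ ψ i ⟨(ψ i).toFun ((‖v.1‖ ^ 2)⁻¹ • v.1), h'⟩ := by
  have h' : (ψ i).toFun ((‖v.1‖ ^ 2)⁻¹ • v.1) ∉ (ψ i).interior := by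
    refine (ψ i).notMem_interior ?_ (annulus_inv_mem v.2).2
    rw [norm_inv_sq_smul]
    exact (one_le_inv₀ (by linarith [v.2.1])).2 h
  refine ⟨h', ?_⟩
  rcases h.lt_or_eq with h | h
  · rw [neck, dif_neg (not_le.2 h)]
  · rw [neck, dif_pos h.ge, inl_eq_inr_iff]
    exact ⟨v, h, rfl, by simp [h]⟩

theorem continuous_neck : Continuous (neck hφ ψ i hsep) := by
  have hn : Continuous fun v : Annulus d => ‖v.1‖ := by fun_prop
  have h1 : ContinuousOn (neck hφ ψ i hsep) {v | 1 ≤ ‖v.1‖} := by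
    rw [continuousOn_iff_continuous_domRestrict]
    have : Continuous fun v : {v : Annulus d | 1 ≤ ‖v.1‖} => (φ i).toFun v.1.1 :=
      (φ i).continuousOn.comp_continuous (by fun_prop) fun v => mem_ball_zero_iff.2 v.1.2.2
    refine (continuous_inl.comp (this.subtype_mk fun v =>
      (neck_of_one_le (hφ := hφ) (ψ := ψ) (hsep := hsep) v.2).choose)).congr fun v => ?_
    exact (neck_of_one_le (hφ := hφ) (ψ := ψ) (hsep := hsep) v.2).choose_spec.symm
  have h2 : ContinuousOn (neck hφ ψ i hsep) {v | ‖v.1‖ ≤ 1} := by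
    rw [continuousOn_iff_continuous_domRestrict]
    have : Continuous fun v : {v : Annulus d | ‖v.1‖ ≤ 1} =>
        (ψ i).toFun ((‖v.1.1‖ ^ 2)⁻¹ • v.1.1) := by
      refine (ψ i).continuousOn.comp_continuous ?_ fun v =>
        mem_ball_zero_iff.2 (annulus_inv_mem v.1.2).2
      exact continuous_annulus_inv.comp continuous_subtype_val
    refine ((continuous_inr i).comp (this.subtype_mk fun v =>
      (neck_of_le_one (hφ := hφ) (ψ := ψ) (hsep := hsep) v.2).choose)).congr fun v => ?_
    exact (neck_of_le_one (hφ := hφ) (ψ := ψ) (hsep := hsep) v.2).choose_spec.symm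
  have h3 := h1.union_of_isClosed h2 (isClosed_le continuous_const hn)
    (isClosed_le hn continuous_const)
  rw [← continuousOn_univ]
  exact h3.mono fun v _ => le_total (1 : ℝ) ‖v.1‖

/-- This provides charts across the gluing spheres. Inside the proof, `key` and `key'` read off the
coordinate of a point of the neck from either of its two possible representatives. -/
theorem isOpenEmbedding_neck : IsOpenEmbedding (neck hφ ψ i hsep) := by
  have hne : ∀ v : Annulus d, v.1 ≠ 0 := fun v h => by
    have := v.2.1
    rw [h, norm_zero] at this
    linarith
  have key : ∀ (v : Annulus d) (x), neck hφ ψ i hsep v = inl hφ ψ x → x.1 = (φ i).toFun v := by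
    intro v x h
    by_cases hv : 1 ≤ ‖v.1‖
    · obtain ⟨h', e⟩ := neck_of_one_le (hφ := hφ) (ψ := ψ) (hsep := hsep) hv
      rw [e] at h
      rw [← inl_injective h]
    · obtain ⟨h', e⟩ := neck_of_le_one (hφ := hφ) (ψ := ψ) (hsep := hsep) (not_le.1 hv).le
      rw [e] at h
      obtain ⟨w, hw, -, h2⟩ := inl_eq_inr_iff.1 h.symm
      have h3 := (ψ i).injOn (mem_ball_zero_iff.2 (annulus_inv_mem v.2).2)
        (mem_ball_zero_iff.2 (by linarith)) h2
      have h4 := congrArg norm h3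
      rw [norm_inv_sq_smul, hw, inv_eq_one] at h4
      exact (hv h4.ge).elim
  have key' : ∀ (v : Annulus d) (j y), neck hφ ψ i hsep v = inr hφ ψ j y → ∃ h : j = i,
      (h ▸ y.1) = (ψ i).toFun ((‖v.1‖ ^ 2)⁻¹ • v.1) := by
    intro v j y h
    by_cases hv : ‖v.1‖ ≤ 1
    · obtain ⟨h', e⟩ := neck_of_le_one (hφ := hφ) (ψ := ψ) (hsep := hsep) hv
      rw [e] at h
      have h1 := inr_eq_inr h
      obtain rfl : i = j := congrArg Sigma.fst h1
      refine ⟨rfl, ?_⟩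
      rw [← inr_injective i h]
    · obtain ⟨h', e⟩ := neck_of_one_le (hφ := hφ) (ψ := ψ) (hsep := hsep) (not_le.1 hv).le
      rw [e] at h
      obtain ⟨w, hw, h1, -⟩ := inl_eq_inr_iff.1 h
      by_cases hij : j = i
      · subst hij
        have h3 := (φ j).injOn (mem_ball_zero_iff.2 v.2.2)
          (mem_ball_zero_iff.2 (by linarith)) h1
        rw [h3] at hv
        exact (hv hw.le).elim
      · refine (hsep j hij v (mem_ball_zero_iff.2 v.2.2) ?_).elim
        have h1' : (φ i).toFun v = (φ j).toFun w := h1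
        rw [h1']
        exact (φ j).mem_closed_of_norm_eq_one hw
  refine .of_continuous_injective_isOpenMap continuous_neck ?_ ?_
  · intro v w h
    by_cases hv : 1 ≤ ‖v.1‖
    · obtain ⟨h', e⟩ := neck_of_one_le (hφ := hφ) (ψ := ψ) (hsep := hsep) hv
      have h1 := key w _ (h.symm.trans e)
      exact Subtype.ext ((φ i).injOn (mem_ball_zero_iff.2 v.2.2) (mem_ball_zero_iff.2 w.2.2) h1)
    · obtain ⟨h', e⟩ := neck_of_le_one (hφ := hφ) (ψ := ψ) (hsep := hsep) (not_le.1 hv).le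
      obtain ⟨_, h1⟩ := key' w _ _ (h.symm.trans e)
      have h2 := (ψ i).injOn (mem_ball_zero_iff.2 (annulus_inv_mem v.2).2)
        (mem_ball_zero_iff.2 (annulus_inv_mem w.2).2) h1
      refine Subtype.ext ?_
      rw [← annulus_inv_inv (hne v), ← annulus_inv_inv (hne w), h2]
  · intro O hO
    have hO' : IsOpen (Subtype.val '' O : Set (Euc d)) := by
      refine IsOpen.isOpenMap_subtype_val ?_ _ hO
      exact (isOpen_lt continuous_const continuous_norm).inter
        (isOpen_lt continuous_norm continuous_const)
    rw [isOpen_iff]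
    constructor
    · have h1 : IsOpen ((φ i).toFun '' (Subtype.val '' O)) := by
        refine (φ i).isOpen_image hO' ?_
        rintro _ ⟨v, -, rfl⟩
        exact mem_ball_zero_iff.2 v.2.2
      convert! h1.preimage (continuous_subtype_val (p := fun x => ∀ i, x ∉ (φ i).interior)) using 1
      ext x
      constructor
      · rintro ⟨v, hv, h⟩
        exact ⟨v, ⟨v, hv, rfl⟩, (key v x h).symm⟩
      · rintro ⟨_, ⟨v, hv, rfl⟩, h⟩
        have h1 : 1 ≤ ‖v.1‖ := by
          by_contra h2
          refine x.2 i ?_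
          rw [← h]
          exact ⟨v, mem_ball_zero_iff.2 (not_le.1 h2), rfl⟩
        obtain ⟨h', e⟩ := neck_of_one_le (hφ := hφ) (ψ := ψ) (hsep := hsep) h1
        exact ⟨v, hv, e.trans (congrArg _ (Subtype.ext h))⟩
    · intro j
      by_cases hij : j = i
      · subst hij
        -- Seen from `M j`, the neck is `ψ j` after the inversion `κ`, so the trace of `O` there is
        -- the image of `κ ⁻¹' O`.
        let κ : Annulus d → Annulus d := fun v => ⟨_, annulus_inv_mem v.2⟩
        have hκ : Continuous κ := continuous_annulus_inv.subtype_mk _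
        have hκκ : ∀ v, κ (κ v) = v := fun v => Subtype.ext (annulus_inv_inv (hne v))
        have h1 : IsOpen ((ψ j).toFun '' (Subtype.val '' (κ ⁻¹' O))) := by
          refine (ψ j).isOpen_image ?_ ?_
          · refine IsOpen.isOpenMap_subtype_val ?_ _ (hO.preimage hκ)
            exact (isOpen_lt continuous_const continuous_norm).inter
              (isOpen_lt continuous_norm continuous_const)
          · rintro _ ⟨v, -, rfl⟩
            exact mem_ball_zero_iff.2 v.2.2
        convert! h1.preimage (continuous_subtype_val (p := fun x => x ∉ (ψ j).interior)) using 1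
        ext y
        constructor
        · rintro ⟨v, hv, h⟩
          obtain ⟨_, h1⟩ := key' v j y h
          refine ⟨_, ⟨κ v, ?_, rfl⟩, h1.symm⟩
          rwa [mem_preimage, hκκ]
        · rintro ⟨_, ⟨v, hv, rfl⟩, h⟩
          have h1 : 1 ≤ ‖v.1‖ := by
            by_contra h2
            refine y.2 ?_
            rw [← h]
            exact ⟨v, mem_ball_zero_iff.2 (not_le.1 h2), rfl⟩
          have h2 : ‖(κ v).1‖ ≤ 1 := by
            change ‖(‖v.1‖ ^ 2)⁻¹ • v.1‖ ≤ 1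
            rw [norm_inv_sq_smul]
            exact inv_le_one_of_one_le₀ h1
          obtain ⟨h', e⟩ := neck_of_le_one (hφ := hφ) (ψ := ψ) (hsep := hsep) h2
          refine ⟨κ v, hv, e.trans (congrArg _ (Subtype.ext ?_))⟩
          rw [← h]
          exact congrArg _ (annulus_inv_inv (hne v))
      · convert! isOpen_empty
        ext y
        simp only [mem_preimage, mem_image, mem_empty_iff_false, iff_false, not_exists, not_and]
        intro v _ h
        exact hij (key' v j y h).1

end ConnSum

/-! ### Folds -/

section Fold

variable {X X' Y Y' : Type*} [TopologicalSpace X] [TopologicalSpace X'] [TopologicalSpace Y]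
  [TopologicalSpace Y']

/-- `F` maps `A × S¹` onto `B`, and its fibres over `B` are the orbits of the involution
`(p, z) ↦ (σ p, z⁻¹)`. -/
structure IsFold (σ : X → X) (F : X × Circle → Y) (A : Set X) (B : Set Y) : Prop where
  continuousOn : ContinuousOn F (A ×ˢ univ)
  image_eq : F '' (A ×ˢ univ) = B
  mapsTo : MapsTo σ A A
  eq_iff : ∀ p ∈ A, ∀ q ∈ A, ∀ z w, F (p, z) = F (q, w) ↔ (q = p ∧ w = z) ∨ (q = σ p ∧ w = z⁻¹)

namespace IsFold

variable {σ : X → X} {F : X × Circle → Y} {A : Set X} {B : Set Y}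

theorem mem (h : IsFold σ F A B) {p : X} (hp : p ∈ A) (z : Circle) : F (p, z) ∈ B :=
  h.image_eq ▸ mem_image_of_mem F ⟨hp, mem_univ z⟩

theorem exists_eq (h : IsFold σ F A B) {y : Y} (hy : y ∈ B) : ∃ p ∈ A, ∃ z, F (p, z) = y := by
  rw [← h.image_eq] at hy
  obtain ⟨⟨p, z⟩, ⟨hp, -⟩, rfl⟩ := hy
  exact ⟨p, hp, z, rfl⟩

theorem apply_inv (h : IsFold σ F A B) {p : X} (hp : p ∈ A) (z : Circle) :
    F (σ p, z⁻¹) = F (p, z) :=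
  ((h.eq_iff p hp _ (h.mapsTo hp) z z⁻¹).2 (Or.inr ⟨rfl, rfl⟩)).symm

theorem congr (h : IsFold σ F A B) {F' : X × Circle → Y}
    (hF : ∀ p ∈ A, ∀ z, F' (p, z) = F (p, z)) : IsFold σ F' A B where
  continuousOn := h.continuousOn.congr fun p hp => hF p.1 hp.1 p.2
  image_eq := by
    rw [← h.image_eq]
    exact image_congr fun p hp => hF p.1 hp.1 p.2
  mapsTo := h.mapsTo
  eq_iff p hp q hq z w := by rw [hF p hp, hF q hq, h.eq_iff p hp q hq]

theorem restrict (h : IsFold σ F A B) {A' : Set X} (hA : A' ⊆ A) (hσ : MapsTo σ A' A') :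
    IsFold σ F A' (F '' (A' ×ˢ univ)) where
  continuousOn := h.continuousOn.mono (prod_mono_left hA)
  image_eq := rfl
  mapsTo := hσ
  eq_iff p hp q hq z w := h.eq_iff p (hA hp) q (hA hq) z w

theorem comp_left (h : IsFold σ F A B) {g : Y → Y'} (hg : ContinuousOn g B) (hi : InjOn g B) :
    IsFold σ (g ∘ F) A (g '' B) where
  continuousOn := hg.comp h.continuousOn fun p hp => h.mem hp.1 p.2
  image_eq := by rw [image_comp, h.image_eq]
  mapsTo := h.mapsTo
  eq_iff p hp q hq z w := by
    rw [← h.eq_iff p hp q hq, Function.comp, Function.comp, hi.eq_iff (h.mem hp z) (h.mem hq w)]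

theorem comp_right (h : IsFold σ F A B) {σ' : X' → X'} {A' : Set X'} {g : X' → X}
    (hg : ContinuousOn g A') (hi : InjOn g A') (hA : g '' A' = A) (hσ' : MapsTo σ' A' A')
    (hgσ : ∀ p ∈ A', g (σ' p) = σ (g p)) : IsFold σ' (fun p => F (g p.1, p.2)) A' B where
  continuousOn := by
    refine h.continuousOn.comp ((hg.comp continuousOn_fst fun p hp => hp.1).prodMk
      continuousOn_snd) fun p hp => ⟨?_, mem_univ _⟩
    rw [← hA]
    exact mem_image_of_mem g hp.1
  image_eq := by
    rw [← h.image_eq, ← hA]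
    ext y
    constructor
    · rintro ⟨⟨p, z⟩, ⟨hp, -⟩, rfl⟩
      exact ⟨(g p, z), ⟨⟨p, hp, rfl⟩, mem_univ _⟩, rfl⟩
    · rintro ⟨⟨_, z⟩, ⟨⟨p, hp, rfl⟩, -⟩, rfl⟩
      exact ⟨(p, z), ⟨hp, mem_univ _⟩, rfl⟩
  mapsTo := hσ'
  eq_iff p hp q hq z w := by
    have hp' : g p ∈ A := hA ▸ mem_image_of_mem g hp
    have hq' : g q ∈ A := hA ▸ mem_image_of_mem g hq
    rw [h.eq_iff _ hp' _ hq', ← hgσ p hp, hi.eq_iff hq hp, hi.eq_iff hq (hσ' hp)]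

/-- Closed subsets of `A` are compact, so `φ` maps them to closed sets. -/
theorem _root_.IsCompact.continuousOn_invFunOn [Nonempty X] [T2Space X'] {φ : X → X'} {A : Set X}
    (hA : IsCompact A) (hφ : ContinuousOn φ A) (hi : InjOn φ A) :
    ContinuousOn (Function.invFunOn φ A) (φ '' A) := by
  refine continuousOn_iff_isClosed.2 fun C hC => ⟨φ '' (A ∩ C), ?_, ?_⟩
  · exact ((hA.inter_right hC).image_of_continuousOn (hφ.mono inter_subset_left)).isClosed
  · ext y
    constructor
    · rintro ⟨h1, x, hx, rfl⟩
      refine ⟨⟨x, ⟨hx, ?_⟩, rfl⟩, ⟨x, hx, rfl⟩⟩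
      rwa [mem_preimage, hi.leftInvOn_invFunOn hx] at h1
    · rintro ⟨⟨x, ⟨hx, hxC⟩, rfl⟩, -⟩
      refine ⟨?_, ⟨x, hx, rfl⟩⟩
      rwa [mem_preimage, hi.leftInvOn_invFunOn hx]

/-- This transports a fold given in coordinates to the image of a compact coordinate patch.
Compactness supplies the continuity of the inverse coordinates. -/
theorem image [Nonempty X] [T2Space X'] (h : IsFold σ F A B) (hA : IsCompact A) {φ : X → X'}
    (hφ : ContinuousOn φ A) (hi : InjOn φ A) {σ' : X' → X'} (hσ : ∀ p ∈ A, σ' (φ p) = φ (σ p)) :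
    IsFold σ' (fun p => F (Function.invFunOn φ A p.1, p.2)) (φ '' A) B := by
  have hl := hi.leftInvOn_invFunOn
  refine h.comp_right (hA.continuousOn_invFunOn hφ hi) ?_ hl.image_image ?_ ?_
  · rintro _ ⟨p, hp, rfl⟩ _ ⟨q, hq, rfl⟩ hpq
    rw [hl hp, hl hq] at hpq
    rw [hpq]
  · rintro _ ⟨p, hp, rfl⟩
    exact ⟨σ p, h.mapsTo hp, (hσ p hp).symm⟩
  · rintro _ ⟨p, hp, rfl⟩
    rw [hσ p hp, hl hp, hl (h.mapsTo hp)]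

theorem prod {Z : Type*} [TopologicalSpace Z] (h : IsFold σ F A B) (S : Set Z) :
    IsFold (fun p : Z × X => (p.1, σ p.2)) (fun p : (Z × X) × Circle => (p.1.1, F (p.1.2, p.2)))
      (S ×ˢ A) (S ×ˢ B) where
  continuousOn := by
    refine ContinuousOn.prodMk (by fun_prop) (h.continuousOn.comp (by fun_prop) ?_)
    rintro ⟨⟨a, p⟩, z⟩ ⟨⟨-, hp⟩, -⟩
    exact ⟨hp, mem_univ _⟩
  image_eq := by
    rw [← h.image_eq]
    ext ⟨a, y⟩
    constructor
    · rintro ⟨⟨⟨a, p⟩, z⟩, ⟨⟨ha, hp⟩, -⟩, h⟩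
      obtain ⟨rfl, rfl⟩ := Prod.mk.inj h
      exact ⟨ha, (p, z), ⟨hp, mem_univ _⟩, rfl⟩
    · rintro ⟨ha, ⟨p, z⟩, ⟨hp, -⟩, rfl⟩
      exact ⟨((a, p), z), ⟨⟨ha, hp⟩, mem_univ _⟩, rfl⟩
  mapsTo := fun p hp => ⟨hp.1, h.mapsTo hp.2⟩
  eq_iff := by
    rintro ⟨a, p⟩ ⟨-, hp⟩ ⟨b, q⟩ ⟨-, hq⟩ z w
    simp only [Prod.mk.injEq]
    rw [h.eq_iff p hp q hq, eq_comm (a := a)]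
    tauto

open Classical in
/-- Two folds which agree on the intersection of their domains can be glued. -/
theorem glue (hσ : Function.Involutive σ) {F₁ F₂ : X × Circle → Y} {A₁ A₂ : Set X} {B₁ B₂ : Set Y}
    (h₁ : IsFold σ F₁ A₁ B₁) (h₂ : IsFold σ F₂ A₂ B₂) (hA₁ : IsClosed A₁) (hA₂ : IsClosed A₂)
    (hF : ∀ p ∈ A₁, p ∈ A₂ → ∀ z, F₁ (p, z) = F₂ (p, z))
    (hB : ∀ y ∈ B₁, y ∈ B₂ → ∃ p ∈ A₁, p ∈ A₂ ∧ ∃ z, F₁ (p, z) = y) :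
    IsFold σ (fun p => if p.1 ∈ A₁ then F₁ p else F₂ p) (A₁ ∪ A₂) (B₁ ∪ B₂) := by
  set G : X × Circle → Y := fun p => if p.1 ∈ A₁ then F₁ p else F₂ p with hG
  have hG₁ : ∀ p ∈ A₁, ∀ z, G (p, z) = F₁ (p, z) := fun p hp z => if_pos hp
  have hG₂ : ∀ p ∈ A₂, ∀ z, G (p, z) = F₂ (p, z) := fun p hp z => by
    by_cases h : p ∈ A₁
    · rw [hG₁ p h, hF p h hp]
    · exact if_neg h
  have g₁ := h₁.congr hG₁
  have g₂ := h₂.congr hG₂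
  -- A value common to both maps is taken at some `r` in `A₁ ∩ A₂`. Both `p` and `q` lie in the
  -- orbit of `r` on the surface side, and `σ` preserves `A₁` and `A₂`.
  have key : ∀ p ∈ A₁, ∀ q ∈ A₂, ∀ z w, G (p, z) = G (q, w) →
      (p ∈ A₂ ∧ q ∈ A₁) := by
    intro p hp q hq z w h
    obtain ⟨r, hr1, hr2, v, hr⟩ := hB (G (p, z)) (g₁.mem hp z) (h ▸ g₂.mem hq w)
    rw [← hG₁ r hr1] at hr
    constructor
    · rcases (g₁.eq_iff r hr1 p hp v z).1 hr with ⟨rfl, -⟩ | ⟨rfl, -⟩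
      exacts [hr2, h₂.mapsTo hr2]
    · rcases (g₂.eq_iff r hr2 q hq v w).1 (hr.trans h) with ⟨rfl, -⟩ | ⟨rfl, -⟩
      exacts [hr1, h₁.mapsTo hr1]
  constructor
  · rw [union_prod]
    exact g₁.continuousOn.union_of_isClosed g₂.continuousOn (hA₁.prod isClosed_univ)
      (hA₂.prod isClosed_univ)
  · rw [union_prod, image_union, g₁.image_eq, g₂.image_eq]
  · rintro p (hp | hp)
    exacts [Or.inl (h₁.mapsTo hp), Or.inr (h₂.mapsTo hp)]
  · have hσmem : ∀ p q : X, ∀ z w : Circle, (q = p ∧ w = z) ∨ (q = σ p ∧ w = z⁻¹) →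
        (p ∈ A₁ ↔ q ∈ A₁) ∧ (p ∈ A₂ ↔ q ∈ A₂) := by
      rintro p q z w (⟨rfl, -⟩ | ⟨rfl, -⟩)
      · simp
      · refine ⟨⟨fun h => h₁.mapsTo h, fun h => ?_⟩, ⟨fun h => h₂.mapsTo h, fun h => ?_⟩⟩
        · simpa [hσ p] using h₁.mapsTo h
        · simpa [hσ p] using h₂.mapsTo h
    rintro p (hp | hp) q (hq | hq) z w
    · exact g₁.eq_iff p hp q hq z w
    · constructor
      · intro h
        exact (g₁.eq_iff p hp q (key p hp q hq z w h).2 z w).1 h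
      · intro h
        exact (g₁.eq_iff p hp q ((hσmem p q z w h).1.1 hp) z w).2 h
    · constructor
      · intro h
        exact (g₂.eq_iff p hp q (key q hq p hp w z h.symm).1 z w).1 h
      · intro h
        exact (g₂.eq_iff p hp q ((hσmem p q z w h).2.1 hp) z w).2 h
    · exact g₂.eq_iff p hp q hq z w

/-- Doubling a fold along reflections of its source and of its target. -/
theorem double (hσ : Function.Involutive σ) (h : IsFold σ F A B) (hA : IsClosed A)
    {r : X → X} {s : Y → Y} (hr : Continuous r) (hr' : Function.Involutive r)
    (hs : Continuous s) (hs' : Function.Involutive s) (hrσ : ∀ p, r (σ p) = σ (r p))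
    (hAr : ∀ p, p ∈ A ∨ r p ∈ A) (hBs : ∀ y, y ∈ B ∨ s y ∈ B)
    (hfix : ∀ p ∈ A, r p ∈ A → r p = p ∧ ∀ z, s (F (p, z)) = F (p, z))
    (hB : ∀ y ∈ B, s y ∈ B → ∃ p ∈ A, r p ∈ A ∧ ∃ z, F (p, z) = y) :
    ∃ G : X × Circle → Y, IsFold σ G univ univ ∧ ∀ p ∈ A, ∀ z, G (p, z) = F (p, z) := by
  classical
  have hσA : MapsTo σ (r ⁻¹' A) (r ⁻¹' A) := fun p hp => by
    rw [mem_preimage, hrσ]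
    exact h.mapsTo hp
  have hrA : r '' (r ⁻¹' A) = A := image_preimage_eq A hr'.surjective
  -- The second half of the double is `s ∘ F ∘ r`. It agrees with `F` on the overlap because `r` and
  -- `s` fix the common boundary pointwise.
  have h₂ := (h.comp_right (σ' := σ) hr.continuousOn hr'.injective.injOn hrA hσA
    fun p _ => hrσ p).comp_left hs.continuousOn hs'.injective.injOn
  have hsB : s '' B = s ⁻¹' B := by
    rw [image_eq_preimage_of_inverse hs' hs']
  have := h.glue hσ h₂ hA (hA.preimage hr) (fun p hp hp' z => ?_) fun y hy hy' => ?_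
  · refine ⟨fun p => if p.1 ∈ A then F p else (s ∘ fun p => F (r p.1, p.2)) p, ?_,
      fun p hp z => if_pos hp⟩
    convert! this
    · exact (eq_univ_of_forall hAr).symm
    · rw [hsB]
      exact (eq_univ_of_forall hBs).symm
  · obtain ⟨h1, h2⟩ := hfix p hp hp'
    simp only [Function.comp, h1, h2]
  · rw [hsB] at hy'
    exact hB y hy hy'

end IsFold

end Fold

/-! ### A fold of the annulus onto the disc -/

theorem Circle.re_sq_add_im_sq (z : Circle) : (z : ℂ).re ^ 2 + (z : ℂ).im ^ 2 = 1 := by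
  have := Circle.normSq_coe z
  rw [Complex.normSq_apply] at this
  linarith

theorem Circle.ext_re_im {z w : Circle} (h1 : (z : ℂ).re = (w : ℂ).re)
    (h2 : (z : ℂ).im = (w : ℂ).im) : z = w := Circle.ext (Complex.ext h1 h2)

theorem Circle.exists_re_im {c s : ℝ} (h : c ^ 2 + s ^ 2 = 1) :
    ∃ z : Circle, (z : ℂ).re = c ∧ (z : ℂ).im = s := by
  refine ⟨⟨⟨c, s⟩, ?_⟩, rfl, rfl⟩
  rw [Submonoid.unitSphere, Submonoid.mem_mk, Subsemigroup.mem_mk, mem_sphere_zero_iff_norm,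
    ← sq_eq_sq₀ (norm_nonneg _) zero_le_one, Complex.sq_norm,
    Complex.normSq_apply]
  simp only
  linarith

theorem Circle.re_inv (z : Circle) : ((z⁻¹ : Circle) : ℂ).re = (z : ℂ).re := by
  rw [Circle.coe_inv_eq_conj, Complex.conj_re]

theorem Circle.im_inv (z : Circle) : ((z⁻¹ : Circle) : ℂ).im = -(z : ℂ).im := by
  rw [Circle.coe_inv_eq_conj, Complex.conj_im]

/-- The map from the right half of the torus to the disc of radius `2` given by the ellipses with
half-axes `2 - cos t` and `2 sin t`. -/
def annulusFold (p : Circle × Circle) : ℂ :=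
  ⟨(2 - (p.1 : ℂ).re) * (p.2 : ℂ).re, 2 * (p.1 : ℂ).im * (p.2 : ℂ).im⟩

theorem continuous_annulusFold : Continuous annulusFold := by
  have : annulusFold = fun p : Circle × Circle =>
      (((2 - (p.1 : ℂ).re) * (p.2 : ℂ).re : ℝ) : ℂ) +
        ((2 * (p.1 : ℂ).im * (p.2 : ℂ).im : ℝ) : ℂ) * Complex.I := by
    ext p
    apply Complex.ext <;> simp [annulusFold]
  rw [this]
  have h1 : Continuous fun p : Circle × Circle => (p.1 : ℂ) := by fun_prop
  have h2 : Continuous fun p : Circle × Circle => (p.2 : ℂ) := by fun_prop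
  fun_prop

/-- In this form, when `Re b ≥ 0`, the defect from `4` is visibly nonnegative and vanishes only
together with `Re b`. -/
theorem sq_norm_annulusFold (b z : Circle) : ‖annulusFold (b, z)‖ ^ 2 =
    4 - (b : ℂ).re * ((4 - (b : ℂ).re) * (z : ℂ).re ^ 2 + 4 * (b : ℂ).re * (z : ℂ).im ^ 2) := by
  rw [Complex.sq_norm, Complex.normSq_apply]
  simp only [annulusFold]
  have hb := b.re_sq_add_im_sq
  have hz := z.re_sq_add_im_sq
  linear_combination 4 * (z : ℂ).im ^ 2 * hb + 4 * hz

theorem norm_annulusFold_le {b : Circle} (hb : 0 ≤ (b : ℂ).re) (z : Circle) :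
    ‖annulusFold (b, z)‖ ≤ 2 := by
  rw [← sq_le_sq₀ (norm_nonneg _) two_pos.le, sq_norm_annulusFold]
  have h1 : (b : ℂ).re ≤ 1 := by nlinarith [b.re_sq_add_im_sq, sq_nonneg (b : ℂ).im]
  have : 0 ≤ (b : ℂ).re * ((4 - (b : ℂ).re) * (z : ℂ).re ^ 2 +
      4 * (b : ℂ).re * (z : ℂ).im ^ 2) := by
    have : 0 ≤ 4 - (b : ℂ).re := by linarith
    positivity
  linarith

theorem norm_annulusFold_eq_two_iff {b : Circle} (hb : 0 ≤ (b : ℂ).re) (z : Circle) :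
    ‖annulusFold (b, z)‖ = 2 ↔ (b : ℂ).re = 0 := by
  rw [← sq_eq_sq₀ (norm_nonneg _) two_pos.le, sq_norm_annulusFold]
  constructor
  · intro h
    by_contra h0
    have hpos : 0 < (b : ℂ).re := lt_of_le_of_ne hb (Ne.symm h0)
    have h1 : (b : ℂ).re ≤ 1 := by nlinarith [b.re_sq_add_im_sq, sq_nonneg (b : ℂ).im]
    have h2 : (4 - (b : ℂ).re) * (z : ℂ).re ^ 2 + 4 * (b : ℂ).re * (z : ℂ).im ^ 2 = 0 := by
      have : (b : ℂ).re * ((4 - (b : ℂ).re) * (z : ℂ).re ^ 2 +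
        4 * (b : ℂ).re * (z : ℂ).im ^ 2) = 0 := by linarith
      exact (mul_eq_zero.1 this).resolve_left h0
    have h5 : 0 ≤ 4 * (b : ℂ).re * (z : ℂ).im ^ 2 := by positivity
    have h6 : 0 ≤ (z : ℂ).re ^ 2 := sq_nonneg _
    have h3 : (z : ℂ).re ^ 2 = 0 := by nlinarith
    have h4 : (z : ℂ).im ^ 2 = 0 := by
      rw [h3] at h2
      have : (b : ℂ).re * (z : ℂ).im ^ 2 = 0 := by linarith
      exact (mul_eq_zero.1 this).resolve_left h0
    have := z.re_sq_add_im_sq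
    linarith
  · intro h
    rw [h]
    norm_num

/-- Both half-axes, `2 - Re b` and `2 |Im b|`, shrink strictly as `Re b` grows from `0` to `1`, so
ellipses with different `Re b` are nested and disjoint. Concretely, for larger `Re b` the first
coordinates force `|Re z|` to be larger or both to vanish; in either case the second coordinates
cannot agree. -/
theorem annulusFold_re_le {b b' z z' : Circle} (hb' : 0 ≤ (b' : ℂ).re)
    (h : annulusFold (b, z) = annulusFold (b', z')) : (b : ℂ).re ≤ (b' : ℂ).re := by
  by_contra hlt
  rw [not_le] at hlt
  have h1 := congrArg Complex.re h
  have h2 := congrArg Complex.im h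
  simp only [annulusFold] at h1 h2
  have hb := b.re_sq_add_im_sq
  have hb2 := b'.re_sq_add_im_sq
  have hz := z.re_sq_add_im_sq
  have hz2 := z'.re_sq_add_im_sq
  generalize (b : ℂ).re = κ at *
  generalize (b' : ℂ).re = κ' at *
  generalize (b : ℂ).im = σ at *
  generalize (b' : ℂ).im = σ' at *
  generalize (z : ℂ).re = c at *
  generalize (z' : ℂ).re = c' at *
  generalize (z : ℂ).im = s at *
  generalize (z' : ℂ).im = s' at *
  have hκ1 : κ ≤ 1 := by nlinarith
  have e1 : (2 - κ) ^ 2 * c ^ 2 = (2 - κ') ^ 2 * c' ^ 2 := by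
    rw [← mul_pow, ← mul_pow, h1]
  have e2 : σ ^ 2 * s ^ 2 = σ' ^ 2 * s' ^ 2 := by
    have : σ * s = σ' * s' := by linarith
    rw [← mul_pow, ← mul_pow, this]
  have hA : (2 - κ) ^ 2 < (2 - κ') ^ 2 := by nlinarith
  have hA0 : 0 < (2 - κ) ^ 2 := by nlinarith
  have hB : σ ^ 2 < σ' ^ 2 := by nlinarith
  rcases eq_or_ne (c ^ 2) 0 with hc | hc
  · have hc' : c' ^ 2 = 0 := by
      rw [hc, mul_zero] at e1
      exact (mul_eq_zero.1 e1.symm).resolve_left (by linarith)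
    have : s ^ 2 = 1 := by linarith
    have : s' ^ 2 = 1 := by linarith
    nlinarith
  · have hc0 : 0 < c ^ 2 := lt_of_le_of_ne (sq_nonneg c) (Ne.symm hc)
    have h3 : c' ^ 2 < c ^ 2 := by
      by_contra h3
      nlinarith [mul_le_mul_of_nonneg_left (not_lt.1 h3) (sq_nonneg (2 - κ'))]
    have h4 : s ^ 2 < s' ^ 2 := by linarith
    nlinarith [mul_lt_mul_of_pos_left h4 (lt_of_le_of_lt (sq_nonneg σ) hB), sq_nonneg s,
      mul_le_mul_of_nonneg_right hB.le (sq_nonneg s)]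

/-- The ellipse determines `Re b`, and the first coordinate then determines `Re z`. The second
coordinate fixes the product of the imaginary parts, which leaves a simultaneous change of signs. If
`Im b' = 0` the ellipse is a doubly covered segment, `b` is its own inverse, and the sign of `Im z`
is free. -/
theorem annulusFold_eq_iff {b b' z z' : Circle} (hb : 0 ≤ (b : ℂ).re) (hb' : 0 ≤ (b' : ℂ).re) :
    annulusFold (b, z) = annulusFold (b', z') ↔ (b' = b ∧ z' = z) ∨ (b' = b⁻¹ ∧ z' = z⁻¹) := by
  constructor
  · intro h
    have hre : (b : ℂ).re = (b' : ℂ).re :=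
      le_antisymm (annulusFold_re_le hb' h) (annulusFold_re_le hb h.symm)
    have h1 := congrArg Complex.re h
    have h2 := congrArg Complex.im h
    simp only [annulusFold, hre] at h1 h2
    have hb1 : (b : ℂ).re ^ 2 + (b : ℂ).im ^ 2 = 1 := b.re_sq_add_im_sq
    have hb2 := b'.re_sq_add_im_sq
    have hz := z.re_sq_add_im_sq
    have hz2 := z'.re_sq_add_im_sq
    have hle : (b' : ℂ).re ≤ 1 := by nlinarith [sq_nonneg (b' : ℂ).im]
    have hc : (z : ℂ).re = (z' : ℂ).re :=
      mul_left_cancel₀ (by linarith : (2 - (b' : ℂ).re) ≠ 0) h1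
    have hσ : (b : ℂ).im = (b' : ℂ).im ∨ (b : ℂ).im = -(b' : ℂ).im := by
      rw [← sq_eq_sq_iff_eq_or_eq_neg]
      rw [hre] at hb1
      linarith
    have hs : (z : ℂ).im = (z' : ℂ).im ∨ (z : ℂ).im = -(z' : ℂ).im := by
      rw [← sq_eq_sq_iff_eq_or_eq_neg]
      rw [hc] at hz
      linarith
    have hinv : ∀ {u v : Circle}, (u : ℂ).re = (v : ℂ).re → (u : ℂ).im = -(v : ℂ).im → v = u⁻¹ :=
      fun h h' => Circle.ext_re_im (by rw [Circle.re_inv, h]) (by rw [Circle.im_inv, h', neg_neg])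
    by_cases h0 : (b' : ℂ).im = 0
    · have hbb : b' = b := by
        refine Circle.ext_re_im hre.symm ?_
        rcases hσ with h | h <;> simp [h, h0]
      have hbb' : b' = b⁻¹ := by
        refine hinv hre ?_
        rcases hσ with h | h <;> simp [h, h0]
      rcases hs with h | h
      · exact Or.inl ⟨hbb, Circle.ext_re_im hc.symm h.symm⟩
      · exact Or.inr ⟨hbb', hinv hc h⟩
    · rcases hσ with h | h
      · refine Or.inl ⟨Circle.ext_re_im hre.symm h.symm, Circle.ext_re_im hc.symm ?_⟩
        rw [h] at h2
        exact (mul_left_cancel₀ (by simpa using h0) h2).symm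
      · refine Or.inr ⟨hinv hre h, hinv hc ?_⟩
        rw [h] at h2
        refine mul_left_cancel₀ (a := 2 * (b' : ℂ).im) (by simpa using h0) ?_
        linarith
  · rintro (⟨rfl, rfl⟩ | ⟨rfl, rfl⟩)
    · rfl
    · simp [annulusFold]

/-- The intermediate value theorem finds an ellipse through the point; `h` is the equation of the
ellipse with denominators cleared. The real axis is treated apart, because at `κ = 1` the ellipse
collapses to the segment `[-1, 1]` and one cannot divide by `√(1 - κ²)`. -/
theorem exists_annulusFold_eq {w : ℂ} (hw : ‖w‖ ≤ 2) :
    ∃ b z : Circle, 0 ≤ (b : ℂ).re ∧ annulusFold (b, z) = w := by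
  obtain ⟨u, v⟩ := w
  have hw' : u ^ 2 + v ^ 2 ≤ 4 := by
    rw [← sq_le_sq₀ (norm_nonneg _) two_pos.le, Complex.sq_norm, Complex.normSq_apply] at hw
    simp only at hw
    linarith
  have key : ∃ κ c s : ℝ, 0 ≤ κ ∧ κ ≤ 1 ∧ c ^ 2 + s ^ 2 = 1 ∧ (2 - κ) * c = u ∧
      2 * √(1 - κ ^ 2) * s = v := by
    by_cases hv : v = 0
    · subst hv
      have hu : |u| ≤ 2 := abs_le_of_sq_le_sq (by linarith) two_pos.le
      by_cases h1 : |u| ≤ 1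
      · refine ⟨1, u, √(1 - u ^ 2), by norm_num, le_rfl, ?_, by ring, by simp⟩
        rw [Real.sq_sqrt (by nlinarith [sq_abs u, abs_nonneg u])]
        ring
      -- Off the segment, `u` is a vertex of the ellipse whose first half-axis `2 - κ` equals `|u|`.
      · refine ⟨2 - |u|, u / |u|, 0, by linarith, by linarith, ?_, ?_, by simp⟩
        · have hu0 : u ≠ 0 := by
            rintro rfl
            simp at h1
          rw [div_pow, sq_abs, div_self (pow_ne_zero 2 hu0)]
          ring
        · have : |u| ≠ 0 := by intro h; simp_all
          field_simp
          ring
    · let h : ℝ → ℝ := fun κ => u ^ 2 * (4 * (1 - κ ^ 2)) + v ^ 2 * (2 - κ) ^ 2 -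
        4 * (1 - κ ^ 2) * (2 - κ) ^ 2
      have hc : ContinuousOn h (Icc 0 1) := by fun_prop
      have h0 : h 0 ≤ 0 := by simp only [h]; nlinarith
      have h1 : 0 ≤ h 1 := by simp only [h]; nlinarith [sq_nonneg v]
      obtain ⟨κ, hκ, hz⟩ := intermediate_value_Icc zero_le_one hc ⟨h0, h1⟩
      have hv2 : 0 < v ^ 2 := by positivity
      have hκ1 : κ < 1 := by
        refine lt_of_le_of_ne hκ.2 ?_
        rintro rfl
        simp only [h] at hz
        nlinarith
      have hpos : 0 < 1 - κ ^ 2 := by nlinarith [hκ.1]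
      have hr := Real.sqrt_pos.2 hpos
      have hA : 0 < 2 - κ := by linarith
      refine ⟨κ, u / (2 - κ), v / (2 * √(1 - κ ^ 2)), hκ.1, hκ.2, ?_, ?_, ?_⟩
      · rw [div_pow, div_pow, mul_pow, Real.sq_sqrt hpos.le]
        field_simp
        simp only [h] at hz
        linear_combination hz
      · field_simp
      · field_simp
  obtain ⟨κ, c, s, hκ0, hκ1, hcs, h1, h2⟩ := key
  obtain ⟨b, hb1, hb2⟩ := Circle.exists_re_im (c := κ) (s := √(1 - κ ^ 2))
    (by rw [Real.sq_sqrt (by nlinarith)]; ring)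
  obtain ⟨z, hz1, hz2⟩ := Circle.exists_re_im hcs
  refine ⟨b, z, hb1 ▸ hκ0, ?_⟩
  rw [annulusFold, hb1, hb2, hz1, hz2, h1, h2]

theorem isFold_annulusFold :
    IsFold (fun b : Circle => b⁻¹) annulusFold {b | 0 ≤ (b : ℂ).re} (closedBall 0 2) where
  continuousOn := continuous_annulusFold.continuousOn
  image_eq := by
    ext w
    rw [mem_closedBall_zero_iff]
    constructor
    · rintro ⟨⟨b, z⟩, ⟨hb, -⟩, rfl⟩
      exact norm_annulusFold_le hb z
    · intro hw
      obtain ⟨b, z, hb, h⟩ := exists_annulusFold_eq hw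
      exact ⟨(b, z), ⟨hb, mem_univ _⟩, h⟩
  mapsTo b hb := by
    change 0 ≤ ((b⁻¹ : Circle) : ℂ).re
    rwa [Circle.re_inv]
  eq_iff b hb b' hb' z z' := annulusFold_eq_iff hb hb'

theorem Circle.re_exp (t : ℝ) : (Circle.exp t : ℂ).re = Real.cos t := by
  rw [Circle.coe_exp, Complex.exp_ofReal_mul_I_re]

theorem Circle.im_exp (t : ℝ) : (Circle.exp t : ℂ).im = Real.sin t := by
  rw [Circle.coe_exp, Complex.exp_ofReal_mul_I_im]

/-- This keeps angles of size at most `π / 2` in the interval where `circleExp_injOn` applies. -/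
theorem pi_div_two_lt_two : Real.pi / 2 < 2 := by linarith [Real.pi_lt_d2]

theorem Icc_pi_div_two_subset : Icc (-(Real.pi / 2)) (Real.pi / 2) ⊆ Ioo (-2 : ℝ) 2 := fun t ht =>
  ⟨by linarith [ht.1, pi_div_two_lt_two], by linarith [ht.2, pi_div_two_lt_two]⟩

theorem Circle.exp_image_Icc :
    Circle.exp '' Icc (-(Real.pi / 2)) (Real.pi / 2) = {b : Circle | 0 ≤ (b : ℂ).re} := by
  ext b
  constructor
  · rintro ⟨t, ht, rfl⟩
    rw [mem_ofPred_eq, Circle.re_exp]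
    exact Real.cos_nonneg_of_mem_Icc ⟨by linarith [ht.1], by linarith [ht.2]⟩
  · intro hb
    refine ⟨Complex.arg b, ?_, Circle.exp_arg b⟩
    refine abs_le.1 ?_
    exact Complex.abs_arg_le_pi_div_two_iff.2 hb

/-- The fold `((x, y), z) ↦ (x, J (e^{iy}, z))` with `J` the fold of the annulus. -/
def boxFold (p : (ℝ × ℝ) × Circle) : ℝ × ℂ := (p.1.1, annulusFold (Circle.exp p.1.2, p.2))

/-- The reflection of the plane in the first axis. -/
def planeRefl (p : ℝ × ℝ) : ℝ × ℝ := (p.1, -p.2)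

theorem isFold_boxFold (S : Set ℝ) : IsFold planeRefl boxFold
    (S ×ˢ Icc (-(Real.pi / 2)) (Real.pi / 2)) (S ×ˢ closedBall 0 2) := by
  refine IsFold.prod (X := ℝ) (σ := fun y => -y) (F := fun p => annulusFold (Circle.exp p.1, p.2))
    ?_ S
  refine isFold_annulusFold.comp_right Circle.exp.continuous.continuousOn
    (circleExp_injOn.mono Icc_pi_div_two_subset) Circle.exp_image_Icc ?_ fun y _ => ?_
  · intro y hy
    exact ⟨by linarith [hy.2], by linarith [hy.1]⟩
  · exact Circle.exp_neg y

/-- The lateral boundary of the cylinder comes exactly from the sides `y = ±π / 2` of the rectangle.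
Hence the box fold matches boundaries with boundaries and interiors with interiors. -/
theorem norm_boxFold_snd_eq_two_iff {p : ℝ × ℝ} (hp : |p.2| ≤ Real.pi / 2) (z : Circle) :
    ‖(boxFold (p, z)).2‖ = 2 ↔ |p.2| = Real.pi / 2 := by
  have h0 : 0 ≤ Real.cos p.2 :=
    Real.cos_nonneg_of_mem_Icc ⟨by linarith [(abs_le.1 hp).1], by linarith [(abs_le.1 hp).2]⟩
  rw [boxFold, norm_annulusFold_eq_two_iff (by rwa [Circle.re_exp]), Circle.re_exp, ← Real.cos_abs]
  constructor
  · intro h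
    by_contra hne
    have := Real.cos_pos_of_mem_Ioo ⟨by linarith [abs_nonneg p.2, Real.pi_pos],
      lt_of_le_of_ne hp hne⟩
    linarith
  · intro h
    rw [h, Real.cos_pi_div_two]

/-! ### Gauges and shells -/

/-- A continuous, positively homogeneous function which is positive away from the origin. -/
structure IsGauge {E : Type*} [AddCommGroup E] [Module ℝ E] [TopologicalSpace E] (g : E → ℝ) :
    Prop where
  continuous : Continuous g
  smul : ∀ t : ℝ, 0 ≤ t → ∀ v, g (t • v) = t * g v
  pos : ∀ v, v ≠ 0 → 0 < g v

namespace IsGauge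

variable {E : Type*} [AddCommGroup E] [Module ℝ E] [TopologicalSpace E] {g : E → ℝ}

theorem zero (hg : IsGauge g) : g 0 = 0 := by
  have := hg.smul 0 le_rfl 0
  simpa using this

theorem nonneg (hg : IsGauge g) (v : E) : 0 ≤ g v := by
  rcases eq_or_ne v 0 with rfl | h
  · rw [hg.zero]
  · exact (hg.pos v h).le

theorem ne_zero (hg : IsGauge g) {v : E} (h : g v ≠ 0) : v ≠ 0 := by
  rintro rfl
  exact h hg.zero

theorem inv_smul (hg : IsGauge g) {v : E} (h : v ≠ 0) : g ((g v)⁻¹ • v) = 1 := by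
  rw [hg.smul _ (inv_nonneg.2 (hg.nonneg v)), inv_mul_cancel₀ (hg.pos v h).ne']

end IsGauge

set_option linter.unusedSectionVars false

section Shell

variable {E E' : Type*} [AddCommGroup E] [Module ℝ E] [TopologicalSpace E]
  [AddCommGroup E'] [Module ℝ E'] [TopologicalSpace E']
  {g n : E → ℝ} {g' n' : E' → ℝ} {σ : E → E} {L : E × Circle → E'}

/-- The factor by which the shell map multiplies `L (p / g p, z)`. -/
def shellFactor (g n : E → ℝ) (n' : E' → ℝ) (L : E × Circle → E') (p : E × Circle) : ℝ :=
  -- Put `q = p / g p` and `l = L (q, z)`. On the ray of `q` the shell is where `g p` lies in `[1 /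
  -- n q, 1]`, and on the ray of `l` the target shell is where `g'` lies in `[1 / n' l, 1]`. The
  -- factor is the increasing affine map between these intervals.
  (n' (L ((g p.1)⁻¹ • p.1, p.2)))⁻¹ + (1 - (n' (L ((g p.1)⁻¹ • p.1, p.2)))⁻¹) *
    ((g p.1 - (n ((g p.1)⁻¹ • p.1))⁻¹) / (1 - (n ((g p.1)⁻¹ • p.1))⁻¹))

/-- The radial extension of a fold `L` from `{g = 1}` onto `{g' = 1}` to a fold from the shell
`{g ≤ 1 ≤ n}` onto the shell `{g' ≤ 1 ≤ n'}`. -/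
def shellFold (g n : E → ℝ) (n' : E' → ℝ) (L : E × Circle → E') (p : E × Circle) : E' :=
  shellFactor g n n' L p • L ((g p.1)⁻¹ • p.1, p.2)

variable (hg : IsGauge g) (hn : IsGauge n) (hg' : IsGauge g') (hn' : IsGauge n')
  (hL : IsFold σ L {p | g p = 1} {v | g' v = 1}) (h1 : ∀ p, g p = 1 → 1 < n p)
  (h1' : ∀ v, g' v = 1 → 1 < n' v)

theorem shellFold_of_gauge_eq_one (h1 : ∀ p, g p = 1 → 1 < n p) {p : E} (hp : g p = 1)
    (z : Circle) : shellFold g n n' L (p, z) = L (p, z) := by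
  have h2 : 1 - (n p)⁻¹ ≠ 0 := by
    have := inv_lt_one_of_one_lt₀ (h1 p hp)
    linarith
  simp only [shellFold, shellFactor, hp, inv_one, one_smul, div_self h2, mul_one,
    add_sub_cancel]

include hg hn in
theorem shellFold_of_norm_eq_one {p : E} (hp : n p = 1) (z : Circle) :
    shellFold g n n' L (p, z) =
      (n' (L ((g p)⁻¹ • p, z)))⁻¹ • L ((g p)⁻¹ • p, z) := by
  have h2 : (n ((g p)⁻¹ • p))⁻¹ = g p := by
    rw [hn.smul _ (inv_nonneg.2 (hg.nonneg p)), hp, mul_one, inv_inv]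
  simp only [shellFold, shellFactor, h2, sub_self, zero_div, mul_zero, add_zero]

include hn in
theorem shell_mem {p : E} (h : 1 ≤ n p) : p ≠ 0 := by
  rintro rfl
  rw [hn.zero] at h
  linarith

include hg hn hL h1 h1' in
theorem shellFactor_bounds {p : E} (hp : g p ≤ 1) (hp' : 1 ≤ n p) (z : Circle) :
    let l := L ((g p)⁻¹ • p, z)
    g' l = 1 ∧ 1 < n' l ∧ (n' l)⁻¹ ≤ shellFactor g n n' L (p, z) ∧
      shellFactor g n n' L (p, z) ≤ 1 := by
  intro l
  have hp0 := shell_mem hn hp'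
  have hq := hg.inv_smul hp0
  have hl : g' l = 1 := hL.mem (A := {p | g p = 1}) hq z
  have hnl := h1' l hl
  have hnq := h1 _ hq
  have hgp := hg.pos p hp0
  have h2 : (n ((g p)⁻¹ • p))⁻¹ ≤ g p := by
    rw [hn.smul _ (inv_nonneg.2 (hg.nonneg p)), mul_inv, inv_inv]
    exact mul_le_of_le_one_right hgp.le (inv_le_one_of_one_le₀ hp')
  have h3 := inv_lt_one_of_one_lt₀ hnq
  have h4 := inv_lt_one_of_one_lt₀ hnl
  have hu0 : 0 ≤ (g p - (n ((g p)⁻¹ • p))⁻¹) / (1 - (n ((g p)⁻¹ • p))⁻¹) :=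
    div_nonneg (by linarith) (by linarith)
  have hu1 : (g p - (n ((g p)⁻¹ • p))⁻¹) / (1 - (n ((g p)⁻¹ • p))⁻¹) ≤ 1 :=
    (div_le_one (by linarith)).2 (by linarith)
  refine ⟨hl, hnl, ?_, ?_⟩
  · have := mul_nonneg (sub_nonneg.2 h4.le) hu0
    simp only [shellFactor]
    linarith
  · have := mul_le_mul_of_nonneg_left hu1 (sub_nonneg.2 h4.le)
    simp only [shellFactor]
    linarith

-- The gauge `g'` of the value recovers the factor, and dividing by it recovers `L (q, z)`, hence
-- `q` and `z` up to the involution. As the factor is strictly increasing in `g p`, the radius is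
-- recovered too.
include hg hn hg' hL h1 h1' in
theorem shellFold_injective {p q : E} (hp : g p ≤ 1) (hp' : 1 ≤ n p) (hq : g q ≤ 1)
    (hq' : 1 ≤ n q) (hσ : ∀ (t : ℝ) (p : E), σ (t • p) = t • σ p) (hnσ : ∀ p, n (σ p) = n p)
    {z w : Circle} (h : shellFold g n n' L (p, z) = shellFold g n n' L (q, w)) :
    (q = p ∧ w = z) ∨ (q = σ p ∧ w = z⁻¹) := by
  obtain ⟨a1, a2, a3, a4⟩ := shellFactor_bounds hg hn hL h1 h1' hp hp' z
  obtain ⟨b1, b2, b3, b4⟩ := shellFactor_bounds hg hn hL h1 h1' hq hq' w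
  have hp0 := shell_mem hn hp'
  have hq0 := shell_mem hn hq'
  have ha : 0 < shellFactor g n n' L (p, z) :=
    (inv_pos.2 (zero_lt_one.trans a2)).trans_le a3
  have hb : 0 < shellFactor g n n' L (q, w) :=
    (inv_pos.2 (zero_lt_one.trans b2)).trans_le b3
  simp only [shellFold] at h
  have hc : shellFactor g n n' L (p, z) = shellFactor g n n' L (q, w) := by
    have := congrArg g' h
    rwa [hg'.smul _ ha.le, hg'.smul _ hb.le, a1, b1, mul_one, mul_one] at this
  rw [hc] at h
  have hl := smul_right_injective E' hb.ne' h
  have hfold := (hL.eq_iff _ (hg.inv_smul hp0) _ (hg.inv_smul hq0) z w).1 hl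
  have hnn : n ((g q)⁻¹ • q) = n ((g p)⁻¹ • p) := by
    rcases hfold with ⟨h, -⟩ | ⟨h, -⟩
    · rw [h]
    · rw [h, hnσ]
  have hgg : g p = g q := by
    simp only [shellFactor] at hc
    rw [hnn, ← hl] at hc
    have h4 := inv_lt_one_of_one_lt₀ a2
    have h5 := inv_lt_one_of_one_lt₀ (h1 _ (hg.inv_smul hp0))
    have h6 := mul_left_cancel₀ (by linarith) (add_left_cancel hc)
    rw [div_left_inj' (by linarith)] at h6
    linarith
  have hgq := (hg.pos q hq0).ne'
  rcases hfold with ⟨h, hw⟩ | ⟨h, hw⟩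
  · refine Or.inl ⟨?_, hw⟩
    rw [hgg] at h
    exact smul_right_injective E (inv_ne_zero hgq) h
  · refine Or.inr ⟨?_, hw⟩
    rw [hgg, hσ] at h
    exact smul_right_injective E (inv_ne_zero hgq) h

include hg hn hg' hn' hL h1 h1' in
theorem exists_shellFold_eq {v : E'} (hv : g' v ≤ 1) (hv' : 1 ≤ n' v) :
    ∃ p, g p ≤ 1 ∧ 1 ≤ n p ∧ ∃ z, shellFold g n n' L (p, z) = v := by
  have hv0 := shell_mem hn' hv'
  have hgv := hg'.pos v hv0
  obtain ⟨q, hq, z, hl⟩ := hL.exists_eq (show (g' v)⁻¹ • v ∈ {v | g' v = 1} from hg'.inv_smul hv0)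
  rw [mem_ofPred_eq] at hq
  have hnq := inv_lt_one_of_one_lt₀ (h1 q hq)
  have hnq0 : 0 < (n q)⁻¹ := inv_pos.2 (zero_lt_one.trans (h1 q hq))
  have hnl := inv_lt_one_of_one_lt₀ (h1' _ (hg'.inv_smul hv0))
  have h2 : (n' ((g' v)⁻¹ • v))⁻¹ ≤ g' v := by
    rw [hn'.smul _ (inv_nonneg.2 (hg'.nonneg v)), mul_inv, inv_inv]
    exact mul_le_of_le_one_right hgv.le (inv_le_one_of_one_le₀ hv')
  generalize hβ : (n' ((g' v)⁻¹ • v))⁻¹ = β at *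
  generalize hα : (n q)⁻¹ = α at *
  -- This inverts the affine map of `shellFactor`: the relative position of `g' v` in `[β, 1]` is
  -- carried to `[α, 1]`.
  set t := α + (1 - α) * ((g' v - β) / (1 - β)) with ht
  have hu0 : 0 ≤ (g' v - β) / (1 - β) := div_nonneg (by linarith) (by linarith)
  have hu1 : (g' v - β) / (1 - β) ≤ 1 := (div_le_one (by linarith)).2 (by linarith)
  have ht0 : α ≤ t := by
    have := mul_nonneg (sub_nonneg.2 hnq.le) hu0
    linarith
  have ht1 : t ≤ 1 := by
    have := mul_le_mul_of_nonneg_left hu1 (sub_nonneg.2 hnq.le)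
    linarith
  have htpos : 0 < t := hnq0.trans_le ht0
  have hgt : g (t • q) = t := by rw [hg.smul _ htpos.le, hq, mul_one]
  have hback : (g (t • q))⁻¹ • t • q = q := by
    rw [hgt, smul_smul, inv_mul_cancel₀ htpos.ne', one_smul]
  refine ⟨t • q, hgt.trans_le ht1, ?_, z, ?_⟩
  · rw [hn.smul _ htpos.le]
    have h3 : 0 < n q := zero_lt_one.trans (h1 q hq)
    have h4 : α * n q = 1 := by rw [← hα, inv_mul_cancel₀ h3.ne']
    have := mul_le_mul_of_nonneg_right ht0 h3.le
    linarith
  · simp only [shellFold, shellFactor]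
    rw [hback, hl, hβ, hα, hgt, smul_smul]
    convert one_smul ℝ v using 2
    have e1 : (t - α) / (1 - α) = (g' v - β) / (1 - β) := by
      rw [ht, add_sub_cancel_left, mul_div_cancel_left₀ _ (by linarith)]
    have e2 : 1 - β ≠ 0 := by linarith
    rw [e1, mul_div_cancel₀ _ e2]
    field_simp
    ring

include hg hn hg' hn' hL h1 h1' in
theorem isFold_shellFold [ContinuousSMul ℝ E] [ContinuousSMul ℝ E']
    (hσ : ∀ (t : ℝ) (p : E), σ (t • p) = t • σ p) (hnσ : ∀ p, n (σ p) = n p)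
    (hgσ : ∀ p, g (σ p) = g p) :
    IsFold σ (shellFold g n n' L) {p | g p ≤ 1 ∧ 1 ≤ n p} {v | g' v ≤ 1 ∧ 1 ≤ n' v} where
  continuousOn := by
    have hq : ContinuousOn (fun p : E × Circle => (g p.1)⁻¹ • p.1)
        ({p | g p ≤ 1 ∧ 1 ≤ n p} ×ˢ univ) := by
      refine ContinuousOn.smul (ContinuousOn.inv₀ (hg.continuous.comp
        continuous_fst).continuousOn fun p hp => ?_) continuous_fst.continuousOn
      exact (hg.pos _ (shell_mem hn hp.1.2)).ne'
    have hl : ContinuousOn (fun p : E × Circle => L ((g p.1)⁻¹ • p.1, p.2))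
        ({p | g p ≤ 1 ∧ 1 ≤ n p} ×ˢ univ) :=
      hL.continuousOn.comp (hq.prodMk continuous_snd.continuousOn) fun p hp =>
        ⟨hg.inv_smul (shell_mem hn hp.1.2), mem_univ _⟩
    have ha : ContinuousOn (fun p : E × Circle => (n ((g p.1)⁻¹ • p.1))⁻¹)
        ({p | g p ≤ 1 ∧ 1 ≤ n p} ×ˢ univ) := by
      refine (hn.continuous.comp_continuousOn hq).inv₀ fun p hp => ?_
      have := h1 _ (hg.inv_smul (shell_mem hn hp.1.2))
      exact (zero_lt_one.trans this).ne'
    have hb : ContinuousOn (fun p : E × Circle => (n' (L ((g p.1)⁻¹ • p.1, p.2)))⁻¹)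
        ({p | g p ≤ 1 ∧ 1 ≤ n p} ×ˢ univ) := by
      refine (hn'.continuous.comp_continuousOn hl).inv₀ fun p hp => ?_
      have := (shellFactor_bounds hg hn hL h1 h1' hp.1.1 hp.1.2 p.2).2.1
      exact (zero_lt_one.trans this).ne'
    refine ContinuousOn.smul (hb.add ((continuousOn_const.sub hb).mul
      (((hg.continuous.comp continuous_fst).continuousOn.sub ha).div
        (continuousOn_const.sub ha) fun p hp => ?_))) hl
    have := inv_lt_one_of_one_lt₀ (h1 _ (hg.inv_smul (shell_mem hn hp.1.2)))
    exact sub_ne_zero.2 this.ne'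
  image_eq := by
    ext v
    constructor
    · rintro ⟨⟨p, z⟩, ⟨⟨hp, hp'⟩, -⟩, rfl⟩
      obtain ⟨a1, a2, a3, a4⟩ := shellFactor_bounds hg hn hL h1 h1' hp hp' z
      have h0 : 0 < n' (L ((g p)⁻¹ • p, z)) := zero_lt_one.trans a2
      have hc := (inv_pos.2 h0).trans_le a3
      rw [mem_ofPred_eq, shellFold, hg'.smul _ hc.le, hn'.smul _ hc.le, a1, mul_one]
      refine ⟨a4, ?_⟩
      have := mul_le_mul_of_nonneg_right a3 h0.le
      rwa [inv_mul_cancel₀ h0.ne'] at this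
    · rintro ⟨hv, hv'⟩
      obtain ⟨p, hp, hp', z, h⟩ := exists_shellFold_eq hg hn hg' hn' hL h1 h1' hv hv'
      exact ⟨(p, z), ⟨⟨hp, hp'⟩, mem_univ _⟩, h⟩
  mapsTo p hp := ⟨(hgσ p).trans_le hp.1, hp.2.trans_eq (hnσ p).symm⟩
  eq_iff p hp q hq z w := by
    refine ⟨shellFold_injective hg hn hg' hL h1 h1' hp.1 hp.2 hq.1 hq.2 hσ hnσ, ?_⟩
    rintro (⟨rfl, rfl⟩ | ⟨rfl, rfl⟩)
    · rfl
    · have := hL.apply_inv (show (g p)⁻¹ • p ∈ {p | g p = 1} from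
        hg.inv_smul (shell_mem hn hp.2)) z
      simp only [shellFold, shellFactor, hgσ, ← hσ, hnσ, this]

end Shell

/-! ### The shells in the plane and in space -/

/-- The gauge of the rectangle with half-sides `a` and `π / 2`. -/
def rectGauge (a : ℝ) (p : ℝ × ℝ) : ℝ := max (|p.1| / a) (|p.2| / (Real.pi / 2))

/-- The gauge of the cylinder of half-length `a` and radius `2`. -/
def cylGauge (a : ℝ) (v : ℝ × ℂ) : ℝ := max (|v.1| / a) (‖v.2‖ / 2)

/-- The Euclidean norm of the plane. -/
def planeNorm (p : ℝ × ℝ) : ℝ := √(p.1 ^ 2 + p.2 ^ 2)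

/-- The Euclidean norm of space. -/
def spaceNorm (v : ℝ × ℂ) : ℝ := √(v.1 ^ 2 + ‖v.2‖ ^ 2)

theorem isGauge_rectGauge {a : ℝ} (ha : 0 < a) : IsGauge (rectGauge a) where
  continuous := by unfold rectGauge; fun_prop
  smul t ht v := by
    simp only [rectGauge, Prod.smul_fst, Prod.smul_snd, smul_eq_mul, abs_mul, abs_of_nonneg ht]
    rw [mul_max_of_nonneg _ _ ht, mul_div_assoc, mul_div_assoc]
  pos v hv := by
    rw [rectGauge, lt_max_iff]
    by_cases h : v.1 = 0
    · have : v.2 ≠ 0 := fun h' => hv (Prod.ext h h')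
      right
      have := Real.pi_pos
      positivity
    · left
      positivity

theorem isGauge_cylGauge {a : ℝ} (ha : 0 < a) : IsGauge (cylGauge a) where
  continuous := by unfold cylGauge; fun_prop
  smul t ht v := by
    simp only [cylGauge, Prod.smul_fst, Prod.smul_snd, smul_eq_mul, abs_mul, abs_of_nonneg ht,
      norm_smul, Real.norm_eq_abs]
    rw [mul_max_of_nonneg _ _ ht, mul_div_assoc, mul_div_assoc]
  pos v hv := by
    rw [cylGauge, lt_max_iff]
    by_cases h : v.1 = 0
    · have : v.2 ≠ 0 := fun h' => hv (Prod.ext h h')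
      right
      positivity
    · left
      positivity

theorem isGauge_planeNorm : IsGauge planeNorm where
  continuous := by unfold planeNorm; fun_prop
  smul t ht v := by
    simp only [planeNorm, Prod.smul_fst, Prod.smul_snd, smul_eq_mul, mul_pow]
    rw [← mul_add, Real.sqrt_mul (sq_nonneg t), Real.sqrt_sq ht]
  pos v hv := by
    rw [planeNorm, Real.sqrt_pos]
    by_cases h : v.1 = 0
    · have : v.2 ≠ 0 := fun h' => hv (Prod.ext h h')
      positivity
    · positivity

theorem isGauge_spaceNorm : IsGauge spaceNorm where
  continuous := by unfold spaceNorm; fun_prop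
  smul t ht v := by
    simp only [spaceNorm, Prod.smul_fst, Prod.smul_snd, smul_eq_mul, mul_pow, norm_smul,
      Real.norm_eq_abs, sq_abs]
    rw [← mul_add, Real.sqrt_mul (sq_nonneg t), Real.sqrt_sq ht]
  pos v hv := by
    rw [spaceNorm, Real.sqrt_pos]
    by_cases h : v.1 = 0
    · have : v.2 ≠ 0 := fun h' => hv (Prod.ext h h')
      positivity
    · positivity

theorem rectGauge_le_one_iff {a : ℝ} (ha : 0 < a) {p : ℝ × ℝ} :
    rectGauge a p ≤ 1 ↔ |p.1| ≤ a ∧ |p.2| ≤ Real.pi / 2 := by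
  rw [rectGauge, max_le_iff, div_le_one ha, div_le_one (by positivity)]

theorem cylGauge_le_one_iff {a : ℝ} (ha : 0 < a) {v : ℝ × ℂ} :
    cylGauge a v ≤ 1 ↔ |v.1| ≤ a ∧ ‖v.2‖ ≤ 2 := by
  rw [cylGauge, max_le_iff, div_le_one ha, div_le_one two_pos]

theorem rectGauge_lt_one_iff {a : ℝ} (ha : 0 < a) {p : ℝ × ℝ} :
    rectGauge a p < 1 ↔ |p.1| < a ∧ |p.2| < Real.pi / 2 := by
  rw [rectGauge, max_lt_iff, div_lt_one ha, div_lt_one (by positivity)]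

theorem cylGauge_lt_one_iff {a : ℝ} (ha : 0 < a) {v : ℝ × ℂ} :
    cylGauge a v < 1 ↔ |v.1| < a ∧ ‖v.2‖ < 2 := by
  rw [cylGauge, max_lt_iff, div_lt_one ha, div_lt_one two_pos]

theorem setOf_rectGauge_le_one {a : ℝ} (ha : 0 < a) :
    {p | rectGauge a p ≤ 1} = Icc (-a) a ×ˢ Icc (-(Real.pi / 2)) (Real.pi / 2) := by
  ext p
  rw [mem_ofPred_eq, rectGauge_le_one_iff ha, abs_le, abs_le]
  rfl

theorem setOf_cylGauge_le_one {a : ℝ} (ha : 0 < a) :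
    {v | cylGauge a v ≤ 1} = Icc (-a) a ×ˢ closedBall 0 2 := by
  ext p
  rw [mem_ofPred_eq, cylGauge_le_one_iff ha, abs_le, ← mem_closedBall_zero_iff]
  rfl

theorem isFold_boxFold_rect {a : ℝ} (ha : 0 < a) :
    IsFold planeRefl boxFold {p | rectGauge a p ≤ 1} {v | cylGauge a v ≤ 1} := by
  rw [setOf_rectGauge_le_one ha, setOf_cylGauge_le_one ha]
  exact isFold_boxFold _

theorem cylGauge_boxFold_lt_one_iff {a : ℝ} (ha : 0 < a) {p : ℝ × ℝ} (hp : rectGauge a p ≤ 1)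
    (z : Circle) : cylGauge a (boxFold (p, z)) < 1 ↔ rectGauge a p < 1 := by
  have h1 := (cylGauge_le_one_iff ha).1 ((isFold_boxFold_rect ha).mem hp z)
  rw [rectGauge_le_one_iff ha] at hp
  rw [cylGauge_lt_one_iff ha, rectGauge_lt_one_iff ha, h1.2.lt_iff_ne, hp.2.lt_iff_ne, Ne, Ne,
    norm_boxFold_snd_eq_two_iff hp.2]
  rfl

theorem rectGauge_planeRefl (a : ℝ) (p : ℝ × ℝ) : rectGauge a (planeRefl p) = rectGauge a p := by
  simp [rectGauge, planeRefl]

theorem isFold_boxFold_boundary {a : ℝ} (ha : 0 < a) :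
    IsFold planeRefl boxFold {p | rectGauge a p = 1} {v | cylGauge a v = 1} := by
  have h := (isFold_boxFold_rect ha).restrict (A' := {p | rectGauge a p = 1})
    (fun p hp => le_of_eq hp) fun p hp => (rectGauge_planeRefl a p).trans hp
  convert! h
  ext v
  constructor
  · intro hv
    obtain ⟨p, hp, z, rfl⟩ := (isFold_boxFold_rect ha).exists_eq (le_of_eq hv)
    refine ⟨(p, z), ⟨?_, mem_univ _⟩, rfl⟩
    by_contra hne
    have := (cylGauge_boxFold_lt_one_iff ha hp z).2 (lt_of_le_of_ne hp hne)
    exact this.ne hv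
  · rintro ⟨⟨p, z⟩, ⟨hp, -⟩, rfl⟩
    have hp1 : rectGauge a p = 1 := hp
    by_contra hne
    have h2 := (isFold_boxFold_rect ha).mem hp1.le z
    have := (cylGauge_boxFold_lt_one_iff ha hp1.le z).1 (lt_of_le_of_ne h2 hne)
    exact this.ne hp1

/-- The half-sides `3 / 2` and `π / 2` both exceed `1`, so the unit disc lies inside the rectangle.
The value `3 / 2` is also half the distance between consecutive ball centres, so neighbouring
rectangles only share an edge. -/
theorem one_lt_planeNorm {p : ℝ × ℝ} (hp : rectGauge (3 / 2) p = 1) : 1 < planeNorm p := by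
  rw [planeNorm, Real.lt_sqrt zero_le_one]
  have h2 := Real.pi_gt_three
  rw [rectGauge] at hp
  rcases max_eq_iff.1 hp with ⟨h, -⟩ | ⟨h, -⟩
  · rw [div_eq_one_iff_eq (by norm_num)] at h
    rw [← sq_abs p.1, h]
    nlinarith [sq_nonneg p.2]
  · rw [div_eq_one_iff_eq (by positivity)] at h
    rw [← sq_abs p.2, h]
    nlinarith [sq_nonneg p.1]

/-- The boundary of the cylinder has distance `3 / 2` from the origin. The number `7 / 5`, chosen
between `1` and `3 / 2`, leaves a collar of the unit ball in which `twist` can die out. -/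
theorem lt_spaceNorm {v : ℝ × ℂ} (hv : cylGauge (3 / 2) v = 1) : 7 / 5 < spaceNorm v := by
  rw [spaceNorm, Real.lt_sqrt (by norm_num)]
  rw [cylGauge] at hv
  rcases max_eq_iff.1 hv with ⟨h, -⟩ | ⟨h, -⟩
  · rw [div_eq_one_iff_eq (by norm_num)] at h
    rw [← sq_abs v.1, h]
    nlinarith [sq_nonneg ‖v.2‖]
  · rw [div_eq_one_iff_eq two_ne_zero] at h
    rw [h]
    nlinarith [sq_nonneg v.1]

/-- The fold of the shell between the unit disc and the rectangle onto the shell between the unit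
ball and the cylinder. -/
def shell : (ℝ × ℝ) × Circle → ℝ × ℂ :=
  shellFold (rectGauge (3 / 2)) planeNorm spaceNorm boxFold

theorem isFold_shell : IsFold planeRefl shell {p | rectGauge (3 / 2) p ≤ 1 ∧ 1 ≤ planeNorm p}
    {v | cylGauge (3 / 2) v ≤ 1 ∧ 1 ≤ spaceNorm v} := by
  have ha : (0 : ℝ) < 3 / 2 := by norm_num
  refine isFold_shellFold (isGauge_rectGauge ha) isGauge_planeNorm (isGauge_cylGauge ha)
    isGauge_spaceNorm (isFold_boxFold_boundary ha) (fun p => one_lt_planeNorm)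
    (fun v hv => lt_trans (by norm_num) (lt_spaceNorm hv)) ?_ ?_ (rectGauge_planeRefl _)
  · intro t p
    simp [planeRefl]
  · intro p
    simp [planeNorm, planeRefl]

theorem shell_of_rectGauge_eq_one {p : ℝ × ℝ} (hp : rectGauge (3 / 2) p = 1) (z : Circle) :
    shell (p, z) = boxFold (p, z) :=
  shellFold_of_gauge_eq_one (g := rectGauge (3 / 2)) (n := planeNorm)
    (fun _ => one_lt_planeNorm) hp z

theorem spaceNorm_shell {p : ℝ × ℝ} (hp : planeNorm p = 1) (z : Circle) :
    spaceNorm (shell (p, z)) = 1 := by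
  have ha : (0 : ℝ) < 3 / 2 := by norm_num
  rw [shell, shellFold_of_norm_eq_one (isGauge_rectGauge ha) isGauge_planeNorm hp]
  refine isGauge_spaceNorm.inv_smul (isGauge_spaceNorm.ne_zero ?_)
  have h0 := shell_mem isGauge_planeNorm hp.ge
  have h1 := (isFold_boxFold_boundary ha).mem
    (show _ ∈ {p | rectGauge (3 / 2) p = 1} from (isGauge_rectGauge ha).inv_smul h0) z
  have := lt_spaceNorm h1
  linarith

theorem rectGauge_le_one_of_planeNorm {p : ℝ × ℝ} (hp : planeNorm p ≤ 1) :
    rectGauge (3 / 2) p < 1 := by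
  rw [planeNorm, Real.sqrt_le_iff] at hp
  rw [rectGauge_lt_one_iff (by norm_num)]
  have := Real.pi_gt_three
  constructor <;> refine abs_lt_of_sq_lt_sq ?_ (by positivity) <;>
    nlinarith [sq_nonneg p.1, sq_nonneg p.2, hp.2]

theorem cylGauge_lt_one_of_spaceNorm {v : ℝ × ℂ} (hv : spaceNorm v ≤ 1) :
    cylGauge (3 / 2) v < 1 := by
  rw [spaceNorm, Real.sqrt_le_iff] at hv
  rw [cylGauge_lt_one_iff (by norm_num)]
  constructor
  · refine abs_lt_of_sq_lt_sq ?_ (by positivity)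
    nlinarith [sq_nonneg ‖v.2‖, hv.2]
  · refine lt_of_pow_lt_pow_left₀ 2 (by positivity) ?_
    nlinarith [sq_nonneg v.1, hv.2]

/-! ### A twist of space near the unit ball -/

theorem cylGauge_lt_one_of_spaceNorm_lt {v : ℝ × ℂ} (hv : spaceNorm v < 3 / 2) :
    cylGauge (3 / 2) v < 1 := by
  rw [spaceNorm, Real.sqrt_lt' (by norm_num)] at hv
  rw [cylGauge_lt_one_iff (by norm_num)]
  constructor
  · refine abs_lt_of_sq_lt_sq ?_ (by positivity)
    nlinarith [sq_nonneg ‖v.2‖]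
  · refine lt_of_pow_lt_pow_left₀ 2 (by positivity) ?_
    nlinarith [sq_nonneg v.1]

/-- The angle of the twist. -/
def twistAngle (v : ℝ × ℂ) : ℝ := Real.pi / 2 * max 0 (1 - 5 / 2 * (spaceNorm v - 1))

/-- The rotation of space by the angle `θ` in the plane of the first two coordinates. -/
def spaceRot (θ : ℝ) (v : ℝ × ℂ) : ℝ × ℂ :=
  (Real.cos θ * v.1 + Real.sin θ * v.2.re,
    (Real.cos θ * v.2.re - Real.sin θ * v.1 : ℝ) + (v.2.im : ℂ) * Complex.I)

theorem spaceNorm_eq (v : ℝ × ℂ) : spaceNorm v = √(v.1 ^ 2 + v.2.re ^ 2 + v.2.im ^ 2) := by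
  rw [spaceNorm, Complex.sq_norm, Complex.normSq_apply]
  congr 1
  ring

theorem spaceNorm_spaceRot (θ : ℝ) (v : ℝ × ℂ) : spaceNorm (spaceRot θ v) = spaceNorm v := by
  rw [spaceNorm_eq, spaceNorm_eq]
  congr 1
  simp only [spaceRot, Complex.add_re, Complex.add_im, Complex.mul_re, Complex.mul_im,
    Complex.ofReal_re, Complex.ofReal_im, Complex.I_re, Complex.I_im]
  linear_combination (v.1 ^ 2 + v.2.re ^ 2) * Real.sin_sq_add_cos_sq θ

theorem spaceRot_neg_spaceRot (θ : ℝ) (v : ℝ × ℂ) : spaceRot (-θ) (spaceRot θ v) = v := by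
  refine Prod.ext ?_ (Complex.ext ?_ ?_) <;>
    simp only [spaceRot, Complex.add_re, Complex.add_im, Complex.mul_re, Complex.mul_im,
      Complex.ofReal_re, Complex.ofReal_im, Complex.I_re, Complex.I_im, Real.cos_neg, Real.sin_neg]
  · linear_combination v.1 * Real.sin_sq_add_cos_sq θ
  · linear_combination v.2.re * Real.sin_sq_add_cos_sq θ
  · ring

/-- The twist: a homeomorphism of space which preserves the spheres about the origin, is a
quarter turn on the unit sphere, and the identity away from the unit ball. -/
def twist (v : ℝ × ℂ) : ℝ × ℂ := spaceRot (twistAngle v) v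

theorem spaceNorm_twist (v : ℝ × ℂ) : spaceNorm (twist v) = spaceNorm v := spaceNorm_spaceRot _ _

theorem continuous_twist : Continuous twist := by
  have h1 := isGauge_spaceNorm.continuous
  have h2 : Continuous twistAngle := by
    unfold twistAngle
    fun_prop
  have h3 := Real.continuous_cos.comp h2
  have h4 := Real.continuous_sin.comp h2
  simp only [Function.comp_def] at h3 h4
  have h5 : Continuous fun v : ℝ × ℂ => v.2.re := Complex.continuous_re.comp continuous_snd
  have h6 : Continuous fun v : ℝ × ℂ => v.2.im := Complex.continuous_im.comp continuous_snd
  unfold twist spaceRot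
  fun_prop

theorem twistAngle_congr {u v : ℝ × ℂ} (h : spaceNorm u = spaceNorm v) :
    twistAngle u = twistAngle v := by rw [twistAngle, twistAngle, h]

/-- The angle depends only on the radius, which a rotation preserves, so the opposite rotation
undoes the twist. -/
theorem twist_injective : Function.Injective twist := fun u v h => by
  have h1 : twistAngle u = twistAngle v := by
    rw [← twistAngle_congr (spaceNorm_twist u), h, twistAngle_congr (spaceNorm_twist v)]
  have h2 := congrArg (spaceRot (-twistAngle u)) h
  rwa [twist, spaceRot_neg_spaceRot, twist, h1, spaceRot_neg_spaceRot] at h2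

theorem exists_twist_eq (v : ℝ × ℂ) : ∃ u, spaceNorm u = spaceNorm v ∧ twist u = v := by
  refine ⟨spaceRot (-twistAngle v) v, spaceNorm_spaceRot _ _, ?_⟩
  rw [twist, twistAngle_congr (spaceNorm_spaceRot (-twistAngle v) v)]
  have := spaceRot_neg_spaceRot (-twistAngle v) v
  rwa [neg_neg] at this

/-- The slope `5 / 2` in `twistAngle` brings the angle from `π / 2` at radius `1` down to `0` at
radius `7 / 5`. -/
theorem twist_of_le_spaceNorm {v : ℝ × ℂ} (h : 7 / 5 ≤ spaceNorm v) : twist v = v := by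
  rw [twist, twistAngle, max_eq_left (by linarith), mul_zero]
  simp [spaceRot, Complex.re_add_im]

theorem twist_of_spaceNorm_eq_one {v : ℝ × ℂ} (h : spaceNorm v = 1) :
    twist v = (v.2.re, (-v.1 : ℝ) + (v.2.im : ℂ) * Complex.I) := by
  rw [twist, twistAngle, h]
  simp [spaceRot]

theorem cylGauge_twist_le_one_iff {v : ℝ × ℂ} :
    cylGauge (3 / 2) (twist v) ≤ 1 ↔ cylGauge (3 / 2) v ≤ 1 := by
  by_cases h : 7 / 5 ≤ spaceNorm v
  · rw [twist_of_le_spaceNorm h]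
  · have h1 : spaceNorm v < 3 / 2 := by linarith
    exact iff_of_true (cylGauge_lt_one_of_spaceNorm_lt ((spaceNorm_twist v).trans_lt h1)).le
      (cylGauge_lt_one_of_spaceNorm_lt h1).le

/-- The twist preserves the spheres about the origin and moves only points of radius less than `7 /
5`, which lie inside the cylinder. -/
theorem twist_image_shell :
    twist '' {v | cylGauge (3 / 2) v ≤ 1 ∧ 1 ≤ spaceNorm v} =
      {v | cylGauge (3 / 2) v ≤ 1 ∧ 1 ≤ spaceNorm v} := by
  ext v
  constructor
  · rintro ⟨u, ⟨h1, h2⟩, rfl⟩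
    exact ⟨cylGauge_twist_le_one_iff.2 h1, h2.trans_eq (spaceNorm_twist u).symm⟩
  · rintro ⟨h1, h2⟩
    obtain ⟨u, hu, rfl⟩ := exists_twist_eq v
    exact ⟨u, ⟨cylGauge_twist_le_one_iff.1 h1, h2.trans_eq hu.symm⟩, rfl⟩

/-! ### Inversions of the sphere -/

/-- The north pole. -/
def northPole (d : ℕ) : Sph d :=
  ⟨EuclideanSpace.single (Fin.last d) 1, by simp⟩

theorem eq_northPole_iff {d : ℕ} {x : Sph d} : x = northPole d ↔ x.1 (Fin.last d) = 1 := by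
  constructor
  · rintro rfl
    simp [northPole]
  · intro h
    have hs : ∑ i : Fin d, x.1 i.castSucc ^ 2 + x.1 (Fin.last d) ^ 2 = 1 := by
      rw [← Fin.sum_univ_castSucc (fun i => x.1 i ^ 2), ← EuclideanSpace.real_norm_sq_eq,
        mem_sphere_zero_iff_norm.1 x.2, one_pow]
    have h0 : ∑ i : Fin d, x.1 i.castSucc ^ 2 = 0 := by
      rw [h] at hs
      linarith
    rw [Finset.sum_eq_zero_iff_of_nonneg fun i _ => sq_nonneg _] at h0
    apply Subtype.ext
    ext i
    refine Fin.lastCases ?_ (fun j => ?_) i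
    · rw [h]
      simp [northPole]
    · have := h0 j (Finset.mem_univ _)
      rw [pow_eq_zero_iff two_ne_zero] at this
      simp [northPole, this, (Fin.castSucc_lt_last j).ne]

theorem one_sub_stereoInvVec_last {d : ℕ} (y : Euc d) :
    1 - stereoInvVec y (Fin.last d) = 2 / (‖y‖ ^ 2 + 1) := by
  have h0 : ‖y‖ ^ 2 + 1 ≠ 0 := by positivity
  rw [stereoInvVec_last]
  field_simp
  ring

theorem stereoInv_ne_northPole {d : ℕ} (y : Euc d) : stereoInv y ≠ northPole d := fun h => by
  have h1 : stereoInvVec y (Fin.last d) = 1 := eq_northPole_iff.1 h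
  have h2 := one_sub_stereoInvVec_last y
  have h3 : 0 < 2 / (‖y‖ ^ 2 + 1) := by positivity
  linarith

theorem exists_stereoInv_eq {d : ℕ} {x : Sph d} (hx : x ≠ northPole d) :
    ∃ y, stereoInv y = x := by
  have hx1 : 1 - x.1 (Fin.last d) ≠ 0 := sub_ne_zero.2 fun h => hx (eq_northPole_iff.2 h.symm)
  have hs : ∑ i : Fin d, x.1 i.castSucc ^ 2 + x.1 (Fin.last d) ^ 2 = 1 := by
    rw [← Fin.sum_univ_castSucc (fun i => x.1 i ^ 2), ← EuclideanSpace.real_norm_sq_eq,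
      mem_sphere_zero_iff_norm.1 x.2, one_pow]
  let y : Euc d := WithLp.toLp 2 fun i => x.1 i.castSucc / (1 - x.1 (Fin.last d))
  have hn : ‖y‖ ^ 2 = (1 + x.1 (Fin.last d)) / (1 - x.1 (Fin.last d)) := by
    rw [EuclideanSpace.real_norm_sq_eq]
    simp only [y, div_pow]
    rw [← Finset.sum_div]
    field_simp
    linarith
  have hn1 : ‖y‖ ^ 2 + 1 = 2 / (1 - x.1 (Fin.last d)) := by
    rw [hn]; field_simp; ring
  refine ⟨y, Subtype.ext ?_⟩
  ext i
  change stereoInvVec y i = x.1 i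
  refine Fin.lastCases ?_ (fun j => ?_) i
  · rw [stereoInvVec_last, hn1, hn]; field_simp; ring
  · rw [stereoInvVec_castSucc, hn1]; simp only [y]; field_simp

theorem stereoInv_injective {d : ℕ} : Function.Injective (stereoInv : Euc d → Sph d) :=
  stereoInv_isOpenEmbedding.injective

open Filter Bornology

/-- Images of closed balls are compact and miss the pole, so their complements are neighbourhoods of
it. With `tendsto_stereoInv_cobounded` this turns continuity at the pole into behaviour at infinity.
-/
theorem nhdsNE_northPole_le {d : ℕ} :
    𝓝[≠] northPole d ≤ map stereoInv (cobounded (Euc d)) := by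
  intro S hS
  rw [mem_map, ← comap_norm_atTop, mem_comap] at hS
  obtain ⟨T, hT, hTS⟩ := hS
  obtain ⟨R, hR⟩ := mem_atTop_sets.1 hT
  have hc : IsClosed (stereoInv '' closedBall (0 : Euc d) R) :=
    ((isCompact_closedBall _ _).image stereoInv_isOpenEmbedding.continuous).isClosed
  rw [mem_nhdsWithin]
  refine ⟨_, hc.isOpen_compl, ?_, ?_⟩
  · rintro ⟨y, -, hy⟩
    exact stereoInv_ne_northPole y hy
  · rintro x ⟨hx, hx'⟩
    obtain ⟨y, rfl⟩ := exists_stereoInv_eq hx'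
    refine hTS (hR _ ?_)
    by_contra h
    exact hx ⟨y, mem_closedBall_zero_iff.2 (not_le.1 h).le, rfl⟩

theorem tendsto_stereoInv_cobounded {d : ℕ} :
    Tendsto (stereoInv : Euc d → Sph d) (cobounded (Euc d)) (𝓝 (northPole d)) := by
  intro S hS
  have h1 : IsCompact (interior S)ᶜ := isOpen_interior.isClosed_compl.isCompact
  have h2 : (interior S)ᶜ ⊆ range (stereoInv : Euc d → Sph d) := fun x hx => by
    refine exists_stereoInv_eq ?_
    rintro rfl
    exact hx (mem_interior_iff_mem_nhds.2 hS)
  have h3 : IsCompact (stereoInv ⁻¹' (interior S)ᶜ) :=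
    stereoInv_isOpenEmbedding.isInducing.isCompact_preimage_iff h2 |>.2 h1
  have h4 := isBounded_def.1 h3.isBounded
  rw [mem_map]
  filter_upwards [h4] with y hy
  have hy' : stereoInv y ∈ interior S := by simpa using hy
  exact (interior_subset hy' : stereoInv y ∈ S)

section Inversion

variable {d : ℕ} {g : Euc d → ℝ} {m : Euc d}

/-- By homogeneity it is enough to bound `g` on the compact unit sphere. These bounds show that
`gaugeInv` exchanges the origin and infinity, as the round inversion does. -/
theorem IsGauge.exists_bounds (hg : IsGauge g) :
    ∃ c > 0, ∃ C > 0, ∀ v, c * ‖v‖ ≤ g v ∧ g v ≤ C * ‖v‖ := by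
  obtain ⟨c, hc, h1⟩ := (isCompact_sphere (0 : Euc d) 1).exists_forall_le' (a := 0)
    hg.continuous.continuousOn fun v hv => hg.pos v (ne_of_mem_sphere hv one_ne_zero)
  obtain ⟨C, h2⟩ := (isCompact_sphere (0 : Euc d) 1).bddAbove_image hg.continuous.continuousOn
  refine ⟨c, hc, max C 1, by positivity, fun v => ?_⟩
  rcases eq_or_ne v 0 with rfl | hv
  · simp [hg.zero]
  · have hn : 0 < ‖v‖ := norm_pos_iff.2 hv
    have hs : ‖v‖⁻¹ • v ∈ sphere (0 : Euc d) 1 := by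
      rw [mem_sphere_zero_iff_norm, norm_smul, norm_inv, norm_norm, inv_mul_cancel₀ hn.ne']
    have e : g v = ‖v‖ * g (‖v‖⁻¹ • v) := by
      rw [hg.smul _ (inv_nonneg.2 hn.le), mul_inv_cancel_left₀ hn.ne']
    rw [e, mul_comm c, mul_comm _ ‖v‖]
    exact ⟨mul_le_mul_of_nonneg_left (h1 _ hs) hn.le,
      mul_le_mul_of_nonneg_left ((h2 (mem_image_of_mem g hs)).trans (le_max_left _ _)) hn.le⟩

/-- The inversion `v ↦ v / g v ^ 2` of `ℝᵈ` with respect to a gauge. -/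
def gaugeInv (g : Euc d → ℝ) (v : Euc d) : Euc d := (g v ^ 2)⁻¹ • v

theorem IsGauge.gauge_gaugeInv (hg : IsGauge g) (v : Euc d) : g (gaugeInv g v) = (g v)⁻¹ := by
  rw [gaugeInv, hg.smul _ (by positivity)]
  by_cases h : g v = 0
  · simp [h]
  · field_simp

theorem IsGauge.gaugeInv_ne_zero (hg : IsGauge g) {v : Euc d} (hv : v ≠ 0) : gaugeInv g v ≠ 0 := by
  have := hg.pos v hv
  exact smul_ne_zero (by positivity) hv

theorem IsGauge.gaugeInv_gaugeInv (hg : IsGauge g) {v : Euc d} (hv : v ≠ 0) :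
    gaugeInv g (gaugeInv g v) = v := by
  have := (hg.pos v hv).ne'
  rw [gaugeInv, hg.gauge_gaugeInv, gaugeInv, smul_smul]
  convert one_smul ℝ v using 2
  field_simp

theorem IsGauge.tendsto_gaugeInv_zero (hg : IsGauge g) :
    Tendsto (gaugeInv g) (𝓝[≠] 0) (cobounded (Euc d)) := by
  obtain ⟨c, hc, C, hC, h⟩ := hg.exists_bounds
  rw [← tendsto_norm_atTop_iff_cobounded]
  have h1 : Tendsto (fun v : Euc d => (C ^ 2)⁻¹ * ‖v‖⁻¹) (𝓝[≠] 0) atTop := by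
    refine Tendsto.const_mul_atTop (by positivity) ?_
    exact tendsto_norm_nhdsNE_zero.inv_tendsto_nhdsGT_zero
  refine tendsto_atTop_mono' _ ?_ h1
  filter_upwards [self_mem_nhdsWithin] with v hv
  have hv0 : 0 < ‖v‖ := norm_pos_iff.2 hv
  have hgv := hg.pos v hv
  rw [gaugeInv, norm_smul, norm_inv, norm_pow, Real.norm_eq_abs, sq_abs]
  have h2 : g v ^ 2 ≤ (C * ‖v‖) ^ 2 := pow_le_pow_left₀ hgv.le (h v).2 2
  calc (C ^ 2)⁻¹ * ‖v‖⁻¹ = ((C * ‖v‖) ^ 2)⁻¹ * ‖v‖ := by field_simp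
    _ ≤ _ := by gcongr

theorem IsGauge.tendsto_gaugeInv_cobounded (hg : IsGauge g) :
    Tendsto (gaugeInv g) (cobounded (Euc d)) (𝓝 0) := by
  obtain ⟨c, hc, C, hC, h⟩ := hg.exists_bounds
  have h1 : Tendsto (fun v : Euc d => (c ^ 2)⁻¹ * ‖v‖⁻¹) (cobounded (Euc d)) (𝓝 0) := by
    have := (tendsto_norm_cobounded_atTop (E := Euc d)).inv_tendsto_atTop.const_mul (c ^ 2)⁻¹
    rwa [mul_zero] at this
  refine squeeze_zero_norm' ?_ h1
  have h2 : ∀ᶠ v in cobounded (Euc d), 0 < ‖v‖ :=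
    tendsto_norm_cobounded_atTop.eventually_gt_atTop 0
  filter_upwards [h2] with v hv0
  rw [gaugeInv, norm_smul, norm_inv, norm_pow, Real.norm_eq_abs, sq_abs]
  have h3 : (c * ‖v‖) ^ 2 ≤ g v ^ 2 := pow_le_pow_left₀ (by positivity) (h v).1 2
  calc (g v ^ 2)⁻¹ * ‖v‖ ≤ ((c * ‖v‖) ^ 2)⁻¹ * ‖v‖ := by gcongr
    _ = (c ^ 2)⁻¹ * ‖v‖⁻¹ := by field_simp

open Classical in
/-- The inversion of the sphere at `{g (y - m) = 1}`, in stereographic coordinates. -/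
def sphInv (g : Euc d → ℝ) (m : Euc d) (x : Sph d) : Sph d :=
  if x = northPole d then stereoInv m else if x = stereoInv m then northPole d else
    stereoInv (m + gaugeInv g (Function.invFun stereoInv x - m))

theorem sphInv_northPole : sphInv g m (northPole d) = stereoInv m := if_pos rfl

theorem sphInv_center : sphInv g m (stereoInv m) = northPole d := by
  rw [sphInv, if_neg (stereoInv_ne_northPole m), if_pos rfl]

theorem sphInv_stereoInv {v : Euc d} (hv : v ≠ 0) :
    sphInv g m (stereoInv (m + v)) = stereoInv (m + gaugeInv g v) := by
  rw [sphInv, if_neg (stereoInv_ne_northPole _), if_neg,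
    Function.leftInverse_invFun stereoInv_injective, add_sub_cancel_left]
  intro h
  exact hv (by simpa using stereoInv_injective h)

theorem sph_cases (m : Euc d) (x : Sph d) :
    x = northPole d ∨ x = stereoInv m ∨ ∃ v, v ≠ 0 ∧ x = stereoInv (m + v) := by
  by_cases h : x = northPole d
  · exact Or.inl h
  · obtain ⟨y, rfl⟩ := exists_stereoInv_eq h
    by_cases hy : y = m
    · exact Or.inr (Or.inl (by rw [hy]))
    · exact Or.inr (Or.inr ⟨y - m, sub_ne_zero.2 hy, by rw [add_sub_cancel]⟩)

theorem IsGauge.sphInv_involutive (hg : IsGauge g) : Function.Involutive (sphInv g m) := by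
  intro x
  rcases sph_cases m x with rfl | rfl | ⟨v, hv, rfl⟩
  · rw [sphInv_northPole, sphInv_center]
  · rw [sphInv_center, sphInv_northPole]
  · rw [sphInv_stereoInv hv, sphInv_stereoInv (hg.gaugeInv_ne_zero hv), hg.gaugeInv_gaugeInv hv]

theorem IsGauge.continuous_sphInv (hg : IsGauge g) : Continuous (sphInv g m) := by
  have hsub : ∀ y : Euc d, y ≠ m →
      sphInv g m (stereoInv y) = stereoInv (m + gaugeInv g (y - m)) := fun y hy => by
    rw [← sphInv_stereoInv (sub_ne_zero.2 hy), add_sub_cancel]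
  have hcs : Continuous (stereoInv : Euc d → Sph d) := stereoInv_isOpenEmbedding.continuous
  rw [continuous_iff_continuousAt]
  intro x
  rcases sph_cases m x with rfl | rfl | ⟨v, hv, rfl⟩
  · rw [continuousAt_iff_punctured_nhds, sphInv_northPole]
    refine Tendsto.mono_left ?_ nhdsNE_northPole_le
    rw [tendsto_map'_iff]
    have h1 : Tendsto (fun y : Euc d => y - m) (cobounded _) (cobounded _) := by
      simp [sub_eq_add_neg]
    have h2 := (hg.tendsto_gaugeInv_cobounded.comp h1).const_add m
    rw [add_zero] at h2
    refine ((hcs.tendsto m).comp h2).congr' ?_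
    filter_upwards [isBounded_def.1 (isBounded_singleton (x := m))] with y hy
    exact (hsub y hy).symm
  · rw [← stereoInv_isOpenEmbedding.continuousAt_iff, continuousAt_iff_punctured_nhds]
    simp only [Function.comp, sphInv_center]
    have h1 : Tendsto (fun y : Euc d => y - m) (𝓝[≠] m) (𝓝[≠] 0) := by
      refine tendsto_nhdsWithin_iff.2 ⟨?_, ?_⟩
      · have : Continuous fun y : Euc d => y - m := by fun_prop
        have := this.tendsto m
        rw [sub_self] at this
        exact this.mono_left nhdsWithin_le_nhds
      · filter_upwards [self_mem_nhdsWithin] with y hy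
        exact sub_ne_zero.2 hy
    have h2 : Tendsto (fun y : Euc d => m + y) (cobounded _) (cobounded _) :=
      tendsto_const_add_cobounded m
    refine (tendsto_stereoInv_cobounded.comp (h2.comp (hg.tendsto_gaugeInv_zero.comp h1))).congr' ?_
    filter_upwards [self_mem_nhdsWithin] with y hy
    exact (hsub y hy).symm
  · rw [← stereoInv_isOpenEmbedding.continuousAt_iff]
    have hne : ∀ᶠ y in 𝓝 (m + v), y ≠ m := by
      refine isOpen_ne.mem_nhds ?_
      simpa using hv
    refine ContinuousAt.congr (f := fun y => stereoInv (m + gaugeInv g (y - m))) ?_ ?_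
    · refine hcs.continuousAt.comp (continuousAt_const.add ?_)
      unfold gaugeInv
      have h1 : ContinuousAt (fun y : Euc d => y - m) (m + v) := by fun_prop
      refine ContinuousAt.smul (ContinuousAt.inv₀ ((hg.continuous.continuousAt.comp h1).pow 2) ?_) h1
      have := hg.pos v hv
      change g (m + v - m) ^ 2 ≠ 0
      rw [add_sub_cancel_left]
      positivity
    · filter_upwards [hne] with y hy
      exact (hsub y hy).symm

/-- The image in the sphere of the body `{g (y - m) ≤ 1}`. -/
def sphBody (g : Euc d → ℝ) (m : Euc d) : Set (Sph d) := (fun v => stereoInv (m + v)) '' {v | g v ≤ 1}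

/-- This and the next two lemmas are what `IsFold.double` asks of a reflection: the body and its
mirror image cover the sphere, and they meet only in the boundary, which is fixed pointwise. -/
theorem IsGauge.mem_sphBody_or (hg : IsGauge g) (x : Sph d) :
    x ∈ sphBody g m ∨ sphInv g m x ∈ sphBody g m := by
  rcases sph_cases m x with rfl | rfl | ⟨v, hv, rfl⟩
  · rw [sphInv_northPole]
    exact Or.inr ⟨0, by simp [hg.zero], by simp⟩
  · exact Or.inl ⟨0, by simp [hg.zero], by simp⟩
  · rcases le_total (g v) 1 with h | h
    · exact Or.inl ⟨v, h, rfl⟩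
    · refine Or.inr ⟨gaugeInv g v, ?_, (sphInv_stereoInv hv).symm⟩
      rw [mem_ofPred_eq, hg.gauge_gaugeInv]
      exact inv_le_one_of_one_le₀ h

theorem IsGauge.mem_boundary_of_mem_sphBody (hg : IsGauge g) {x : Sph d} (hx : x ∈ sphBody g m)
    (hx' : sphInv g m x ∈ sphBody g m) : ∃ v, g v = 1 ∧ stereoInv (m + v) = x := by
  obtain ⟨v, hv, rfl⟩ := hx
  obtain ⟨w, hw, hwv⟩ := hx'
  have hv0 : v ≠ 0 := by
    rintro rfl
    simp only [add_zero, sphInv_center] at hwv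
    exact stereoInv_ne_northPole _ hwv
  simp only [sphInv_stereoInv hv0] at hwv
  have h1 : w = gaugeInv g v := by simpa using stereoInv_injective hwv
  rw [mem_ofPred_eq, h1, hg.gauge_gaugeInv, inv_le_one₀ (hg.pos v hv0)] at hw
  exact ⟨v, le_antisymm hv hw, rfl⟩

theorem IsGauge.sphInv_of_boundary (hg : IsGauge g) {v : Euc d} (hv : g v = 1) :
    sphInv g m (stereoInv (m + v)) = stereoInv (m + v) := by
  have hv0 : v ≠ 0 := hg.ne_zero (by rw [hv]; exact one_ne_zero)
  rw [sphInv_stereoInv hv0, gaugeInv, hv]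
  simp

theorem IsGauge.isCompact_le_one (hg : IsGauge g) : IsCompact {v | g v ≤ 1} := by
  obtain ⟨c, hc, C, hC, h⟩ := hg.exists_bounds
  refine (isCompact_closedBall (0 : Euc d) c⁻¹).of_isClosed_subset
    (isClosed_le hg.continuous continuous_const) fun v hv => ?_
  rw [mem_closedBall_zero_iff, ← mul_le_mul_iff_right₀ hc, mul_inv_cancel₀ hc.ne']
  exact (h v).1.trans hv

theorem IsGauge.isClosed_sphBody (hg : IsGauge g) : IsClosed (sphBody g m) := by
  have : Continuous fun v : Euc d => stereoInv (m + v) :=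
    stereoInv_isOpenEmbedding.continuous.comp (by fun_prop)
  exact (hg.isCompact_le_one.image this).isClosed

end Inversion

/-! ### Coordinates -/

theorem IsGauge.comp {E E' : Type*} [AddCommGroup E] [Module ℝ E] [TopologicalSpace E]
    [AddCommGroup E'] [Module ℝ E'] [TopologicalSpace E'] {g : E → ℝ} (hg : IsGauge g)
    {e : E' → E} (he : Continuous e) (hs : ∀ (t : ℝ) v, e (t • v) = t • e v)
    (h0 : ∀ v, e v = 0 → v = 0) : IsGauge (g ∘ e) where
  continuous := hg.continuous.comp he
  smul t ht v := by rw [Function.comp, hs, hg.smul t ht, Function.comp]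
  pos v hv := hg.pos _ fun h => hv (h0 v h)

/-- The point of the plane with given coordinates. -/
def toPlane (p : ℝ × ℝ) : Euc 2 := !₂[p.1, p.2]

/-- The coordinates of a point of the plane. -/
def ofPlane (v : Euc 2) : ℝ × ℝ := (v 0, v 1)

theorem ofPlane_toPlane (p : ℝ × ℝ) : ofPlane (toPlane p) = p := rfl

theorem toPlane_ofPlane (v : Euc 2) : toPlane (ofPlane v) = v := by
  ext i; fin_cases i <;> rfl

theorem continuous_toPlane : Continuous toPlane := by
  refine (PiLp.continuous_toLp 2 _).comp (continuous_pi fun i => ?_)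
  fin_cases i
  exacts [continuous_fst, continuous_snd]

theorem continuous_ofPlane : Continuous ofPlane := by unfold ofPlane; fun_prop

theorem norm_toPlane (p : ℝ × ℝ) : ‖toPlane p‖ = planeNorm p := by
  rw [EuclideanSpace.norm_eq, Fin.sum_univ_two, Real.norm_eq_abs, Real.norm_eq_abs, sq_abs, sq_abs]
  rfl

theorem planeNorm_ofPlane (v : Euc 2) : planeNorm (ofPlane v) = ‖v‖ := by
  rw [← norm_toPlane, toPlane_ofPlane]

/-- The point of space with coordinates `(x, v, -u)`, where `w = u + iv`. -/
def toSpace (v : ℝ × ℂ) : Euc 3 := !₂[v.1, v.2.im, -v.2.re]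

/-- The inverse of `toSpace`. -/
def ofSpace (u : Euc 3) : ℝ × ℂ := (u 0, (-(u 2) : ℝ) + (u 1 : ℂ) * Complex.I)

/-- The point of space with coordinates `(u, v, x)`, where `w = u + iv`. -/
def toSpace' (v : ℝ × ℂ) : Euc 3 := !₂[v.2.re, v.2.im, v.1]

theorem ofSpace_toSpace (v : ℝ × ℂ) : ofSpace (toSpace v) = v := by
  refine Prod.ext rfl (Complex.ext ?_ ?_) <;> simp [ofSpace, toSpace]

theorem toSpace_ofSpace (u : Euc 3) : toSpace (ofSpace u) = u := by
  ext i; fin_cases i <;> simp [ofSpace, toSpace]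

theorem continuous_toSpace : Continuous toSpace := by
  refine (PiLp.continuous_toLp 2 _).comp (continuous_pi fun i => ?_)
  fin_cases i
  exacts [continuous_fst, Complex.continuous_im.comp continuous_snd,
    (Complex.continuous_re.comp continuous_snd).neg]

theorem continuous_ofSpace : Continuous ofSpace := by unfold ofSpace; fun_prop

theorem norm_toSpace (v : ℝ × ℂ) : ‖toSpace v‖ = spaceNorm v := by
  rw [EuclideanSpace.norm_eq, spaceNorm_eq, Fin.sum_univ_three]
  congr 1
  simp only [Real.norm_eq_abs, sq_abs, toSpace]
  simp
  ring

theorem norm_toSpace' (v : ℝ × ℂ) : ‖toSpace' v‖ = spaceNorm v := by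
  rw [EuclideanSpace.norm_eq, spaceNorm_eq, Fin.sum_univ_three]
  congr 1
  simp only [Real.norm_eq_abs, sq_abs, toSpace']
  simp
  ring

/-- In `S³` the balls are lined up along the first axis, so `toSpace` puts the length of the
cylinder first. In `S² × S¹` the length is the circle direction, which comes last. The quarter turn
reconciles the two conventions on the unit sphere; the sign in `toSpace` makes it a rotation, which
can be phased out radially. -/
theorem toSpace_twist {v : ℝ × ℂ} (h : spaceNorm v = 1) : toSpace (twist v) = toSpace' v := by
  rw [twist_of_spaceNorm_eq_one h]
  ext i
  fin_cases i <;> simp [toSpace, toSpace']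

theorem surjective_toSpace' (u : Euc 3) : ∃ v, toSpace' v = u := by
  refine ⟨(u 2, ⟨u 0, u 1⟩), ?_⟩
  ext i; fin_cases i <;> rfl

/-- The stereographic chart of the sphere centred at `(c, 0)`. -/
def planeChart (c : ℝ) (p : ℝ × ℝ) : Sph 2 := stereoInv (EuclideanSpace.single 0 c + toPlane p)

/-- The stereographic chart of the `3`-sphere centred at `(c, 0, 0)`. -/
def spaceChart (c : ℝ) (v : ℝ × ℂ) : Sph 3 := stereoInv (EuclideanSpace.single 0 c + toSpace v)

theorem continuous_planeChart (c : ℝ) : Continuous (planeChart c) :=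
  stereoInv_isOpenEmbedding.continuous.comp (continuous_const.add continuous_toPlane)

theorem continuous_spaceChart (c : ℝ) : Continuous (spaceChart c) :=
  stereoInv_isOpenEmbedding.continuous.comp (continuous_const.add continuous_toSpace)

theorem planeChart_injective (c : ℝ) : Function.Injective (planeChart c) := fun p q h => by
  have h1 := add_left_cancel (stereoInv_injective h)
  rw [← ofPlane_toPlane p, h1, ofPlane_toPlane]

theorem spaceChart_injective (c : ℝ) : Function.Injective (spaceChart c) := fun p q h => by
  have h1 := add_left_cancel (stereoInv_injective h)
  rw [← ofSpace_toSpace p, h1, ofSpace_toSpace]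

theorem planeChart_shift (c c' : ℝ) (p : ℝ × ℝ) :
    planeChart c p = planeChart c' (c - c' + p.1, p.2) := by
  unfold planeChart
  congr 1
  ext i
  fin_cases i
  · simp [toPlane]; ring
  · simp [toPlane]

theorem spaceChart_shift (c c' : ℝ) (v : ℝ × ℂ) :
    spaceChart c v = spaceChart c' (c - c' + v.1, v.2) := by
  unfold spaceChart
  congr 1
  ext i
  fin_cases i
  · simp [toSpace]; ring
  · simp [toSpace]
  · simp [toSpace]

theorem isOpenMap_planeChart (c : ℝ) : IsOpenMap (planeChart c) := by
  let e : ℝ × ℝ ≃ₜ Euc 2 :=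
    { toFun := toPlane
      invFun := ofPlane
      left_inv := ofPlane_toPlane
      right_inv := toPlane_ofPlane
      continuous_toFun := continuous_toPlane
      continuous_invFun := continuous_ofPlane }
  exact stereoInv_isOpenEmbedding.isOpenMap.comp
    ((Homeomorph.addLeft (EuclideanSpace.single 0 c)).isOpenMap.comp e.isOpenMap)

theorem sphBall_two_toFun (k : ℕ) (v : Euc 2) :
    (sphBall 2 k).toFun v = planeChart (3 * k) (ofPlane v) := by
  rw [planeChart, toPlane_ofPlane]
  rfl

theorem sphBall_three_toFun (k : ℕ) (v : ℝ × ℂ) :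
    (sphBall 3 k).toFun (toSpace v) = spaceChart (3 * k) v := rfl

theorem sphBall_two_interior (k : ℕ) :
    (sphBall 2 k).interior = planeChart (3 * k) '' {p | planeNorm p < 1} := by
  ext x
  constructor
  · rintro ⟨v, hv, rfl⟩
    refine ⟨ofPlane v, ?_, (sphBall_two_toFun k v).symm⟩
    rw [mem_ofPred_eq, planeNorm_ofPlane]
    exact mem_ball_zero_iff.1 hv
  · rintro ⟨p, hp, rfl⟩
    refine ⟨toPlane p, ?_, rfl⟩
    rw [mem_ball_zero_iff, norm_toPlane]
    exact hp

theorem sphBall_three_interior (k : ℕ) :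
    (sphBall 3 k).interior = spaceChart (3 * k) '' {v | spaceNorm v < 1} := by
  ext x
  constructor
  · rintro ⟨v, hv, rfl⟩
    refine ⟨ofSpace v, ?_, ?_⟩
    · rw [mem_ofPred_eq, ← norm_toSpace, toSpace_ofSpace]
      exact mem_ball_zero_iff.1 hv
    · rw [← sphBall_three_toFun, toSpace_ofSpace]
  · rintro ⟨v, hv, rfl⟩
    refine ⟨toSpace v, ?_, rfl⟩
    rw [mem_ball_zero_iff, norm_toSpace]
    exact hv

/-- The reflection of the sphere in the plane of the first and the last coordinate. -/
def sphRefl (x : Sph 2) : Sph 2 := ⟨!₂[x.1 0, -x.1 1, x.1 2], by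
  have h := mem_sphere_zero_iff_norm.1 x.2
  rw [EuclideanSpace.norm_eq, Fin.sum_univ_three] at h
  rw [mem_sphere_zero_iff_norm, EuclideanSpace.norm_eq, Fin.sum_univ_three]
  refine Eq.trans ?_ h
  simp⟩

theorem sphRefl_involutive : Function.Involutive sphRefl := fun x => by
  apply Subtype.ext
  ext i
  fin_cases i <;> simp [sphRefl]

theorem continuous_sphRefl : Continuous sphRefl := by
  refine Continuous.subtype_mk ((PiLp.continuous_toLp 2 _).comp (continuous_pi fun i => ?_)) _
  fin_cases i
  exacts [by fun_prop, by fun_prop, by fun_prop]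

theorem norm_planeRefl (c : ℝ) (p : ℝ × ℝ) :
    ‖EuclideanSpace.single 0 c + toPlane (planeRefl p)‖ =
      ‖EuclideanSpace.single 0 c + toPlane p‖ := by
  rw [EuclideanSpace.norm_eq, EuclideanSpace.norm_eq, Fin.sum_univ_two, Fin.sum_univ_two]
  simp [toPlane, planeRefl]

theorem sphRefl_planeChart (c : ℝ) (p : ℝ × ℝ) :
    sphRefl (planeChart c p) = planeChart c (planeRefl p) := by
  apply Subtype.ext
  have h := norm_planeRefl c p
  have hs : ∀ (y : Euc 2) (i : Fin 2), stereoInvVec y i.castSucc = 2 * y i / (‖y‖ ^ 2 + 1) :=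
    stereoInvVec_castSucc
  have hl : ∀ y : Euc 2, stereoInvVec y (Fin.last 2) = (‖y‖ ^ 2 - 1) / (‖y‖ ^ 2 + 1) :=
    stereoInvVec_last
  ext i
  fin_cases i
  · refine (hs _ 0).trans (Eq.trans ?_ (hs _ 0).symm)
    rw [h]
    simp [toPlane, planeRefl]
  · refine (congrArg Neg.neg (hs _ 1)).trans (Eq.trans ?_ (hs _ 1).symm)
    rw [h]
    simp [toPlane, planeRefl, neg_div]
  · refine (hl _).trans (Eq.trans ?_ (hl _).symm)
    rw [h]

theorem sphRefl_northPole : sphRefl (northPole 2) = northPole 2 := by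
  rw [eq_northPole_iff]
  change (northPole 2).1 (Fin.last 2) = 1
  exact eq_northPole_iff.1 rfl

/-! ### The fold of the sphere -/

/-- The gauge of the rectangle on the Euclidean plane. -/
def planeGauge (a : ℝ) : Euc 2 → ℝ := rectGauge a ∘ ofPlane

/-- The gauge of the cylinder on Euclidean space. -/
def spaceGauge (a : ℝ) : Euc 3 → ℝ := cylGauge a ∘ ofSpace

theorem isGauge_planeGauge {a : ℝ} (ha : 0 < a) : IsGauge (planeGauge a) := by
  refine (isGauge_rectGauge ha).comp continuous_ofPlane (fun t v => ?_) fun v hv => ?_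
  · simp [ofPlane]
  · rw [← toPlane_ofPlane v, hv]
    ext i; fin_cases i <;> rfl

theorem isGauge_spaceGauge {a : ℝ} (ha : 0 < a) : IsGauge (spaceGauge a) := by
  refine (isGauge_cylGauge ha).comp continuous_ofSpace (fun t v => ?_) fun v hv => ?_
  · refine Prod.ext ?_ (Complex.ext ?_ ?_) <;> simp [ofSpace]
  · rw [← toSpace_ofSpace v, hv]
    ext i; fin_cases i <;> simp [toSpace]

theorem planeChart_image (a c : ℝ) : planeChart c '' {p | rectGauge a p ≤ 1} =
    sphBody (planeGauge a) (EuclideanSpace.single 0 c) := by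
  ext x
  constructor
  · rintro ⟨p, hp, rfl⟩
    exact ⟨toPlane p, hp, rfl⟩
  · rintro ⟨v, hv, rfl⟩
    refine ⟨ofPlane v, hv, ?_⟩
    rw [planeChart, toPlane_ofPlane]

theorem spaceChart_image (a c : ℝ) : spaceChart c '' {v | cylGauge a v ≤ 1} =
    sphBody (spaceGauge a) (EuclideanSpace.single 0 c) := by
  ext x
  constructor
  · rintro ⟨v, hv, rfl⟩
    refine ⟨toSpace v, ?_, rfl⟩
    rw [mem_ofPred_eq, spaceGauge, Function.comp, ofSpace_toSpace]
    exact hv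
  · rintro ⟨v, hv, rfl⟩
    refine ⟨ofSpace v, hv, ?_⟩
    rw [spaceChart, toSpace_ofSpace]

theorem isCompact_rectGauge_le_one {a : ℝ} (ha : 0 < a) : IsCompact {p | rectGauge a p ≤ 1} := by
  rw [setOf_rectGauge_le_one ha]
  exact isCompact_Icc.prod isCompact_Icc

/-- The gauge is invariant under the reflection and the centre lies on its axis. -/
theorem sphRefl_sphInv {a : ℝ} (ha : 0 < a) (c : ℝ) (x : Sph 2) :
    sphInv (planeGauge a) (EuclideanSpace.single 0 c) (sphRefl x) =
      sphRefl (sphInv (planeGauge a) (EuclideanSpace.single 0 c) x) := by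
  have hg := isGauge_planeGauge ha
  have h0 : stereoInv (EuclideanSpace.single 0 c) = planeChart c 0 := by
    unfold planeChart
    congr 1
    ext i; fin_cases i <;> simp [toPlane]
  have h1 : sphRefl (stereoInv (EuclideanSpace.single 0 c)) =
      stereoInv (EuclideanSpace.single 0 c) := by
    rw [h0, sphRefl_planeChart]
    exact congrArg _ (Prod.ext rfl neg_zero)
  rcases sph_cases (EuclideanSpace.single 0 c) x with rfl | rfl | ⟨v, hv, rfl⟩
  · rw [sphRefl_northPole, sphInv_northPole, h1]
  · rw [h1, sphInv_center, sphRefl_northPole]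
  · have h2 : ∀ v : Euc 2, stereoInv (EuclideanSpace.single 0 c + v) = planeChart c (ofPlane v) :=
      fun v => by rw [planeChart, toPlane_ofPlane]
    have h3 : toPlane (planeRefl (ofPlane v)) ≠ 0 := by
      intro h
      refine hv ?_
      have h4 := congrArg (fun v => toPlane (planeRefl (ofPlane v))) h
      simp only [ofPlane_toPlane] at h4
      rw [show planeRefl (planeRefl (ofPlane v)) = ofPlane v by simp [planeRefl],
        toPlane_ofPlane] at h4
      rw [h4]
      ext i; fin_cases i <;> simp [toPlane, planeRefl, ofPlane]
    have h5 : planeGauge a (toPlane (planeRefl (ofPlane v))) = planeGauge a v := by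
      simp only [planeGauge, Function.comp, ofPlane_toPlane, rectGauge_planeRefl]
    have h6 : sphRefl (stereoInv (EuclideanSpace.single 0 c + v)) =
        stereoInv (EuclideanSpace.single 0 c + toPlane (planeRefl (ofPlane v))) := by
      rw [h2 v, sphRefl_planeChart, planeChart]
    rw [h6, sphInv_stereoInv h3, sphInv_stereoInv hv, h2, h2, sphRefl_planeChart]
    congr 1
    simp only [gaugeInv, h5]
    simp [ofPlane, planeRefl, toPlane]

/-- The inversions exhibit `S²` as the double of the rectangle and `S³` as the double of the
cylinder. The box fold carries boundary to boundary, so it doubles. -/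
theorem exists_fold_sphere {a : ℝ} (ha : 0 < a) (c : ℝ) : ∃ G : Sph 2 × Circle → Sph 3,
    IsFold sphRefl G univ univ ∧
      ∀ p, rectGauge a p ≤ 1 → ∀ z, G (planeChart c p, z) = spaceChart c (boxFold (p, z)) := by
  have hg := isGauge_planeGauge ha
  have hg' := isGauge_spaceGauge ha
  have hinj : InjOn (planeChart c) {p | rectGauge a p ≤ 1} := (planeChart_injective c).injOn
  have h1 := ((isFold_boxFold_rect ha).comp_left (continuous_spaceChart c).continuousOn
    (spaceChart_injective c).injOn).image (isCompact_rectGauge_le_one ha)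
    (continuous_planeChart c).continuousOn hinj (σ' := sphRefl)
    fun p _ => sphRefl_planeChart c p
  have hval : ∀ p, rectGauge a p ≤ 1 → ∀ z, (spaceChart c ∘ boxFold)
      (Function.invFunOn (planeChart c) {p | rectGauge a p ≤ 1} (planeChart c p), z) =
        spaceChart c (boxFold (p, z)) := fun p hp z => by
    rw [hinj.leftInvOn_invFunOn hp]
    rfl
  rw [planeChart_image, spaceChart_image] at h1
  have hbd : ∀ x ∈ sphBody (planeGauge a) (EuclideanSpace.single 0 c),
      sphInv (planeGauge a) (EuclideanSpace.single 0 c) x ∈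
        sphBody (planeGauge a) (EuclideanSpace.single 0 c) →
      ∃ p, rectGauge a p = 1 ∧ planeChart c p = x := fun x hx hx' => by
    obtain ⟨v, hv, rfl⟩ := hg.mem_boundary_of_mem_sphBody hx hx'
    exact ⟨ofPlane v, hv, by rw [planeChart, toPlane_ofPlane]⟩
  refine Exists.imp (fun G hG => ⟨hG.1, fun p hp z => ?_⟩)
    (h1.double sphRefl_involutive hg.isClosed_sphBody
    (r := sphInv (planeGauge a) (EuclideanSpace.single 0 c))
    (s := sphInv (spaceGauge a) (EuclideanSpace.single 0 c)) hg.continuous_sphInv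
    hg.sphInv_involutive hg'.continuous_sphInv hg'.sphInv_involutive (sphRefl_sphInv ha c)
    hg.mem_sphBody_or hg'.mem_sphBody_or ?_ ?_)
  · rw [hG.2 _ (planeChart_image a c ▸ mem_image_of_mem _ hp), hval p hp]
  · intro x hx hx'
    obtain ⟨p, hp, rfl⟩ := hbd x hx hx'
    constructor
    · exact hg.sphInv_of_boundary (v := toPlane p) hp
    · intro z
      have h2 : spaceGauge a (toSpace (boxFold (p, z))) = 1 := by
        rw [spaceGauge, Function.comp, ofSpace_toSpace]
        exact (isFold_boxFold_boundary ha).mem (A := {p | rectGauge a p = 1}) hp z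
      simp only [hval p hp.le]
      exact hg'.sphInv_of_boundary h2
  · intro y hy hy'
    obtain ⟨v, hv, rfl⟩ := hg'.mem_boundary_of_mem_sphBody hy hy'
    obtain ⟨p, hp, z, hpz⟩ := (isFold_boxFold_boundary ha).exists_eq
      (show ofSpace v ∈ {v | cylGauge a v = 1} from hv)
    rw [mem_ofPred_eq] at hp
    refine ⟨planeChart c p, planeChart_image a c ▸ mem_image_of_mem _ hp.le, ?_, z, ?_⟩
    · have := hg.sphInv_of_boundary (m := EuclideanSpace.single 0 c) (v := toPlane p) hp
      change sphInv _ _ (stereoInv (_ + toPlane p)) ∈ _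
      rw [this]
      exact ⟨toPlane p, hp.le, rfl⟩
    · simp only [hval p hp.le]
      rw [spaceChart, hpz, toSpace_ofSpace]

/-! ### The fold of the torus -/

/-- The stereographic chart of the sphere, on the complex plane. -/
def complexChart (w : ℂ) : Sph 2 := stereoInv !₂[w.re, w.im]

theorem continuous_complexChart : Continuous complexChart := by
  refine stereoInv_isOpenEmbedding.continuous.comp
    (continuous_toPlane.comp (f := fun w : ℂ => (w.re, w.im)) ?_)
  exact Complex.continuous_re.prodMk Complex.continuous_im

theorem complexChart_injective : Function.Injective complexChart := fun w w' h => by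
  have h1 := stereoInv_injective h
  exact Complex.ext (congrArg (fun v : Euc 2 => v 0) h1) (congrArg (fun v : Euc 2 => v 1) h1)

theorem norm_re_im (w : ℂ) : ‖(!₂[w.re, w.im] : Euc 2)‖ = ‖w‖ := by
  rw [EuclideanSpace.norm_eq, Fin.sum_univ_two, Complex.norm_def, Complex.normSq_apply]
  congr 1
  simp
  ring

/-- The gauge of the disc of radius `2`. -/
def discGauge (v : Euc 2) : ℝ := ‖v‖ / 2

theorem isGauge_discGauge : IsGauge discGauge where
  continuous := by unfold discGauge; fun_prop
  smul t ht v := by rw [discGauge, norm_smul, Real.norm_of_nonneg ht, mul_div_assoc, discGauge]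
  pos v hv := by
    have := norm_pos_iff.2 hv
    unfold discGauge
    positivity

theorem complexChart_image : complexChart '' closedBall 0 2 = sphBody discGauge 0 := by
  ext x
  constructor
  · rintro ⟨w, hw, rfl⟩
    refine ⟨!₂[w.re, w.im], ?_, by simp [complexChart]⟩
    rw [mem_ofPred_eq, discGauge, norm_re_im, div_le_one two_pos]
    exact mem_closedBall_zero_iff.1 hw
  · rintro ⟨v, hv, rfl⟩
    have h1 : (!₂[v 0, v 1] : Euc 2) = v := toPlane_ofPlane v
    refine ⟨⟨v 0, v 1⟩, ?_, ?_⟩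
    · rw [mem_closedBall_zero_iff, ← norm_re_im, h1]
      rwa [mem_ofPred_eq, discGauge, div_le_one two_pos] at hv
    · simp only [complexChart, h1, zero_add]

/-- This is the pillowcase map. The circle is doubled by `b ↦ -b⁻¹`, which exchanges the halves `Re
b ≥ 0` and `Re b ≤ 0` and fixes `±i`; the sphere is doubled by the inversion in the circle of radius
`2`. -/
theorem exists_fold_circle : ∃ T : Circle × Circle → Sph 2,
    IsFold (fun b : Circle => b⁻¹) T univ univ ∧
      ∀ b z : Circle, 0 ≤ (b : ℂ).re → T (b, z) = complexChart (annulusFold (b, z)) := by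
  have hg := isGauge_discGauge
  have h1 := isFold_annulusFold.comp_left continuous_complexChart.continuousOn
    complexChart_injective.injOn
  rw [complexChart_image] at h1
  have hre : Continuous fun b : Circle => (b : ℂ).re := Complex.continuous_re.comp (by fun_prop)
  have hneg : ∀ b : Circle, ((-b⁻¹ : Circle) : ℂ).re = -(b : ℂ).re := fun b => by
    rw [Circle.coe_neg, Complex.neg_re, Circle.re_inv]
  have hfix : ∀ b : Circle, (b : ℂ).re = 0 → -b⁻¹ = b := fun b hb => by
    refine Circle.ext_re_im ?_ ?_
    · rw [hneg, hb, neg_zero]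
    · rw [Circle.coe_neg, Complex.neg_im, Circle.im_inv, neg_neg]
  refine Exists.imp (fun T hT => ⟨hT.1, fun b z hb => hT.2 b hb z⟩)
    (h1.double (fun b => inv_inv b) (isClosed_le continuous_const hre)
    (r := fun b => -b⁻¹) (s := sphInv discGauge 0) (by fun_prop)
    (fun b => by simp) hg.continuous_sphInv hg.sphInv_involutive
    (fun b => by simp) ?_ hg.mem_sphBody_or ?_ ?_)
  · intro b
    rw [mem_ofPred_eq, mem_ofPred_eq, hneg]
    rcases le_total 0 (b : ℂ).re with h | h
    exacts [Or.inl h, Or.inr (by linarith)]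
  · intro b hb hb'
    rw [mem_ofPred_eq] at hb
    rw [mem_ofPred_eq, hneg] at hb'
    have h0 : (b : ℂ).re = 0 := by linarith
    refine ⟨hfix b h0, fun z => ?_⟩
    have h2 := (norm_annulusFold_eq_two_iff hb z).2 h0
    have h3 := hg.sphInv_of_boundary (m := 0)
      (v := !₂[(annulusFold (b, z)).re, (annulusFold (b, z)).im])
      (by rw [discGauge, norm_re_im, h2]; norm_num)
    rw [zero_add] at h3
    exact h3
  · intro y hy hy'
    obtain ⟨v, hv, rfl⟩ := hg.mem_boundary_of_mem_sphBody hy hy'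
    have h1 : (!₂[v 0, v 1] : Euc 2) = v := toPlane_ofPlane v
    have hn : ‖(⟨v 0, v 1⟩ : ℂ)‖ = 2 := by
      rw [← norm_re_im, h1]
      rwa [discGauge, div_eq_one_iff_eq two_ne_zero] at hv
    obtain ⟨b, hb, z, hbz⟩ := isFold_annulusFold.exists_eq (mem_closedBall_zero_iff.2 hn.le)
    have h0 : (b : ℂ).re = 0 := (norm_annulusFold_eq_two_iff hb z).1 (hbz ▸ hn)
    refine ⟨b, hb, ?_, z, ?_⟩
    · rw [mem_ofPred_eq, hneg, h0, neg_zero]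
    · simp only [Function.comp, hbz, complexChart, h1, zero_add]

/-- The reflection of the torus in the second factor. -/
def torusRefl (p : Circle × Circle) : Circle × Circle := (p.1, p.2⁻¹)

/-- The angular chart of the torus. -/
def torusChart (p : ℝ × ℝ) : Circle × Circle := (Circle.exp p.1, Circle.exp p.2)

/-- The standard chart of `S² × S¹`. -/
def solidChart (v : ℝ × ℂ) : Sph 2 × Circle := (complexChart v.2, Circle.exp v.1)

/-- The first circle of the torus is not reflected and becomes the circle of `S² × S¹`. The second
one, together with the extra circle, forms a pillowcase. -/
theorem exists_fold_torus : ∃ G : (Circle × Circle) × Circle → Sph 2 × Circle,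
    IsFold torusRefl G univ univ ∧
      ∀ p : ℝ × ℝ, |p.2| ≤ Real.pi / 2 → ∀ z, G (torusChart p, z) = solidChart (boxFold (p, z)) := by
  obtain ⟨T, hT, hT'⟩ := exists_fold_circle
  have h1 := (hT.prod (univ : Set Circle)).comp_left (g := Prod.swap)
    continuous_swap.continuousOn Prod.swap_injective.injOn
  rw [univ_prod_univ, univ_prod_univ, image_univ, Prod.swap_surjective.range_eq] at h1
  refine ⟨_, h1, fun p hp z => ?_⟩
  have h2 : 0 ≤ (Circle.exp p.2 : ℂ).re := by
    rw [Circle.re_exp]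
    exact Real.cos_nonneg_of_mem_Icc (abs_le.1 hp)
  simp only [Function.comp, torusChart, hT' _ _ h2]
  rfl

/-! ### Puncturing a fold -/

/-- The box fold need not take the unit circle times `S¹` to the unit sphere. Between the disc and
the rectangle it is replaced by the shell fold, which does so and agrees with it on the boundary of
the rectangle. The map `D`, which is trivial on the boundary of the cylinder, allows an adjustment
of the identification along the unit sphere. -/
theorem IsFold.puncture {X Y : Type*} [TopologicalSpace X] [TopologicalSpace Y] [T2Space X]
    {σ : X → X} {F : X × Circle → Y} {A : Set X} {B : Set Y} (hσ : Function.Involutive σ)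
    (hF : IsFold σ F A B) (hA : IsClosed A) {φ : ℝ × ℝ → X} {ψ D : ℝ × ℂ → _}
    (hφ : ContinuousOn φ {p | rectGauge (3 / 2) p ≤ 1})
    (hφi : InjOn φ {p | rectGauge (3 / 2) p ≤ 1})
    (hφA : ∀ p, rectGauge (3 / 2) p ≤ 1 → φ p ∈ A)
    (hφo : IsOpen (φ '' {p | rectGauge (3 / 2) p < 1}))
    (hφσ : ∀ p, rectGauge (3 / 2) p ≤ 1 → σ (φ p) = φ (planeRefl p))
    (hψ : ContinuousOn ψ {v | cylGauge (3 / 2) v ≤ 1})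
    (hψi : InjOn ψ {v | cylGauge (3 / 2) v ≤ 1})
    (hFφ : ∀ p, rectGauge (3 / 2) p ≤ 1 → ∀ z, F (φ p, z) = ψ (boxFold (p, z)))
    (hD : Continuous D) (hDi : Function.Injective D)
    (hDR : D '' {v | cylGauge (3 / 2) v ≤ 1 ∧ 1 ≤ spaceNorm v} =
      {v | cylGauge (3 / 2) v ≤ 1 ∧ 1 ≤ spaceNorm v})
    (hDb : ∀ v, cylGauge (3 / 2) v = 1 → D v = v) :
    ∃ G : X × Circle → Y,
      IsFold σ G (A \ φ '' {p | planeNorm p < 1}) (B \ ψ '' {v | spaceNorm v < 1}) ∧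
      (∀ p ∈ A, p ∉ φ '' {p | rectGauge (3 / 2) p < 1} → ∀ z, G (p, z) = F (p, z)) ∧
      ∀ p, planeNorm p = 1 → ∀ z, G (φ p, z) = ψ (D (shell (p, z))) := by
  classical
  have ha : (0 : ℝ) < 3 / 2 := by norm_num
  have hbox := isFold_boxFold_rect ha
  set K : Set (ℝ × ℝ) := {p | rectGauge (3 / 2) p ≤ 1 ∧ 1 ≤ planeNorm p} with hK
  set R : Set (ℝ × ℂ) := {v | cylGauge (3 / 2) v ≤ 1 ∧ 1 ≤ spaceNorm v} with hR
  have hKV : K ⊆ {p | rectGauge (3 / 2) p ≤ 1} := fun p hp => hp.1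
  have hKc : IsCompact K := (isCompact_rectGauge_le_one ha).inter_right
    (isClosed_le continuous_const isGauge_planeNorm.continuous)
  have h₁' := isFold_shell.comp_left hD.continuousOn hDi.injOn
  rw [hDR] at h₁'
  have h₁ := (h₁'.comp_left (hψ.mono fun v hv => hv.1) (hψi.mono fun v hv => hv.1)).image hKc
    (hφ.mono hKV) (hφi.mono hKV) (σ' := σ) fun p hp => hφσ p hp.1
  have hval : ∀ p ∈ K, ∀ z, (ψ ∘ D ∘ shell) (Function.invFunOn φ K (φ p), z) =
      ψ (D (shell (p, z))) := fun p hp z => by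
    rw [(hφi.mono hKV).leftInvOn_invFunOn hp]
    rfl
  have hKσ : MapsTo σ (A \ φ '' {p | rectGauge (3 / 2) p < 1})
      (A \ φ '' {p | rectGauge (3 / 2) p < 1}) := by
    rintro p ⟨hp, hp'⟩
    refine ⟨hF.mapsTo hp, ?_⟩
    rintro ⟨q, hq, h⟩
    refine hp' ⟨planeRefl q, (rectGauge_planeRefl _ q).trans_lt hq, ?_⟩
    rw [← hφσ q (le_of_lt hq), h, hσ p]
  have h₂ := hF.restrict sdiff_subset hKσ
  -- The box fold respects interiors, so removing the open rectangle upstairs removes exactly the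
  -- open cylinder downstairs.
  have hB₂ : F '' ((A \ φ '' {p | rectGauge (3 / 2) p < 1}) ×ˢ univ) =
      B \ ψ '' {v | cylGauge (3 / 2) v < 1} := by
    ext y
    constructor
    · rintro ⟨⟨p, z⟩, ⟨⟨hp, hp'⟩, -⟩, rfl⟩
      refine ⟨hF.mem hp z, ?_⟩
      rintro ⟨v, hv, h⟩
      rw [mem_ofPred_eq] at hv
      obtain ⟨q, hq, z', rfl⟩ := hbox.exists_eq hv.le
      rw [mem_ofPred_eq] at hq
      have hq' := (cylGauge_boxFold_lt_one_iff ha hq z').1 hv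
      rw [← hFφ q hq, hF.eq_iff _ (hφA q hq) _ hp] at h
      rcases h with ⟨rfl, -⟩ | ⟨rfl, -⟩
      · exact hp' ⟨q, hq', rfl⟩
      · exact hp' ⟨planeRefl q, (rectGauge_planeRefl _ q).trans_lt hq', (hφσ q hq).symm⟩
    · rintro ⟨hy, hy'⟩
      obtain ⟨p, hp, z, rfl⟩ := hF.exists_eq hy
      refine ⟨(p, z), ⟨⟨hp, ?_⟩, mem_univ _⟩, rfl⟩
      rintro ⟨q, hq, rfl⟩
      rw [mem_ofPred_eq] at hq
      have hq0 := hq.le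
      exact hy' ⟨boxFold (q, z), (cylGauge_boxFold_lt_one_iff ha hq0 z).2 hq, (hFφ q hq0 z).symm⟩
  rw [hB₂] at h₂
  have hc₁ : IsClosed (φ '' K) := (hKc.image_of_continuousOn (hφ.mono hKV)).isClosed
  have hb : ∀ v ∈ R, ψ v ∉ ψ '' {v | cylGauge (3 / 2) v < 1} → cylGauge (3 / 2) v = 1 :=
    fun v hv h => le_antisymm hv.1 (not_lt.1 fun h' => h ⟨v, h', rfl⟩)
  have h := h₁.glue hσ h₂ hc₁ (hA.sdiff hφo) ?_ ?_
  · have hdom : φ '' K ∪ A \ φ '' {p | rectGauge (3 / 2) p < 1} =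
        A \ φ '' {p | planeNorm p < 1} := by
      ext x
      constructor
      · rintro (⟨p, hp, rfl⟩ | ⟨hx, hx'⟩)
        · refine ⟨hφA p hp.1, ?_⟩
          rintro ⟨q, hq, h⟩
          rw [mem_ofPred_eq] at hq
          rw [← hφi (rectGauge_le_one_of_planeNorm hq.le).le hp.1 h] at hp
          exact hq.not_ge hp.2
        · refine ⟨hx, fun ⟨q, hq, h⟩ => hx' ⟨q, ?_, h⟩⟩
          exact rectGauge_le_one_of_planeNorm (le_of_lt (show planeNorm q < 1 from hq))
      · rintro ⟨hx, hx'⟩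
        by_cases h : x ∈ φ '' {p | rectGauge (3 / 2) p < 1}
        · obtain ⟨q, hq, rfl⟩ := h
          rw [mem_ofPred_eq] at hq
          exact Or.inl ⟨q, ⟨hq.le, not_lt.1 fun h => hx' ⟨q, h, rfl⟩⟩, rfl⟩
        · exact Or.inr ⟨hx, h⟩
    have htgt : ψ '' R ∪ B \ ψ '' {v | cylGauge (3 / 2) v < 1} =
        B \ ψ '' {v | spaceNorm v < 1} := by
      ext y
      constructor
      · rintro (⟨v, hv, rfl⟩ | ⟨hy, hy'⟩)
        · constructor
          · obtain ⟨q, hq, z, rfl⟩ := hbox.exists_eq hv.1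
            rw [← hFφ q hq]
            exact hF.mem (hφA q hq) z
          · rintro ⟨w, hw, h⟩
            rw [mem_ofPred_eq] at hw
            rw [← hψi (cylGauge_lt_one_of_spaceNorm hw.le).le hv.1 h] at hv
            exact hw.not_ge hv.2
        · refine ⟨hy, fun ⟨q, hq, h⟩ => hy' ⟨q, ?_, h⟩⟩
          exact cylGauge_lt_one_of_spaceNorm (le_of_lt (show spaceNorm q < 1 from hq))
      · rintro ⟨hx, hx'⟩
        by_cases h : y ∈ ψ '' {v | cylGauge (3 / 2) v < 1}
        · obtain ⟨q, hq, rfl⟩ := h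
          rw [mem_ofPred_eq] at hq
          exact Or.inl ⟨q, ⟨hq.le, not_lt.1 fun h => hx' ⟨q, h, rfl⟩⟩, rfl⟩
        · exact Or.inr ⟨hx, h⟩
    rw [hdom, htgt] at h
    refine ⟨_, h, fun p hp hp' z => ?_, fun p hp z => ?_⟩
    · dsimp only
      split_ifs with hpK
      · obtain ⟨q, hq, rfl⟩ := hpK
        have hq1 : rectGauge (3 / 2) q = 1 :=
          le_antisymm hq.1 (not_lt.1 fun h => hp' ⟨q, h, rfl⟩)
        rw [hval q hq, shell_of_rectGauge_eq_one hq1, hFφ q hq.1,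
          hDb _ ((isFold_boxFold_boundary ha).mem (A := {p | rectGauge (3 / 2) p = 1}) hq1 z)]
      · rfl
    · have hpK : p ∈ K := ⟨(rectGauge_le_one_of_planeNorm hp.le).le, hp.ge⟩
      dsimp only
      rw [if_pos (mem_image_of_mem φ hpK), hval p hpK]
  · rintro _ ⟨q, hq, rfl⟩ ⟨-, hq'⟩ z
    have hq1 : rectGauge (3 / 2) q = 1 :=
      le_antisymm hq.1 (not_lt.1 fun h => hq' ⟨q, h, rfl⟩)
    dsimp only
    rw [hval q hq, shell_of_rectGauge_eq_one hq1, hFφ q hq.1,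
      hDb _ ((isFold_boxFold_boundary ha).mem (A := {p | rectGauge (3 / 2) p = 1}) hq1 z)]
  · rintro _ ⟨v, hv, rfl⟩ ⟨-, hv'⟩
    have hv1 := hb v hv hv'
    obtain ⟨q, hq1, z, rfl⟩ := (isFold_boxFold_boundary ha).exists_eq
      (show v ∈ {v | cylGauge (3 / 2) v = 1} from hv1)
    rw [mem_ofPred_eq] at hq1
    have hqK : q ∈ K := ⟨hq1.le, (one_lt_planeNorm hq1).le⟩
    refine ⟨φ q, mem_image_of_mem φ hqK, ⟨hφA q hq1.le, ?_⟩, z, ?_⟩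
    · rintro ⟨r, hr, h⟩
      rw [mem_ofPred_eq] at hr
      rw [hφi hr.le hq1.le h] at hr
      exact hr.ne hq1
    · dsimp only
      rw [hval q hqK, shell_of_rectGauge_eq_one hq1, hDb _ hv1]

/-- Some point of the shell maps to `u`. Moving it radially to the unit circle keeps its direction,
so the image stays on the ray of `u`; since it has norm `1`, it is still `u`. -/
theorem exists_shell_eq {u : ℝ × ℂ} (hu : spaceNorm u = 1) :
    ∃ p, planeNorm p = 1 ∧ ∃ z, shell (p, z) = u := by
  have ha : (0 : ℝ) < 3 / 2 := by norm_num
  have hg := isGauge_rectGauge ha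
  obtain ⟨p, hp, z, rfl⟩ := isFold_shell.exists_eq
    (show u ∈ {v | cylGauge (3 / 2) v ≤ 1 ∧ 1 ≤ spaceNorm v} from
      ⟨(cylGauge_lt_one_of_spaceNorm hu.le).le, hu.ge⟩)
  have hp0 := shell_mem isGauge_planeNorm hp.2
  have hn := isGauge_planeNorm.pos p hp0
  have hq := isGauge_planeNorm.inv_smul hp0
  obtain ⟨h1, h2, h3, -⟩ := shellFactor_bounds hg isGauge_planeNorm (isFold_boxFold_boundary ha)
    (fun p => one_lt_planeNorm) (fun v hv => lt_trans (by norm_num) (lt_spaceNorm hv)) hp.1 hp.2 z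
  refine ⟨_, hq, z, ?_⟩
  have hdir : (rectGauge (3 / 2) ((planeNorm p)⁻¹ • p))⁻¹ • (planeNorm p)⁻¹ • p =
      (rectGauge (3 / 2) p)⁻¹ • p := by
    rw [hg.smul _ (inv_nonneg.2 hn.le), smul_smul, mul_inv, inv_inv]
    congr 1
    field_simp
  rw [shell, shellFold_of_norm_eq_one hg isGauge_planeNorm hq, hdir]
  rw [shell, shellFold, isGauge_spaceNorm.smul _ ((inv_pos.2 (by linarith)).le.trans h3)] at hu
  rw [shellFold, eq_inv_of_mul_eq_one_left hu]

/-! ### The folds of the punctured sphere and of the punctured torus -/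

/-- Overlapping rectangles, one of them open, have centres less than `3` apart, while the centres
are multiples of `3`. -/
theorem nat_eq_of_planeChart_eq {j k : ℕ} {p q : ℝ × ℝ} (hp : rectGauge (3 / 2) p ≤ 1)
    (hq : rectGauge (3 / 2) q < 1) (h : planeChart (3 * j) q = planeChart (3 * k) p) : j = k := by
  rw [planeChart_shift (3 * j) (3 * k)] at h
  have h1 := congrArg Prod.fst (planeChart_injective _ h)
  dsimp only at h1
  have hp1 := abs_le.1 ((rectGauge_le_one_iff (by norm_num)).1 hp).1
  have hq1 := abs_lt.1 ((rectGauge_lt_one_iff (by norm_num)).1 hq).1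
  have h2 : (j : ℝ) - k < 1 := by linarith
  have h3 : (k : ℝ) - j < 1 := by linarith
  have h4 : (j : ℝ) < k + 1 := by linarith
  have h5 : (k : ℝ) < j + 1 := by linarith
  norm_cast at h4 h5
  omega

theorem isOpen_image_planeChart (c : ℝ) {O : Set (ℝ × ℝ)} (hO : IsOpen O) :
    IsOpen (planeChart c '' O) := isOpenMap_planeChart c _ hO

/-- The balls are removed one at a time. The invariant is that the fold is still the box fold on the
rectangles not yet treated, and a puncture changes it only inside its own open rectangle. -/
theorem exists_fold_sphere_of_le (n k : ℕ) (hk : k ≤ n) : ∃ G : Sph 2 × Circle → Sph 3,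
    IsFold sphRefl G {x | ∀ j < k, x ∉ (sphBall 2 j).interior}
        {y | ∀ j < k, y ∉ (sphBall 3 j).interior} ∧
      (∀ j < n, k ≤ j → ∀ p, rectGauge (3 / 2) p ≤ 1 → ∀ z,
        G (planeChart (3 * j) p, z) = spaceChart (3 * j) (boxFold (p, z))) ∧
      ∀ j < k, ∀ p, planeNorm p = 1 → ∀ z,
        G (planeChart (3 * j) p, z) = spaceChart (3 * j) (twist (shell (p, z))) := by
  have ha : (0 : ℝ) < 3 / 2 := by norm_num
  induction k with
  | zero =>
    -- The large rectangle has first coordinate in `[-3/2, 3n + 3/2]` and contains the small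
    -- rectangles about `3j` for all `j < n`.
    have hn : (0 : ℝ) < (3 * n + 3) / 2 := by positivity
    obtain ⟨G, hG, hG'⟩ := exists_fold_sphere hn (3 * n / 2)
    refine ⟨G, by simpa using hG, fun j hj _ p hp z => ?_, by simp⟩
    rw [planeChart_shift (3 * j) (3 * n / 2), hG', spaceChart_shift (3 * j) (3 * n / 2)]
    · rfl
    · rw [rectGauge_le_one_iff ha, abs_le] at hp
      rw [rectGauge_le_one_iff hn, abs_le]
      have h1 : (j : ℝ) ≤ n := by exact_mod_cast hj.le
      have h2 : (0 : ℝ) ≤ j := Nat.cast_nonneg j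
      exact ⟨⟨by linarith [hp.1.1], by linarith [hp.1.2]⟩, hp.2⟩
  | succ k ih =>
    obtain ⟨F, hF, hbox, hbd⟩ := ih (by omega)
    have hA : ∀ p, rectGauge (3 / 2) p ≤ 1 →
        planeChart (3 * k) p ∈ {x | ∀ j < k, x ∉ (sphBall 2 j).interior} := by
      intro p hp j hj h
      rw [sphBall_two_interior] at h
      obtain ⟨q, hq, h⟩ := h
      exact hj.ne (nat_eq_of_planeChart_eq hp (rectGauge_le_one_of_planeNorm (le_of_lt (show planeNorm q < 1 from hq))) h)
    have hcl : IsClosed {x : Sph 2 | ∀ j < k, x ∉ (sphBall 2 j).interior} := by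
      simp only [ofPred_forall]
      exact isClosed_iInter fun j => isClosed_iInter fun _ =>
        (sphBall 2 j).isOpen_interior.isClosed_compl
    have hlt : IsOpen {p | rectGauge (3 / 2) p < 1} :=
      isOpen_lt (isGauge_rectGauge ha).continuous continuous_const
    obtain ⟨G, hG, hGF, hGb⟩ := hF.puncture sphRefl_involutive hcl (φ := planeChart (3 * k))
      (ψ := spaceChart (3 * k)) (D := twist) (continuous_planeChart _).continuousOn
      (planeChart_injective _).injOn hA (isOpen_image_planeChart _ hlt)
      (fun p _ => sphRefl_planeChart _ p) (continuous_spaceChart _).continuousOn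
      (spaceChart_injective _).injOn (hbox k (by omega) le_rfl) continuous_twist twist_injective
      twist_image_shell fun v hv => twist_of_le_spaceNorm (lt_spaceNorm hv).le
    have hset : ∀ {X : Type} (P : ℕ → Set X), {x | ∀ j < k, x ∉ P j} \ P k =
        {x | ∀ j < k + 1, x ∉ P j} := by
      intro X P
      ext x
      constructor
      · rintro ⟨h1, h2⟩ j hj
        rcases Nat.lt_succ_iff_lt_or_eq.1 hj with h | rfl
        exacts [h1 j h, h2]
      · exact fun h => ⟨fun j hj => h j (by omega), h k (by omega)⟩
    rw [← sphBall_two_interior, ← sphBall_three_interior, hset fun j => (sphBall 2 j).interior,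
      hset fun j => (sphBall 3 j).interior] at hG
    refine ⟨G, hG, fun j hj hkj p hp z => ?_, fun j hj p hp z => ?_⟩
    · rw [hGF, hbox j hj (by omega) p hp]
      · intro i hi h
        rw [sphBall_two_interior] at h
        obtain ⟨q, hq, h⟩ := h
        have := nat_eq_of_planeChart_eq hp (rectGauge_le_one_of_planeNorm (le_of_lt (show planeNorm q < 1 from hq))) h
        omega
      · rintro ⟨q, hq, h⟩
        have := nat_eq_of_planeChart_eq hp hq h
        omega
    · rcases Nat.lt_succ_iff_lt_or_eq.1 hj with h | rfl
      · rw [hGF, hbd j h p hp]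
        · intro i hi h
          rw [sphBall_two_interior] at h
          obtain ⟨q, hq, h⟩ := h
          rw [mem_ofPred_eq] at hq
          have := nat_eq_of_planeChart_eq (rectGauge_le_one_of_planeNorm hp.le).le
            (rectGauge_le_one_of_planeNorm hq.le) h
          subst this
          rw [planeChart_injective _ h] at hq
          exact hq.ne hp
        · rintro ⟨q, hq, h'⟩
          exact h.ne (nat_eq_of_planeChart_eq (le_of_lt (show rectGauge _ q < 1 from hq))
            (rectGauge_le_one_of_planeNorm hp.le) h'.symm)
      · exact hGb p hp z

theorem exists_fold_punctured_sphere (n : ℕ) : ∃ G : Sph 2 × Circle → Sph 3,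
    IsFold sphRefl G {x | ∀ i : Fin n, x ∉ (sphBall 2 i).interior}
        {y | ∀ i : Fin n, y ∉ (sphBall 3 i).interior} ∧
      ∀ (i : Fin n) (v : Euc 2), ‖v‖ = 1 → ∀ z, G ((sphBall 2 i).toFun v, z) =
        (sphBall 3 i).toFun (toSpace' (shell (ofPlane v, z))) := by
  obtain ⟨G, hG, -, hb⟩ := exists_fold_sphere_of_le n n le_rfl
  refine ⟨G, ?_, fun i v hv z => ?_⟩
  · convert! hG <;> exact Fin.forall_iff
  · have hv' : planeNorm (ofPlane v) = 1 := (planeNorm_ofPlane v).trans hv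
    rw [sphBall_two_toFun, hb i i.2 _ hv', ← toSpace_twist (spaceNorm_shell hv' z),
      sphBall_three_toFun]

theorem injOn_torusChart : InjOn torusChart {p | rectGauge (3 / 2) p ≤ 1} := by
  intro p hp q hq h
  rw [mem_ofPred_eq, rectGauge_le_one_iff (by norm_num)] at hp hq
  have := pi_div_two_lt_two
  refine Prod.ext (circleExp_injOn ?_ ?_ (congrArg Prod.fst h))
    (circleExp_injOn ?_ ?_ (congrArg Prod.snd h)) <;> rw [mem_Ioo, ← abs_lt] <;> linarith

theorem continuous_torusChart : Continuous torusChart := by unfold torusChart; fun_prop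

theorem isOpenMap_torusChart : IsOpenMap torusChart :=
  isLocalHomeomorph_circleExp.isOpenMap.prodMap isLocalHomeomorph_circleExp.isOpenMap

theorem torusRefl_involutive : Function.Involutive torusRefl := fun p => by simp [torusRefl]

theorem continuous_torusRefl : Continuous torusRefl := by unfold torusRefl; fun_prop

theorem torusRefl_torusChart (p : ℝ × ℝ) : torusRefl (torusChart p) = torusChart (planeRefl p) := by
  simp [torusRefl, torusChart, planeRefl, Circle.exp_neg]

theorem continuous_solidChart : Continuous solidChart := by
  unfold solidChart
  exact (continuous_complexChart.comp continuous_snd).prodMk (by fun_prop)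

theorem injOn_solidChart : InjOn solidChart {v | cylGauge (3 / 2) v ≤ 1} := by
  intro v hv w hw h
  rw [mem_ofPred_eq, cylGauge_le_one_iff (by norm_num)] at hv hw
  refine Prod.ext (circleExp_injOn ?_ ?_ (congrArg Prod.snd h))
    (complexChart_injective (congrArg Prod.fst h)) <;> rw [mem_Ioo, ← abs_lt] <;> linarith

theorem torusBall_toFun (v : Euc 2) : torusBall.toFun v = torusChart (ofPlane v) := rfl

theorem sphCircleBall_toFun (v : ℝ × ℂ) : sphCircleBall.toFun (toSpace' v) = solidChart v := rfl

theorem torusBall_interior : torusBall.interior = torusChart '' {p | planeNorm p < 1} := by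
  ext x
  constructor
  · rintro ⟨v, hv, rfl⟩
    exact ⟨ofPlane v, (planeNorm_ofPlane v).trans_lt (mem_ball_zero_iff.1 hv), rfl⟩
  · rintro ⟨p, hp, rfl⟩
    exact ⟨toPlane p, mem_ball_zero_iff.2 ((norm_toPlane p).trans_lt hp), rfl⟩

theorem sphCircleBall_interior :
    sphCircleBall.interior = solidChart '' {v | spaceNorm v < 1} := by
  ext x
  constructor
  · rintro ⟨v, hv, rfl⟩
    obtain ⟨v, rfl⟩ := surjective_toSpace' v
    exact ⟨v, (norm_toSpace' v).symm.trans_lt (mem_ball_zero_iff.1 hv), rfl⟩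
  · rintro ⟨p, hp, rfl⟩
    exact ⟨toSpace' p, mem_ball_zero_iff.2 ((norm_toSpace' p).trans_lt hp), rfl⟩

theorem exists_fold_punctured_torus : ∃ G : (Circle × Circle) × Circle → Sph 2 × Circle,
    IsFold torusRefl G {x | x ∉ torusBall.interior} {y | y ∉ sphCircleBall.interior} ∧
      ∀ v : Euc 2, ‖v‖ = 1 → ∀ z, G (torusBall.toFun v, z) =
        sphCircleBall.toFun (toSpace' (shell (ofPlane v, z))) := by
  have ha : (0 : ℝ) < 3 / 2 := by norm_num
  obtain ⟨F, hF, hF'⟩ := exists_fold_torus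
  have hlt : IsOpen {p | rectGauge (3 / 2) p < 1} :=
    isOpen_lt (isGauge_rectGauge ha).continuous continuous_const
  obtain ⟨G, hG, -, hGb⟩ := hF.puncture torusRefl_involutive isClosed_univ (φ := torusChart)
    (ψ := solidChart) (D := id) continuous_torusChart.continuousOn injOn_torusChart
    (fun _ _ => mem_univ _) (isOpenMap_torusChart _ hlt) (fun p _ => torusRefl_torusChart p)
    continuous_solidChart.continuousOn injOn_solidChart
    (fun p hp => hF' p ((rectGauge_le_one_iff ha).1 hp).2) continuous_id Function.injective_id
    (image_id _) fun v _ => rfl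
  refine ⟨G, ?_, fun v hv z => ?_⟩
  · rw [← torusBall_interior, ← sphCircleBall_interior, ← compl_eq_univ_sdiff,
      ← compl_eq_univ_sdiff] at hG
    exact hG
  · rw [torusBall_toFun, hGb _ ((planeNorm_ofPlane v).trans hv), sphCircleBall_toFun]
    rfl

/-! ### Folds of connected sums -/

/-- The reflection of the plane in the first axis. -/
def discRefl (v : Euc 2) : Euc 2 := toPlane (planeRefl (ofPlane v))

theorem norm_discRefl (v : Euc 2) : ‖discRefl v‖ = ‖v‖ := by
  rw [discRefl, norm_toPlane, ← planeNorm_ofPlane v]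
  simp [planeNorm, planeRefl]

/-- The map by which the boundary circle of a punctured surface, times `S¹`, is folded onto the
boundary sphere. -/
def sphereFold (p : Euc 2 × Circle) : Euc 3 := toSpace' (shell (ofPlane p.1, p.2))

theorem norm_sphereFold {v : Euc 2} (hv : ‖v‖ = 1) (z : Circle) : ‖sphereFold (v, z)‖ = 1 := by
  rw [sphereFold, norm_toSpace']
  exact spaceNorm_shell ((planeNorm_ofPlane v).trans hv) z

theorem exists_sphereFold_eq {u : Euc 3} (hu : ‖u‖ = 1) :
    ∃ v : Euc 2, ‖v‖ = 1 ∧ ∃ z, sphereFold (v, z) = u := by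
  obtain ⟨u, rfl⟩ := surjective_toSpace' u
  rw [norm_toSpace'] at hu
  obtain ⟨p, hp, z, rfl⟩ := exists_shell_eq hu
  exact ⟨toPlane p, (norm_toPlane p).trans hp, z, by rw [sphereFold, ofPlane_toPlane]⟩

/-- Both kinds of pieces fold their boundary by the same `sphereFold`, and both involutions act on
the boundary circle by `discRefl`. Hence the folds and the involutions descend to the connected
sums. -/
theorem ConnSum.exists_fold {ι X M X' M' : Type*} [TopologicalSpace X] [TopologicalSpace M]
    [TopologicalSpace X'] [TopologicalSpace M'] {φ : ι → CoordBall 2 X}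
    (hφ : Pairwise fun i j => Disjoint (φ i).closed (φ j).closed) {ψ : CoordBall 2 M}
    {φ' : ι → CoordBall 3 X'} (hφ' : Pairwise fun i j => Disjoint (φ' i).closed (φ' j).closed)
    {ψ' : CoordBall 3 M'} {σ : X → X} {θ : M → M} {G : X × Circle → X'} {H : M × Circle → M'}
    (hσ : Continuous σ) (hσσ : Function.Involutive σ) (hθ : Continuous θ)
    (hθθ : Function.Involutive θ)
    (hG : IsFold σ G {x | ∀ i, x ∉ (φ i).interior} {y | ∀ i, y ∉ (φ' i).interior})
    (hH : IsFold θ H {x | x ∉ ψ.interior} {y | y ∉ ψ'.interior})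
    (hGb : ∀ i v, ‖v‖ = 1 → ∀ z, G ((φ i).toFun v, z) = (φ' i).toFun (sphereFold (v, z)))
    (hHb : ∀ v, ‖v‖ = 1 → ∀ z, H (ψ.toFun v, z) = ψ'.toFun (sphereFold (v, z)))
    (hσφ : ∀ i v, ‖v‖ = 1 → σ ((φ i).toFun v) = (φ i).toFun (discRefl v))
    (hθψ : ∀ v, ‖v‖ = 1 → θ (ψ.toFun v) = ψ.toFun (discRefl v)) :
    ∃ (s : ConnSum φ hφ (fun _ => ψ) → ConnSum φ hφ (fun _ => ψ))
      (f : C(ConnSum φ hφ (fun _ => ψ) × Circle, ConnSum φ' hφ' (fun _ => ψ'))),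
      Continuous s ∧ Function.Involutive s ∧
      (∀ x, s (inl hφ (fun _ => ψ) x) = inl hφ (fun _ => ψ) ⟨σ x.1, hG.mapsTo x.2⟩) ∧
      (∀ i y, s (inr hφ (fun _ => ψ) i y) = inr hφ (fun _ => ψ) i ⟨θ y.1, hH.mapsTo y.2⟩) ∧
      Function.Surjective f ∧
      ∀ p q, f p = f q ↔ q = p ∨ q = (s p.1, p.2⁻¹) := by
  let sP : ConnSumPieces φ (fun _ => ψ) → ConnSum φ hφ (fun _ => ψ) :=
    Sum.elim (fun x => inl hφ (fun _ => ψ) ⟨σ x.1, hG.mapsTo x.2⟩)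
      fun y => inr hφ (fun _ => ψ) y.1 ⟨θ y.2.1, hH.mapsTo y.2.2⟩
  have hsP : Continuous sP := by
    refine Continuous.sumElim ?_ (continuous_sigma fun i => ?_)
    · exact continuous_inl.comp ((hσ.comp continuous_subtype_val).subtype_mk _)
    · exact (continuous_inr i).comp ((hθ.comp continuous_subtype_val).subtype_mk _)
  have hs1 : ∀ u v, ConnSumRel φ (fun _ => ψ) u v → sP u = sP v := by
    intro u v h
    cases h with
    | glue i v hv x hx y hy =>
      refine inl_eq_inr_iff.2 ⟨discRefl v, (norm_discRefl v).trans hv, ?_, ?_⟩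
      · exact (congrArg σ hx).trans (hσφ i v hv)
      · exact (congrArg θ hy).trans (hθψ v hv)
  let s : ConnSum φ hφ (fun _ => ψ) → ConnSum φ hφ (fun _ => ψ) := Quot.lift sP hs1
  have hs : Continuous s := continuous_quot_lift _ hsP
  have hss : Function.Involutive s := by
    intro p
    rcases exists_rep p with ⟨x, rfl⟩ | ⟨i, y, rfl⟩
    · exact congrArg (inl hφ (fun _ => ψ)) (Subtype.ext (hσσ x.1))
    · exact congrArg (inr hφ (fun _ => ψ) i) (Subtype.ext (hθθ y.1))
  let fX : C({x : X // ∀ i, x ∉ (φ i).interior} × Circle, ConnSum φ' hφ' (fun _ => ψ')) :=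
    ⟨fun p => inl hφ' (fun _ => ψ') ⟨G (p.1.1, p.2), hG.mem p.1.2 p.2⟩,
      continuous_inl.comp ((hG.continuousOn.comp_continuous (by fun_prop)
        fun p => ⟨p.1.2, mem_univ _⟩).subtype_mk _)⟩
  let fM : ι → C({x : M // x ∉ ψ.interior} × Circle, ConnSum φ' hφ' (fun _ => ψ')) := fun i =>
    ⟨fun p => inr hφ' (fun _ => ψ') i ⟨H (p.1.1, p.2), hH.mem p.1.2 p.2⟩,
      (continuous_inr i).comp ((hH.continuousOn.comp_continuous (by fun_prop)
        fun p => ⟨p.1.2, mem_univ _⟩).subtype_mk _)⟩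
  -- Currying reduces the continuity of `f` to that of a map out of the quotient alone, rather than
  -- out of its product with the circle.
  let fP : ConnSumPieces φ (fun _ => ψ) → C(Circle, ConnSum φ' hφ' (fun _ => ψ')) :=
    Sum.elim fX.curry fun y => (fM y.1).curry y.2
  have hfP : Continuous fP :=
    Continuous.sumElim fX.curry.continuous (continuous_sigma fun i => (fM i).curry.continuous)
  have hf1 : ∀ u v, ConnSumRel φ (fun _ => ψ) u v → fP u = fP v := by
    intro u v h
    cases h with
    | glue i v hv x hx y hy =>
      ext z
      refine inl_eq_inr_iff.2 ⟨sphereFold (v, z), norm_sphereFold hv z, ?_, ?_⟩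
      · change G (x.1, z) = _
        rw [hx, hGb i v hv]
      · change H (y.1, z) = _
        rw [hy, hHb v hv]
  let f : C(ConnSum φ hφ (fun _ => ψ) × Circle, ConnSum φ' hφ' (fun _ => ψ')) :=
    ContinuousMap.uncurry ⟨Quot.lift fP hf1, continuous_quot_lift _ hfP⟩
  have hfl : ∀ x z, f (inl hφ (fun _ => ψ) x, z) =
      inl hφ' (fun _ => ψ') ⟨G (x.1, z), hG.mem x.2 z⟩ := fun _ _ => rfl
  have hfr : ∀ i y z, f (inr hφ (fun _ => ψ) i y, z) =
      inr hφ' (fun _ => ψ') i ⟨H (y.1, z), hH.mem y.2 z⟩ := fun _ _ _ => rfl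
  have hsl : ∀ x, s (inl hφ (fun _ => ψ) x) = inl hφ (fun _ => ψ) ⟨σ x.1, hG.mapsTo x.2⟩ :=
    fun _ => rfl
  have hsr : ∀ i y, s (inr hφ (fun _ => ψ) i y) =
      inr hφ (fun _ => ψ) i ⟨θ y.1, hH.mapsTo y.2⟩ := fun _ _ => rfl
  have hinv : ∀ p z, f (s p, z⁻¹) = f (p, z) := by
    intro p z
    rcases exists_rep p with ⟨x, rfl⟩ | ⟨i, y, rfl⟩
    · rw [hsl, hfl, hfl]
      exact congrArg _ (Subtype.ext (hG.apply_inv x.2 z))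
    · rw [hsr, hfr, hfr]
      exact congrArg (inr hφ' (fun _ => ψ') i) (Subtype.ext (hH.apply_inv y.2 z))
  have hll : ∀ x x' z z', f (inl hφ (fun _ => ψ) x, z) = f (inl hφ (fun _ => ψ) x', z') →
      (inl hφ (fun _ => ψ) x', z') = (inl hφ (fun _ => ψ) x, z) ∨
        (inl hφ (fun _ => ψ) x', z') = (s (inl hφ (fun _ => ψ) x), z⁻¹) := by
    intro x x' z z' h
    rw [hfl, hfl] at h
    have h1 := congrArg Subtype.val (inl_injective h)
    rcases (hG.eq_iff _ x.2 _ x'.2 z z').1 h1 with ⟨h2, rfl⟩ | ⟨h2, rfl⟩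
    · exact Or.inl (by rw [Subtype.ext h2])
    · refine Or.inr (Prod.ext ?_ rfl)
      exact congrArg (inl hφ (fun _ => ψ)) (Subtype.ext h2)
  -- A coincidence between the two sides takes place on a gluing sphere, so `y` lies on a boundary
  -- circle. It then also represents a point of the punctured `X`, which reduces the claim to `hll`.
  have hlr : ∀ x i y z z', f (inl hφ (fun _ => ψ) x, z) = f (inr hφ (fun _ => ψ) i y, z') →
      (inr hφ (fun _ => ψ) i y, z') = (inl hφ (fun _ => ψ) x, z) ∨
        (inr hφ (fun _ => ψ) i y, z') = (s (inl hφ (fun _ => ψ) x), z⁻¹) := by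
    intro x i y z z' h
    have h0 := h
    rw [hfl, hfr, inl_eq_inr_iff] at h
    obtain ⟨u, hu, -, h2⟩ := h
    obtain ⟨v, hv, w, rfl⟩ := exists_sphereFold_eq hu
    have hψv : ψ.toFun v ∉ ψ.interior := ψ.notMem_interior hv.ge (by linarith)
    have h3 : H (ψ.toFun v, w) = H (y.1, z') := (hHb v hv w).trans h2.symm
    obtain ⟨v', hv', hy⟩ : ∃ v', ‖v'‖ = 1 ∧ y.1 = ψ.toFun v' := by
      rcases (hH.eq_iff _ hψv _ y.2 w z').1 h3 with ⟨h4, -⟩ | ⟨h4, -⟩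
      · exact ⟨v, hv, h4⟩
      · exact ⟨discRefl v, (norm_discRefl v).trans hv, h4.trans (hθψ v hv)⟩
    have hφv : ∀ j, (φ i).toFun v' ∉ (φ j).interior := by
      intro j
      by_cases hij : i = j
      · subst hij
        exact (φ i).notMem_interior hv'.ge (by linarith)
      · exact fun h => Set.disjoint_left.1 (hφ hij) ((φ i).mem_closed_of_norm_eq_one hv')
          ((φ j).interior_subset_closed h)
    have h5 : inl hφ (fun _ => ψ) ⟨(φ i).toFun v', hφv⟩ = inr hφ (fun _ => ψ) i y :=
      inl_eq_inr_iff.2 ⟨v', hv', rfl, hy⟩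
    rw [← h5] at h0 ⊢
    exact hll _ _ _ _ h0
  refine ⟨s, f, hs, hss, hsl, hsr, ?_, ?_⟩
  · intro q
    rcases exists_rep q with ⟨x, rfl⟩ | ⟨i, y, rfl⟩
    · obtain ⟨p, hp, z, h⟩ := hG.exists_eq x.2
      exact ⟨(inl hφ (fun _ => ψ) ⟨p, hp⟩, z),
        congrArg (inl hφ' (fun _ => ψ')) (Subtype.ext h)⟩
    · obtain ⟨p, hp, z, h⟩ := hH.exists_eq y.2
      exact ⟨(inr hφ (fun _ => ψ) i ⟨p, hp⟩, z),
        congrArg (inr hφ' (fun _ => ψ') i) (Subtype.ext h)⟩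
  · rintro ⟨p, z⟩ ⟨q, w⟩
    constructor
    · intro h
      rcases exists_rep p with ⟨x, rfl⟩ | ⟨i, x, rfl⟩ <;> rcases exists_rep q with ⟨y, rfl⟩ | ⟨j, y, rfl⟩
      · exact hll _ _ _ _ h
      · exact hlr _ _ _ _ _ h
      · rcases hlr _ _ _ _ _ h.symm with h | h
        · exact Or.inl h.symm
        · refine Or.inr ?_
          obtain ⟨h1, h2⟩ := Prod.mk.inj h
          rw [h1, h2, hss, inv_inv]
      · have h1 := h
        rw [hfr, hfr] at h1
        obtain rfl : i = j := congrArg Sigma.fst (inr_eq_inr h1)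
        have h2 := congrArg Subtype.val (inr_injective i h1)
        rcases (hH.eq_iff _ x.2 _ y.2 z w).1 h2 with ⟨h3, rfl⟩ | ⟨h3, rfl⟩
        · exact Or.inl (by rw [Subtype.ext h3])
        · refine Or.inr (Prod.ext ?_ rfl)
          exact congrArg (inr hφ (fun _ => ψ) i) (Subtype.ext h3)
    · rintro (h | h)
      · rw [h]
      · rw [h, hinv]

/-! ### Charts at the fixed points of an involution -/

/-- The radial homeomorphism from `E` onto the ball of radius `r`. -/
def shrink {E : Type*} [NormedAddCommGroup E] [NormedSpace ℝ E] (r : ℝ) (v : E) : E :=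
  r • (OpenPartialHomeomorph.univUnitBall v : E)

section Shrink

variable {E : Type*} [NormedAddCommGroup E] [NormedSpace ℝ E]

theorem isOpenEmbedding_shrink {r : ℝ} (hr : 0 < r) : IsOpenEmbedding (shrink r : E → E) :=
  (Homeomorph.smulOfNeZero r hr.ne').isOpenEmbedding.comp
    (OpenPartialHomeomorph.univUnitBall.isOpenEmbedding rfl)

theorem shrink_mem_ball {r : ℝ} (hr : 0 < r) (v : E) : shrink r v ∈ ball (0 : E) r := by
  have h := OpenPartialHomeomorph.univUnitBall.map_source (mem_univ v)
  rw [mem_ball_zero_iff, shrink, norm_smul, Real.norm_of_nonneg hr.le]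
  exact mul_lt_of_lt_one_right hr (mem_ball_zero_iff.1 h)

theorem shrink_zero (r : ℝ) : shrink r (0 : E) = 0 := by
  simp [shrink]

theorem shrink_map {L : E → E} (hL : ∀ v, ‖L v‖ = ‖v‖) (hL' : ∀ (t : ℝ) v, L (t • v) = t • L v)
    (r : ℝ) (v : E) : shrink r (L v) = L (shrink r v) := by
  rw [shrink, shrink, OpenPartialHomeomorph.univUnitBall_apply,
    OpenPartialHomeomorph.univUnitBall_apply, hL', hL', hL]

end Shrink

section ConjChart

variable {X : Type*} [TopologicalSpace X] {s : X → X} {x : X}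

open ComplexConjugate

/-- There is a chart of the surface `X` around `x` in which `s` is complex conjugation. -/
def HasConjChart (s : X → X) (x : X) : Prop :=
  ∃ e : ℂ → X, IsOpenEmbedding e ∧ e 0 = x ∧ ∀ w, e (conj w) = s (e w)

theorem shrink_conj (r : ℝ) (w : ℂ) : shrink r (conj w) = conj (shrink r w) :=
  shrink_map (fun v => RCLike.norm_conj v) (fun t v => by simp) r w

theorem hasConjChart_of_ball {r : ℝ} (hr : 0 < r) {e : ball (0 : ℂ) r → X} (he : IsOpenEmbedding e)
    (h0 : e ⟨0, mem_ball_self hr⟩ = x)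
    (hs : ∀ w w' : ball (0 : ℂ) r, w'.1 = conj w.1 → e w' = s (e w)) : HasConjChart s x := by
  have h : IsOpenEmbedding fun w : ℂ => (⟨shrink r w, shrink_mem_ball hr w⟩ : ball (0 : ℂ) r) :=
    .of_comp _ isOpen_ball.isOpenEmbedding_subtypeVal (isOpenEmbedding_shrink hr)
  refine ⟨_, he.comp h, ?_, fun w => hs _ _ (shrink_conj r w)⟩
  rw [← h0, Function.comp]
  exact congrArg e (Subtype.ext (shrink_zero r))

theorem HasConjChart.avoid (h : HasConjChart s x) {C : Set X} (hC : IsClosed C) (hx : x ∉ C) :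
    ∃ e : ℂ → X, IsOpenEmbedding e ∧ e 0 = x ∧ (∀ w, e (conj w) = s (e w)) ∧ ∀ w, e w ∉ C := by
  obtain ⟨e, he, rfl, hs⟩ := h
  obtain ⟨r, hr, hrC⟩ := Metric.isOpen_iff.1 (hC.isOpen_compl.preimage he.continuous) 0 hx
  refine ⟨e ∘ shrink r, he.comp (isOpenEmbedding_shrink hr), ?_, fun w => ?_,
    fun w => hrC (shrink_mem_ball hr w)⟩
  · rw [Function.comp, shrink_zero]
  · rw [Function.comp, shrink_conj, hs]
    rfl

/-- The involution reverses the imaginary part of the surface chart and the angle about `z`. These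
two coordinates are combined into the complex coordinate `w`, and the real part of the surface chart
becomes `t`. -/
theorem HasConjChart.prod_circle (h : HasConjChart s x) {z : Circle} (hz : z⁻¹ = z) :
    ∃ e : ℂ × ℝ → X × Circle, IsOpenEmbedding e ∧ e 0 = (x, z) ∧
      ∀ w t, e (-w, t) = (s (e (w, t)).1, (e (w, t)).2⁻¹) := by
  obtain ⟨e, he, rfl, hs⟩ := h
  let h1 : ℂ × ℝ ≃ₜ ℂ × ℝ :=
    { toFun := fun p => (⟨p.2, p.1.re⟩, p.1.im)
      invFun := fun p => (⟨p.1.im, p.2⟩, p.1.re)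
      left_inv := fun p => rfl
      right_inv := fun p => rfl
      continuous_toFun := by
        refine Continuous.prodMk ?_ (by fun_prop)
        exact Complex.equivRealProdCLM.symm.continuous.comp
          (f := fun p : ℂ × ℝ => (p.2, p.1.re)) (by fun_prop)
      continuous_invFun := by
        refine Continuous.prodMk ?_ (by fun_prop)
        exact Complex.equivRealProdCLM.symm.continuous.comp
          (f := fun p : ℂ × ℝ => (p.1.im, p.2)) (by fun_prop) }
  -- Shrinking the line to `(-1, 1)` makes the exponential injective while keeping the chart odd.
  have h2 : IsOpenEmbedding fun t : ℝ => z * Circle.exp (shrink 1 t) := by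
    refine (Homeomorph.mulLeft z).isOpenEmbedding.comp (.of_continuous_injective_isOpenMap
      (Circle.exp.continuous.comp (isOpenEmbedding_shrink one_pos).continuous) ?_
      (isLocalHomeomorph_circleExp.isOpenMap.comp (isOpenEmbedding_shrink one_pos).isOpenMap))
    have hb : ∀ t : ℝ, shrink 1 t ∈ Ioo (-2 : ℝ) 2 := fun t => by
      have := mem_ball_zero_iff.1 (shrink_mem_ball one_pos t)
      rw [Real.norm_eq_abs] at this
      exact abs_lt.1 (by linarith)
    exact fun t u h => (isOpenEmbedding_shrink one_pos).injective (circleExp_injOn (hb t) (hb u) h)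
  refine ⟨_, (he.prodMap h2).comp h1.isOpenEmbedding, ?_, fun w t => ?_⟩
  · refine Prod.ext (congrArg e (Complex.ext rfl rfl)) ?_
    change z * Circle.exp (shrink 1 (0 : ℝ)) = z
    rw [shrink_zero, Circle.exp_zero, mul_one]
  · refine Prod.ext ?_ ?_
    · change e ⟨t, (-w).re⟩ = s (e ⟨t, w.re⟩)
      rw [← hs]
      exact congrArg e (Complex.ext rfl rfl)
    · change z * Circle.exp (shrink 1 (-w).im) = (z * Circle.exp (shrink 1 w.im))⁻¹
      rw [mul_inv, hz, ← Circle.exp_neg, Complex.neg_im,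
        shrink_map (L := Neg.neg) norm_neg fun t v => (smul_neg t v).symm]

end ConjChart

/-! ### Charts at the fixed points of the involution of the surface -/

open ComplexConjugate

/-- The coordinates of a complex number. -/
def complexToPlane : ℂ ≃ₜ Euc 2 where
  toFun w := toPlane (w.re, w.im)
  invFun v := ⟨v 0, v 1⟩
  left_inv _ := rfl
  right_inv v := toPlane_ofPlane v
  continuous_toFun := continuous_toPlane.comp (by fun_prop)
  continuous_invFun := Complex.equivRealProdCLM.symm.continuous.comp continuous_ofPlane

theorem norm_complexToPlane (w : ℂ) : ‖complexToPlane w‖ = ‖w‖ := norm_re_im w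

theorem complexToPlane_conj (w : ℂ) : complexToPlane (conj w) = discRefl (complexToPlane w) := by
  refine congrArg toPlane (Prod.ext ?_ ?_) <;> simp [planeRefl, ofPlane, complexToPlane, toPlane]

theorem isOpenEmbedding_planeChart_complex (c : ℝ) :
    IsOpenEmbedding fun w : ℂ => planeChart c (w.re, w.im) :=
  (stereoInv_isOpenEmbedding.comp
    (Homeomorph.addLeft (EuclideanSpace.single 0 c)).isOpenEmbedding).comp
      complexToPlane.isOpenEmbedding

/-- Planar charts centred on the axis reach every fixed point except the pole. The inversion, which
commutes with the reflection, carries such a chart to the pole. -/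
theorem hasConjChart_sphRefl {x : Sph 2} (hx : sphRefl x = x) : HasConjChart sphRefl x := by
  have hconj : ∀ c (w : ℂ), planeChart c ((conj w).re, (conj w).im) =
      sphRefl (planeChart c (w.re, w.im)) := fun c w => by
    rw [sphRefl_planeChart]
    exact congrArg _ (Prod.ext (Complex.conj_re w) (Complex.conj_im w))
  by_cases hp : x = northPole 2
  · let m : Euc 2 := EuclideanSpace.single 0 0
    have hg := isGauge_planeGauge one_pos
    let h : Sph 2 ≃ₜ Sph 2 :=
      { toFun := sphInv (planeGauge 1) m
        invFun := sphInv (planeGauge 1) m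
        left_inv := hg.sphInv_involutive
        right_inv := hg.sphInv_involutive
        continuous_toFun := hg.continuous_sphInv
        continuous_invFun := hg.continuous_sphInv }
    refine ⟨_, h.isOpenEmbedding.comp (isOpenEmbedding_planeChart_complex 0), ?_, fun w => ?_⟩
    · rw [hp, ← sphInv_center (g := planeGauge 1) (m := m)]
      refine congrArg (sphInv (planeGauge 1) m) (congrArg stereoInv ?_)
      ext i; fin_cases i <;> simp [toPlane, m]
    · rw [Function.comp, hconj]
      exact sphRefl_sphInv one_pos 0 _
  · obtain ⟨y, rfl⟩ := exists_stereoInv_eq hp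
    have hy : stereoInv y = planeChart (y 0) (0, y 1) := by
      refine congrArg stereoInv ?_
      ext i; fin_cases i <;> simp [toPlane]
    rw [hy, sphRefl_planeChart] at hx
    have h1 : y 1 = 0 := by
      have : -y 1 = y 1 := congrArg Prod.snd (planeChart_injective _ hx)
      linarith
    refine ⟨_, isOpenEmbedding_planeChart_complex (y 0), ?_, hconj _⟩
    rw [hy, h1]
    rfl

/-- The chart is the angular one translated by `x`. Since `x.2` is its own inverse, inversion only
changes the sign of the second angle. -/
theorem hasConjChart_torusRefl {x : Circle × Circle} (hx : torusRefl x = x) :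
    HasConjChart torusRefl x := by
  have hx2 : x.2⁻¹ = x.2 := congrArg Prod.snd hx
  refine hasConjChart_of_ball one_pos
    (e := fun w => (x.1 * Circle.exp w.1.re, x.2 * Circle.exp w.1.im)) ?_ ?_ ?_
  · have h : IsOpenEmbedding fun w : ball (0 : ℂ) 1 => torusChart (w.1.re, w.1.im) := by
      refine .of_continuous_injective_isOpenMap
        (continuous_torusChart.comp (by fun_prop)) ?_ ?_
      · intro w w' h
        have hw : ∀ w : ball (0 : ℂ) 1, rectGauge (3 / 2) (w.1.re, w.1.im) ≤ 1 := fun w => by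
          have h1 := mem_ball_zero_iff.1 w.2
          have h2 := Complex.abs_re_le_norm w.1
          have h3 := Complex.abs_im_le_norm w.1
          have := Real.pi_gt_three
          rw [rectGauge_le_one_iff (by norm_num)]
          constructor <;> dsimp only <;> linarith
        have h1 := injOn_torusChart (hw w) (hw w') h
        exact Subtype.ext (Complex.ext (congrArg Prod.fst h1) (congrArg Prod.snd h1))
      · exact (isOpenMap_torusChart.comp
          Complex.equivRealProdCLM.toHomeomorph.isOpenMap).comp isOpen_ball.isOpenMap_subtype_val
    exact ((Homeomorph.mulLeft x.1).isOpenEmbedding.prodMap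
      (Homeomorph.mulLeft x.2).isOpenEmbedding).comp h
  · simp
  · rintro w w' h
    simp only [h, torusRefl, Complex.conj_re, Complex.conj_im, mul_inv, hx2, Circle.exp_neg]

theorem CoordBall.isClosed_closed {d : ℕ} {M : Type*} [TopologicalSpace M] [T2Space M]
    (φ : CoordBall d M) : IsClosed φ.closed :=
  ((isCompact_closedBall _ _).image_of_continuousOn
    (φ.continuousOn.mono (closedBall_subset_ball one_lt_two))).isClosed

theorem CoordBall.exists_norm_eq_one {d : ℕ} {M : Type*} [TopologicalSpace M] {φ : CoordBall d M}
    {x : M} (hx : x ∈ φ.closed) (hx' : x ∉ φ.interior) : ∃ v, ‖v‖ = 1 ∧ φ.toFun v = x := by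
  obtain ⟨v, hv, rfl⟩ := hx
  refine ⟨v, le_antisymm (mem_closedBall_zero_iff.1 hv) (not_lt.1 fun h => ?_), rfl⟩
  exact hx' ⟨v, mem_ball_zero_iff.2 h, rfl⟩

/-- The centres are at least `3 = 2 + 1` apart. This is the separation hypothesis of `ConnSum.neck`.
-/
theorem sphBall_two_separated {n : ℕ} (i j : Fin n) (hij : j ≠ i) (v : Euc 2) (hv : v ∈ ball 0 2) :
    (sphBall 2 i).toFun v ∉ (sphBall 2 j).closed := by
  rintro ⟨w, hw, h⟩
  have h1 := stereoInv_isOpenEmbedding.injective h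
  have h2 : 3 * ((j : ℕ) : ℝ) + w 0 = 3 * ((i : ℕ) : ℝ) + v 0 := by
    simpa using congrArg (fun z : Euc 2 => z 0) h1
  have hv0 := abs_coord_lt hv 0
  have hw0 := abs_le.1 ((PiLp.norm_apply_le w 0).trans (mem_closedBall_zero_iff.1 hw))
  have h3 : ((i : ℕ) : ℝ) < (j : ℕ) + 1 := by linarith [hv0.1, hv0.2, hw0.1, hw0.2]
  have h4 : ((j : ℕ) : ℝ) < (i : ℕ) + 1 := by linarith [hv0.1, hv0.2, hw0.1, hw0.2]
  norm_cast at h3 h4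
  exact hij (Fin.ext (by omega))

theorem sphRefl_sphBall (k : ℕ) (v : Euc 2) :
    sphRefl ((sphBall 2 k).toFun v) = (sphBall 2 k).toFun (discRefl v) := by
  rw [sphBall_two_toFun, sphRefl_planeChart, sphBall_two_toFun]
  rfl

theorem torusRefl_torusBall (v : Euc 2) :
    torusRefl (torusBall.toFun v) = torusBall.toFun (discRefl v) :=
  torusRefl_torusChart (ofPlane v)

theorem discRefl_smul (t : ℝ) (v : Euc 2) : discRefl (t • v) = t • discRefl v := by
  ext i
  fin_cases i <;> simp [discRefl, toPlane, planeRefl, ofPlane]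

theorem discRefl_add (u v : Euc 2) : discRefl (u + v) = discRefl u + discRefl v := by
  ext i
  fin_cases i <;> simp [discRefl, toPlane, planeRefl, ofPlane, add_comm]

/-- The class of a point of the punctured sphere in the surface. -/
abbrev surfInl {n : ℕ} (x : {x : Sph 2 // ∀ i : Fin n, x ∉ (sphBall 2 i).interior}) :
    GenusSurface n :=
  ConnSum.inl (sphBall_disjoint 2 n) (fun _ => torusBall) x

/-- The class of a point of the `i`-th punctured torus in the surface. -/
abbrev surfInr {n : ℕ} (i : Fin n) (y : {y : Circle × Circle // y ∉ torusBall.interior}) :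
    GenusSurface n :=
  ConnSum.inr (sphBall_disjoint 2 n) (fun _ => torusBall) i y

section Surface

variable {n : ℕ} {s : GenusSurface n → GenusSurface n}

variable (hsl : ∀ x, ∃ h, s (surfInl x) = surfInl ⟨sphRefl x.1, h⟩)
  (hsr : ∀ i y, ∃ h, s (surfInr i y) = surfInr i ⟨torusRefl y.1, h⟩)

-- At a fixed point on a gluing circle the neck serves as chart. The plane reflection matches
-- `sphRefl` on one side and `torusRefl` on the other, and it commutes with the inversion. A disc of
-- radius `1 / 2` about a unit vector stays inside the annulus.
include hsl hsr in
theorem hasConjChart_of_norm_eq_one (i : Fin n) {v : Euc 2} (hv : ‖v‖ = 1) (hvr : discRefl v = v)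
    (h : ∀ j : Fin n, (sphBall 2 i).toFun v ∉ (sphBall 2 j).interior) :
    HasConjChart s (surfInl ⟨(sphBall 2 i).toFun v, h⟩) := by
  let N : ConnSum.Annulus 2 → GenusSurface n :=
    ConnSum.neck (sphBall_disjoint 2 n) (fun _ => torusBall) i fun j hj => sphBall_two_separated i j hj
  have hN : IsOpenEmbedding N := ConnSum.isOpenEmbedding_neck
  have hmem : ∀ w : ball (0 : ℂ) (1 / 2), 1 / 2 < ‖v + complexToPlane w.1‖ ∧
      ‖v + complexToPlane w.1‖ < 2 := fun w => by
    have h1 := mem_ball_zero_iff.1 w.2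
    rw [← norm_complexToPlane] at h1
    have h2 := norm_add_le v (complexToPlane w.1)
    have h3 := norm_sub_le (v + complexToPlane w.1) (complexToPlane w.1)
    rw [add_sub_cancel_right] at h3
    constructor <;> linarith
  have hA : IsOpen {v : Euc 2 | 1 / 2 < ‖v‖ ∧ ‖v‖ < 2} :=
    (isOpen_lt continuous_const continuous_norm).inter (isOpen_lt continuous_norm continuous_const)
  have h1 : IsOpenEmbedding fun w : ball (0 : ℂ) (1 / 2) =>
      (⟨v + complexToPlane w.1, hmem w⟩ : ConnSum.Annulus 2) := by
    refine .of_comp _ hA.isOpenEmbedding_subtypeVal ?_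
    exact ((Homeomorph.addLeft v).isOpenEmbedding.comp complexToPlane.isOpenEmbedding).comp
      isOpen_ball.isOpenEmbedding_subtypeVal
  refine hasConjChart_of_ball (by norm_num) (hN.comp h1) ?_ ?_
  · have h0 : v + complexToPlane 0 = v := by
      ext i; fin_cases i <;> simp [complexToPlane, toPlane]
    obtain ⟨h2, h3⟩ := ConnSum.neck_of_one_le (hφ := sphBall_disjoint 2 n) (i := i)
      (ψ := fun _ => torusBall) (hsep := fun j hj => sphBall_two_separated i j hj)
      (v := ⟨v + complexToPlane 0, hmem ⟨0, mem_ball_self (by norm_num)⟩⟩) (by simp only [h0, hv, le_refl])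
    refine h3.trans (congrArg surfInl (Subtype.ext ?_))
    dsimp only
    rw [h0]
  · intro w w' hw
    have hw' : v + complexToPlane w'.1 = discRefl (v + complexToPlane w.1) := by
      rw [hw, complexToPlane_conj, discRefl_add, hvr]
    have hN' : ∀ u u' : ConnSum.Annulus 2, u'.1 = discRefl u.1 → N u' = s (N u) := by
      intro u u' hu
      have hnorm : ‖u'.1‖ = ‖u.1‖ := by rw [hu, norm_discRefl]
      rcases le_total 1 ‖u.1‖ with h | h
      · obtain ⟨h2, h3⟩ := ConnSum.neck_of_one_le (hφ := sphBall_disjoint 2 n) (i := i)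
          (ψ := fun _ => torusBall) (hsep := fun j hj => sphBall_two_separated i j hj) h
        obtain ⟨h4, h5⟩ := ConnSum.neck_of_one_le (hφ := sphBall_disjoint 2 n) (i := i)
          (ψ := fun _ => torusBall) (hsep := fun j hj => sphBall_two_separated i j hj)
          (h.trans_eq hnorm.symm)
        obtain ⟨h6, h7⟩ := hsl ⟨_, h2⟩
        rw [show N u' = _ from h5, show N u = _ from h3, h7]
        refine congrArg surfInl (Subtype.ext ?_)
        dsimp only
        rw [hu, sphRefl_sphBall]
      · obtain ⟨h2, h3⟩ := ConnSum.neck_of_le_one (hφ := sphBall_disjoint 2 n) (i := i)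
          (ψ := fun _ => torusBall) (hsep := fun j hj => sphBall_two_separated i j hj) h
        obtain ⟨h4, h5⟩ := ConnSum.neck_of_le_one (hφ := sphBall_disjoint 2 n) (i := i)
          (ψ := fun _ => torusBall) (hsep := fun j hj => sphBall_two_separated i j hj)
          (hnorm.trans_le h)
        obtain ⟨h6, h7⟩ := hsr i ⟨_, h2⟩
        rw [show N u' = _ from h5, show N u = _ from h3, h7]
        refine congrArg (surfInr i) (Subtype.ext ?_)
        dsimp only
        rw [hnorm, hu, torusRefl_torusBall, discRefl_smul]
    exact hN' _ _ hw'

-- Off the gluing circles a chart of the sphere or of the torus is shrunk until it avoids the closed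
-- balls; on a gluing circle the neck is used.
include hsl hsr in
theorem hasConjChart_genusSurface {x : GenusSurface n} (hx : s x = x) : HasConjChart s x := by
  have hrefl : ∀ (i : Fin n) (v : Euc 2), ‖v‖ = 1 →
      sphRefl ((sphBall 2 i).toFun v) = (sphBall 2 i).toFun v → discRefl v = v := by
    intro i v hv h
    rw [sphRefl_sphBall] at h
    exact (sphBall 2 i).injOn (mem_ball_zero_iff.2 (by rw [norm_discRefl]; linarith))
      (mem_ball_zero_iff.2 (by linarith)) h
  have hleft : ∀ p, s (surfInl p) = surfInl p → HasConjChart s (surfInl p) := by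
    intro p hx
    obtain ⟨h, h1⟩ := hsl p
    rw [h1] at hx
    have hp : sphRefl p.1 = p.1 := congrArg Subtype.val (ConnSum.inl_injective hx)
    by_cases hC : ∃ i : Fin n, p.1 ∈ (sphBall 2 i).closed
    · obtain ⟨i, hi⟩ := hC
      obtain ⟨v, hv, h2⟩ := CoordBall.exists_norm_eq_one hi (p.2 i)
      obtain ⟨p, hp'⟩ := p
      dsimp only at h2 hp
      subst h2
      exact hasConjChart_of_norm_eq_one hsl hsr i hv (hrefl i v hv hp) hp'
    · have hcl : IsClosed (⋃ i : Fin n, (sphBall 2 i).closed) :=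
        isClosed_iUnion_of_finite fun i => (sphBall 2 i).isClosed_closed
      obtain ⟨e, he, h0, hs, hd⟩ := (hasConjChart_sphRefl hp).avoid hcl
        (fun h => hC (mem_iUnion.1 h))
      refine ⟨_, ConnSum.isOpenEmbedding_inl (hφ := sphBall_disjoint 2 n)
        (ψ := fun _ => torusBall) he fun w i h => hd w (mem_iUnion.2 ⟨i, h⟩), ?_, fun w => ?_⟩
      · exact congrArg surfInl (Subtype.ext h0)
      · obtain ⟨h2, h3⟩ := hsl ⟨e w, fun i h => hd w (mem_iUnion.2
          ⟨i, (sphBall 2 i).interior_subset_closed h⟩)⟩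
        exact (congrArg surfInl (Subtype.ext (hs w))).trans h3.symm
  rcases ConnSum.exists_rep x with ⟨p, rfl⟩ | ⟨i, q, rfl⟩
  · exact hleft p hx
  · by_cases hC : q.1 ∈ torusBall.closed
    · obtain ⟨v, hv, h2⟩ := CoordBall.exists_norm_eq_one hC q.2
      have hmem : ∀ j : Fin n, (sphBall 2 i).toFun v ∉ (sphBall 2 j).interior := by
        intro j
        by_cases hij : j = i
        · subst hij
          exact (sphBall 2 j).notMem_interior hv.ge (by linarith)
        · exact fun h => sphBall_two_separated i j hij v (mem_ball_zero_iff.2 (by linarith))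
            ((sphBall 2 j).interior_subset_closed h)
      have h3 : surfInl ⟨_, hmem⟩ = surfInr i q := ConnSum.inl_eq_inr_iff.2 ⟨v, hv, rfl, h2.symm⟩
      change s (surfInr i q) = surfInr i q at hx
      change HasConjChart s (surfInr i q)
      rw [← h3] at hx ⊢
      exact hleft _ hx
    · obtain ⟨h, h1⟩ := hsr i q
      rw [h1] at hx
      have hp : torusRefl q.1 = q.1 := congrArg Subtype.val (ConnSum.inr_injective i hx)
      obtain ⟨e, he, h0, hs, hd⟩ := (hasConjChart_torusRefl hp).avoid torusBall.isClosed_closed hC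
      refine ⟨_, ConnSum.isOpenEmbedding_inr (hφ := sphBall_disjoint 2 n)
        (ψ := fun _ => torusBall) (i := i) he hd, ?_, fun w => ?_⟩
      · exact congrArg (surfInr i) (Subtype.ext h0)
      · obtain ⟨h2, h3⟩ := hsr i ⟨e w, fun h => hd w (torusBall.interior_subset_closed h)⟩
        exact (congrArg (surfInr i) (Subtype.ext (hs w))).trans h3.symm

/-! ### Paths to the fixed points -/

-- In the plane without the open unit discs about the points `3i`, moving vertically away from the
-- axis increases the distance to all centres. At height `b + 1 / b`, of absolute value at least
-- `1`, one passes all discs horizontally to abscissa `-2`, and there one descends to the axis,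
-- which the reflection fixes. The pole is itself fixed.
include hsl in
theorem exists_joined_inl (p : {x : Sph 2 // ∀ i : Fin n, x ∉ (sphBall 2 i).interior}) :
    ∃ x, s x = x ∧ Joined (surfInl p) x := by
  by_cases hp : p.1 = northPole 2
  · refine ⟨_, ?_, Joined.refl _⟩
    obtain ⟨h, h1⟩ := hsl p
    rw [h1]
    exact congrArg surfInl (Subtype.ext ((congrArg sphRefl hp).trans (sphRefl_northPole.trans hp.symm)))
  · let P : Set (ℝ × ℝ) := {q | ∀ i : Fin n, 1 ≤ (q.1 - 3 * (i : ℕ)) ^ 2 + q.2 ^ 2}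
    have hP : ∀ q, q ∈ P ↔ ∀ i : Fin n, planeChart 0 q ∉ (sphBall 2 i).interior := by
      intro q
      refine forall_congr' fun i => ?_
      rw [sphBall_two_interior, planeChart_shift 0 (3 * (i : ℕ)),
        (planeChart_injective _).mem_set_image, mem_ofPred_eq, not_lt, planeNorm, Real.one_le_sqrt,
        zero_sub, neg_add_eq_sub]
    obtain ⟨y, hy⟩ := exists_stereoInv_eq hp
    have hy' : planeChart 0 (y 0, y 1) = p.1 := by
      rw [← hy]
      refine congrArg stereoInv ?_
      ext i; fin_cases i <;> simp [toPlane]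
    have hq : (y 0, y 1) ∈ P := (hP _).2 fun i => by
      rw [hy']
      exact p.2 i
    let c : P → GenusSurface n := fun q => surfInl ⟨planeChart 0 q.1, (hP _).1 q.2⟩
    have hc : Continuous c := ConnSum.continuous_inl.comp
      (((continuous_planeChart 0).comp continuous_subtype_val).subtype_mk _)
    have hpath : ∃ a : ℝ, ∃ h : (a, (0 : ℝ)) ∈ P, JoinedIn P (y 0, y 1) (a, 0) := by
      generalize y 0 = a, y 1 = b at hq
      rcases eq_or_ne b 0 with rfl | hb
      · exact ⟨a, hq, JoinedIn.refl hq⟩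
      have hb2 : b * (1 / b) = 1 := by field_simp
      have hB : 1 ≤ (b + 1 / b) ^ 2 := by nlinarith [sq_nonneg b, sq_nonneg (1 / b)]
      have h2 : ∀ i : Fin n, (1 : ℝ) ≤ (-2 - 3 * (i : ℕ)) ^ 2 := fun i => by
        have : (0 : ℝ) ≤ (i : ℕ) := Nat.cast_nonneg _
        nlinarith
      refine ⟨-2, fun i => by simpa using h2 i, (JoinedIn.of_segment_subset (y := (a, b + 1 / b)) ?_).trans
        ((JoinedIn.of_segment_subset (y := (-2, b + 1 / b)) ?_).trans
          (JoinedIn.of_segment_subset ?_))⟩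
      · rintro _ ⟨u, v, hu, hv, huv, rfl⟩ i
        have h3 : u * a + v * a = a := by rw [← add_mul, huv, one_mul]
        have h4 : u * b + v * (b + 1 / b) = b + v * (1 / b) := by
          linear_combination b * huv
        have h5 := hq i
        simp only [Prod.smul_mk, Prod.mk_add_mk, smul_eq_mul, h3, h4] at h5 ⊢
        nlinarith [sq_nonneg (v * (1 / b))]
      · rintro _ ⟨u, v, hu, hv, huv, rfl⟩ i
        have h3 : u * (b + 1 / b) + v * (b + 1 / b) = b + 1 / b := by rw [← add_mul, huv, one_mul]
        simp only [Prod.smul_mk, Prod.mk_add_mk, smul_eq_mul, h3]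
        nlinarith [sq_nonneg (u * a + v * -2 - 3 * (i : ℕ))]
      · rintro _ ⟨u, v, hu, hv, huv, rfl⟩ i
        have h3 : u * (-2) + v * (-2) = -2 := by rw [← add_mul, huv, one_mul]
        simp only [Prod.smul_mk, Prod.mk_add_mk, smul_eq_mul, h3]
        nlinarith [h2 i, sq_nonneg (u * (b + 1 / b) + v * 0)]
    obtain ⟨a, ha, hj⟩ := hpath
    refine ⟨c ⟨(a, 0), ha⟩, ?_, ?_⟩
    · obtain ⟨h, h1⟩ := hsl ⟨planeChart 0 (a, 0), (hP _).1 ha⟩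
      refine h1.trans (congrArg surfInl (Subtype.ext ?_))
      dsimp only
      rw [sphRefl_planeChart, planeRefl, neg_zero]
    · have := hj.joined_subtype.map hc
      convert! this
      exact hy'.symm

/-- An angle of size at most `π` and one of size less than `1` differ by less than `2π`, so they
agree as soon as their exponentials do. -/
theorem torusChart_mem_interior_iff {q : ℝ × ℝ} (h1 : |q.1| ≤ Real.pi) (h2 : |q.2| ≤ Real.pi) :
    torusChart q ∈ torusBall.interior ↔ q.1 ^ 2 + q.2 ^ 2 < 1 := by
  have key : ∀ a b : ℝ, |a| ≤ Real.pi → |b| < 1 → Circle.exp b = Circle.exp a → b = a := by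
    intro a b ha hb h
    obtain ⟨m, hm⟩ := Circle.exp_eq_exp.1 h
    have hpi := Real.pi_gt_three
    rw [abs_le] at ha
    rw [abs_lt] at hb
    have h1 : (m : ℝ) < 1 := by nlinarith
    have h2 : (-1 : ℝ) < m := by nlinarith
    have h3 : m = 0 := by
      norm_cast at h1 h2
      have : -1 < m := by exact_mod_cast h2
      omega
    simpa [h3] using hm
  have hlt : ∀ p : ℝ × ℝ, planeNorm p < 1 ↔ p.1 ^ 2 + p.2 ^ 2 < 1 := fun p => by
    rw [planeNorm, Real.sqrt_lt' one_pos, one_pow]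
  rw [torusBall_interior]
  constructor
  · rintro ⟨p, hp, h⟩
    have hp' := (hlt p).1 hp
    have h3 := key q.1 p.1 h1 (abs_lt_of_sq_lt_sq (by nlinarith [sq_nonneg p.2]) zero_le_one)
      (congrArg Prod.fst h)
    have h4 := key q.2 p.2 h2 (abs_lt_of_sq_lt_sq (by nlinarith [sq_nonneg p.1]) zero_le_one)
      (congrArg Prod.snd h)
    rwa [h3, h4] at hp'
  · exact fun h => ⟨q, (hlt q).2 h, rfl⟩

-- The second angle is moved away from `0` to `±π`, where its exponential `-1` is its own inverse.
-- Its absolute value never decreases, so the path does not enter the removed disc.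
include hsr in
theorem exists_joined_inr (i : Fin n) (q : {x : Circle × Circle // x ∉ torusBall.interior}) :
    ∃ x, s x = x ∧ Joined (surfInr i q) x := by
  let P : Set (ℝ × ℝ) := {q | |q.1| ≤ Real.pi ∧ |q.2| ≤ Real.pi ∧ 1 ≤ q.1 ^ 2 + q.2 ^ 2}
  have hP : ∀ q ∈ P, torusChart q ∉ torusBall.interior := fun q hq => by
    rw [torusChart_mem_interior_iff hq.1 hq.2.1, not_lt]
    exact hq.2.2
  obtain ⟨p, hp, hpq⟩ : ∃ p ∈ P, torusChart p = q.1 := by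
    have harg : ∀ z : Circle, |Complex.arg z| ≤ Real.pi := fun z => Complex.abs_arg_le_pi _
    have hpq : torusChart (Complex.arg q.1.1, Complex.arg q.1.2) = q.1 :=
      Prod.ext (Circle.exp_arg _) (Circle.exp_arg _)
    refine ⟨_, ⟨harg q.1.1, harg q.1.2, not_lt.1 fun h => q.2 ?_⟩, hpq⟩
    rw [← hpq]
    exact (torusChart_mem_interior_iff (harg _) (harg _)).2 h
  let c : P → GenusSurface n := fun q => surfInr i ⟨torusChart q.1, hP _ q.2⟩
  have hc : Continuous c := (ConnSum.continuous_inr i).comp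
    ((continuous_torusChart.comp continuous_subtype_val).subtype_mk _)
  obtain ⟨T, hT, hT'⟩ : ∃ T : ℝ, |T| = Real.pi ∧ 0 ≤ p.2 * (T - p.2) := by
    have h2 := abs_le.1 hp.2.1
    rcases le_total 0 p.2 with h | h
    · exact ⟨Real.pi, abs_of_pos Real.pi_pos, mul_nonneg h (by linarith)⟩
    · exact ⟨-Real.pi, by rw [abs_neg, abs_of_pos Real.pi_pos],
        mul_nonneg_of_nonpos_of_nonpos h (by linarith)⟩
  have hseg : segment ℝ p (p.1, T) ⊆ P := by
    rintro _ ⟨u, v, hu, hv, huv, rfl⟩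
    have h3 : u * p.1 + v * p.1 = p.1 := by rw [← add_mul, huv, one_mul]
    have h4 : u * p.2 + v * T = p.2 + v * (T - p.2) := by linear_combination p.2 * huv
    refine ⟨?_, ?_, ?_⟩
    · simpa [h3] using hp.1
    · have h5 := abs_le.1 hp.2.1
      have h6 := abs_le.1 hT.le
      simp only [Prod.snd_add, Prod.smul_snd, smul_eq_mul]
      rw [abs_le]
      constructor <;> nlinarith
    · have h5 := hp.2.2
      simp only [Prod.snd_add, Prod.smul_snd, Prod.fst_add, Prod.smul_fst, smul_eq_mul, h3, h4]
      nlinarith [sq_nonneg (v * (T - p.2)), mul_nonneg hv hT']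
  have hTP : (p.1, T) ∈ P := hseg (right_mem_segment ℝ _ _)
  refine ⟨c ⟨(p.1, T), hTP⟩, ?_, ?_⟩
  · obtain ⟨h, h1⟩ := hsr i ⟨torusChart (p.1, T), hP _ hTP⟩
    refine h1.trans (congrArg (surfInr i) (Subtype.ext (Prod.ext rfl ?_)))
    change (Circle.exp T)⁻¹ = Circle.exp T
    refine Circle.ext_re_im (Circle.re_inv _) ?_
    have : Real.sin T = 0 := by
      rcases (abs_eq Real.pi_pos.le).1 hT with rfl | rfl <;> simp
    rw [Circle.im_inv, Circle.im_exp, this, neg_zero]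
  · have := (JoinedIn.of_segment_subset hseg).joined_subtype.map hc
    convert! this
    exact hpq.symm

include hsl hsr in
theorem exists_joined_genusSurface (x : GenusSurface n) : ∃ y, s y = y ∧ Joined x y := by
  rcases ConnSum.exists_rep x with ⟨p, rfl⟩ | ⟨i, q, rfl⟩
  exacts [exists_joined_inl hsl p, exists_joined_inr hsr i q]

end Surface

end

/-! ### The branched covering of the connected sum -/

theorem mainTheorem11 (n : ℕ) {S N : Type*} [TopologicalSpace S] [TopologicalSpace N]
    (hS : Nonempty (S ≃ₜ GenusSurface n)) (hN : Nonempty (N ≃ₜ ConnSumSphCircle n)) :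
    ∃ f : C(S × Circle, N), IsBranchedDoubleCovering f ∧ PiOneSurjective f := by
  obtain ⟨hS⟩ := hS
  obtain ⟨hN⟩ := hN
  obtain ⟨G, hG, hGb⟩ := exists_fold_punctured_sphere n
  obtain ⟨H, hH, hHb⟩ := exists_fold_punctured_torus
  obtain ⟨s, f, hs, hss, hsl, hsr, hf, hff⟩ := ConnSum.exists_fold (sphBall_disjoint 2 n)
    (sphBall_disjoint 3 n) continuous_sphRefl sphRefl_involutive continuous_torusRefl
    torusRefl_involutive hG hH hGb hHb (fun i v _ => sphRefl_sphBall i v)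
    fun v _ => torusRefl_torusBall v
  have hsl' : ∀ x, ∃ h, s (surfInl x) = surfInl ⟨sphRefl x.1, h⟩ := fun x => ⟨_, hsl x⟩
  have hsr' : ∀ i y, ∃ h, s (surfInr i y) = surfInr i ⟨torusRefl y.1, h⟩ :=
    fun i y => ⟨_, hsr i y⟩
  have : CompactSpace S := hS.symm.compactSpace
  have : T2Space S := hS.symm.t2Space
  have : T2Space N := hN.symm.t2Space
  let h : S × Circle ≃ₜ GenusSurface n × Circle := hS.prodCongr (Homeomorph.refl Circle)
  let τ : S × Circle → S × Circle := fun p => (hS.symm (s (hS p.1)), p.2⁻¹)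
  let g : C(S × Circle, N) := ⟨fun p => hN.symm (f (h p)), by fun_prop⟩
  have hgg : ∀ p q, g p = g q ↔ q = p ∨ q = τ p := by
    intro p q
    change hN.symm (f (h p)) = hN.symm (f (h q)) ↔ _
    rw [hN.symm.injective.eq_iff, hff, h.injective.eq_iff, ← h.injective.eq_iff (b := τ p)]
    have : h (τ p) = (s (h p).1, (h p).2⁻¹) :=
      Prod.ext (hS.apply_symm_apply (s (hS p.1))) rfl
    rw [this]
  have hfix : ∀ p, τ p = p → s (hS p.1) = hS p.1 ∧ p.2⁻¹ = p.2 := fun p hp =>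
    ⟨hS.symm_apply_eq.1 (congrArg Prod.fst hp), congrArg Prod.snd hp⟩
  have hbr : IsBranchedDoubleCovering g := by
    refine isBranchedDoubleCovering_of_involution τ (by fun_prop) (fun p => ?_) g
      (hN.symm.surjective.comp (hf.comp h.surjective)) hgg fun p hp => ?_
    · refine Prod.ext ?_ (inv_inv p.2)
      change hS.symm (s (hS (hS.symm (s (hS p.1))))) = p.1
      rw [hS.apply_symm_apply, hss, hS.symm_apply_apply]
    · obtain ⟨h1, h2⟩ := hfix p hp
      obtain ⟨e, he, he0, hes⟩ := (hasConjChart_genusSurface hsl' hsr' h1).prod_circle h2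
      refine ⟨h.symm ∘ e, h.symm.isOpenEmbedding.comp he, ?_, fun z t => ?_⟩
      · rw [Function.comp, he0]
        exact h.symm_apply_apply p
      · rw [Function.comp, hes]
        refine Prod.ext ?_ rfl
        change hS.symm (s (e (z, t)).1) = hS.symm (s (hS (hS.symm (e (z, t)).1)))
        rw [hS.apply_symm_apply]
  refine ⟨g, hbr, hbr.piOneSurjective fun p => ?_⟩
  obtain ⟨y, hy, hxy⟩ := exists_joined_genusSurface hsl' hsr' (hS p.1)
  -- A fixed point of `s` paired with `1` is fixed by `τ`, hence alone in its fibre.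
  have h1 : τ (hS.symm y, 1) = (hS.symm y, 1) := by
    refine Prod.ext ?_ inv_one
    change hS.symm (s (hS (hS.symm y))) = hS.symm y
    rw [hS.apply_symm_apply, hy]
  refine ⟨(hS.symm y, 1), ?_, fun q hq => ?_⟩
  · have h2 := hxy.map hS.symm.continuous
    rw [hS.symm_apply_apply] at h2
    exact h2.prod (PathConnectedSpace.joined _ _)
  · rcases (hgg _ _).1 hq.symm with h2 | h2
    · exact h2
    · rw [h2, h1]
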